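/- **Model.** Let $\Omega\subset\mathbb R_{\ge 0}$ be finite, $d$ a probability distribution on $\Omega$, $\mathcal H_g$ a Hilbert space, and $|0\rangle|0\rangle$ a fixed product of unit vectors of $\mathcal H_g$ and $\mathcal H_\Omega=\mathbb C^\Omega$. A *quantum sampler* for $d$ is a unitary $\mathcal S$ on $\mathcal H_g\otimes\mathcal H_\Omega$ with $\mathcal S(|0\rangle|0\rangle)=\sum_{x\in\Omega}\sqrt{d(x)}\,|\psi_x\rangle|x\rangle$ for some unit vectors $|\psi_x\rangle$. A *quantum sample* is one execution of $\mathcal S$ or $\mathcal S^{-1}$, possibly controlled. Put $\mu=\sum_x x\,d(x)$ and $\phi=(\sum_x x^2d(x))^{1/2}$. Throughout $0<L<H$, $0<\varepsilon,\delta<1/2$, and $\log=\log_2$ except in the number of repetitions below, where $\ln$ is written. **Basic estimation** $\mathrm{BasicEst}((a,b),t,\delta)$. Let $R_{a,b}$ be a unitary on $\mathcal H_\Omega\otimes\mathbb C^2$ with $|x\rangle|0\rangle\mapsto|x\rangle(\sqrt{1-\nu_x}|0\rangle+\sqrt{\nu_x}|1\rangle)$, where $\nu_x=x/b$ if $a\le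 x<b$ and $\nu_x=0$ otherwise, and put $U=(I\otimes R_{a,b})(\mathcal S\otimes I)$, $\Pi=I\otimes I\otimes|1\rangle\langle1|$. Amplitude estimation runs phase estimation, with a $t$-dimensional phase register, of $U(2|0\rangle\langle 0|-I)U^{-1}(I-2\Pi)$ on $U|0\rangle$, measures $y\in\{0,\dots,t-1\}$ and returns $\sin^2(\pi y/t)$; it uses $2t+1$ quantum samples. Return the median of $2\lceil 12\ln(1/\delta)\rceil+1$ independent amplitude estimations. **Summation** $\mathrm{SApprox}(\Gamma,t,\delta)$. With $k=\lceil\log t\rceil-1$ and $t_0=\lceil3\pi^2t\sqrt{\log t}\rceil$, let $\tilde p_0=\mathrm{BasicEst}((0,\Gamma),t_0,\tfrac{\delta}{k+1})$ and $\tilde p_\ell=\mathrm{BasicEst}((2^{\ell-1}\Gamma,2^\ell\Gamma),t_0,\tfrac{\delta}{k+1})$ for $1\le\ell\le k$. Return $\sum_{\ell=0}^k2^\ell\Gamma\,\tilde p_\ell$. **Explicit bound** $\mathrm{EpsApprox}(\Delta,L,H,\varepsilon,\delta)$, for an integer $\Delta\ge1$. Set $M=8H$, $\tilde p=0$. While $\tilde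 p=0$ and $M\ge2L$: set $M\leftarrow M/2$, $\tilde p\leftarrow\mathrm{BasicEst}((0,M\Delta^2),25\Delta,\tfrac{\delta}{2(3+\log(H/L))})$. If $M<2L$ return $0$, else return $\mathrm{SApprox}(M\Delta,\lceil51^2\varepsilon^{-1}\Delta\rceil,\delta/2)$. **Algorithm EpsApproxDec** (input $\mathcal S,f,L,H,\varepsilon,\delta$). For real $y$ let $\langle y\rangle=\max(1,\lceil y\rceil)$. Set $M=2H$, $m=0$. While $m<M/6$ and $M\ge L/2$: set $M\leftarrow M/2$, $m\leftarrow\mathrm{EpsApprox}(\langle f(M)\rangle,L,H,\tfrac56,\tfrac{\delta}{2(2+\log(H/L))})$. If $M<L/2$ output $0$, else output $\mathrm{EpsApprox}(\langle f(M/(6(1+2\pi)^2))\rangle,L,H,\varepsilon,\delta/2)$. **Theorem.** There are absolute constants $C>0$ and $k\in\mathbb N$ such that the following holds for every sampler $\mathcal S$ and every function $f$ that is non-increasing on $(0,\infty)$ and satisfies $f(\mu)\ge\phi/\mu$ (no condition if $\mu=0$). Let $\tilde\mu$ be the output and $N$ the number of quantum samples used by EpsApproxDec. 1. If $L\le\mu<H$,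 then $|\tilde\mu-\mu|\le\varepsilon\mu$ with probability at least $1-\delta$. 2. For any $0<L<H$, $\tilde\mu\le(1+2\pi)^2\mu$ with probability at least $1-\delta$. 3. If $\mu<H$ (for any $0<L<H$), there is a random variable $T\in\{1,2,\dots\}$, defined on the same probability space, with $\Pr(T=1)\ge1-\delta$ and $\Pr(T=\ell)\le\delta^\ell$ for all $\ell>1$, such that always $$N\le C\,X\,h\,\bigl(\log(2+X)\bigr)^k,\qquad X=\max\Bigl(1,f\Bigl(\tfrac{\max(L/4,\,2^{-T}\mu)}{6(1+2\pi)^2}\Bigr)\Bigr)\cdot\varepsilon^{-1}\cdot h\cdot\log(1/\delta),\quad h=\max(1,\log(H/L)).$$ That is, up to polylogarithmic factors, in $X$ and in $H/L$, the algorithm uses $f\bigl(\max(L/4,2^{-T}\mu)/(6(1+2\pi)^2)\bigr)\,\varepsilon^{-1}\log(H/L)\log(1/\delta)$ quantum samples. (If $L\le\mu$ the maximum with $1$ has no effect.) -/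

import Mathlib

open scoped NNReal ENNReal

noncomputable section

namespace QuantumMean

/-! ### Hilbert spaces and elementary unitaries -/

section Unitaries

variable {E : Type*} [NormedAddCommGroup E] [InnerProductSpace ℂ E]
variable {ι κ : Type*} [Fintype ι] [Fintype κ]

theorem matAct_aux [DecidableEq ι] (A B : Matrix ι ι ℂ) (h : A * B = 1)
    (v : PiLp 2 (fun _ : ι => E)) (i : ι) :
    ∑ j, A i j • ∑ k, B j k • v k = v i := by
  have h1 : ∀ k, ∑ j, A i j * B j k = (1 : Matrix ι ι ℂ) i k := fun k => by
    rw [← h, Matrix.mul_apply]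
  simp_rw [Finset.smul_sum, smul_smul]
  rw [Finset.sum_comm]
  simp_rw [← Finset.sum_smul, h1, Matrix.one_apply, ite_smul, one_smul, zero_smul]
  simp

/-- The operator `A ⊗ I` on `ℂ^ι ⊗ E`, for a unitary matrix `A`; the Hilbert space `ℂ^ι ⊗ E` is
represented as the `ℓ²`-sum of `ι` copies of `E`. -/
def matAct [DecidableEq ι] (A : Matrix.unitaryGroup ι ℂ) :
    PiLp 2 (fun _ : ι => E) ≃ₗᵢ[ℂ] PiLp 2 (fun _ : ι => E) where
  toFun v := WithLp.toLp 2 fun i => ∑ j, A.1 i j • v j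
  invFun v := WithLp.toLp 2 fun i => ∑ j, (star A.1) i j • v j
  map_add' v w := by
    ext i
    simp [smul_add, Finset.sum_add_distrib]
  map_smul' c v := by
    ext i
    simp only [PiLp.smul_apply, RingHom.id_apply, Finset.smul_sum]
    exact Finset.sum_congr rfl fun j _ => smul_comm _ _ _
  left_inv v := by
    ext i
    exact matAct_aux (star A.1) A.1 (Matrix.mem_unitaryGroup_iff'.1 A.2) v i
  right_inv v := by
    ext i
    exact matAct_aux A.1 (star A.1) (Matrix.mem_unitaryGroup_iff.1 A.2) v i
  norm_map' v := by
    let w : PiLp 2 (fun _ : ι => E) := WithLp.toLp 2 fun i => ∑ j, A.1 i j • v j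
    have hw : ∀ j, ∑ i, (star A.1) j i • w i = v j := fun j =>
      matAct_aux (star A.1) A.1 (Matrix.mem_unitaryGroup_iff'.1 A.2) v j
    have hinner : inner ℂ w w = inner ℂ v v := by
      calc inner ℂ w w = ∑ i, inner ℂ (w i) (w i) := PiLp.inner_apply _ _
        _ = ∑ i, ∑ j, (star A.1) j i * inner ℂ (v j) (w i) := by
            refine Finset.sum_congr rfl fun i _ => ?_
            change inner ℂ (∑ j, A.1 i j • v j) (w i) = _
            rw [sum_inner]
            refine Finset.sum_congr rfl fun j _ => ?_
            rw [inner_smul_left, Matrix.star_apply]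
            rfl
        _ = ∑ j, inner ℂ (v j) (∑ i, (star A.1) j i • w i) := by
            rw [Finset.sum_comm]
            refine Finset.sum_congr rfl fun j _ => ?_
            rw [inner_sum]
            exact Finset.sum_congr rfl fun i _ => (inner_smul_right _ _ _).symm
        _ = ∑ j, inner ℂ (v j) (v j) := by simp_rw [hw]
        _ = inner ℂ v v := (PiLp.inner_apply _ _).symm
    change ‖w‖ = ‖v‖
    rw [inner_self_eq_norm_sq_to_K, inner_self_eq_norm_sq_to_K] at hinner
    have h2 : ‖w‖ ^ 2 = ‖v‖ ^ 2 := by exact_mod_cast hinner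
    exact (pow_left_inj₀ (norm_nonneg _) (norm_nonneg _) two_ne_zero).1 h2

/-- The canonical identification `ℂ^ι ⊗ ℂ^κ ⊗ E = ℂ^κ ⊗ ℂ^ι ⊗ E`. -/
def swapReg : PiLp 2 (fun _ : ι => PiLp 2 (fun _ : κ => E)) ≃ₗᵢ[ℂ]
    PiLp 2 (fun _ : κ => PiLp 2 (fun _ : ι => E)) where
  toFun v := WithLp.toLp 2 fun k => WithLp.toLp 2 fun i => v i k
  invFun v := WithLp.toLp 2 fun i => WithLp.toLp 2 fun k => v k i
  map_add' _ _ := rfl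
  map_smul' _ _ := rfl
  left_inv _ := rfl
  right_inv _ := rfl
  norm_map' v := by
    refine (pow_left_inj₀ (norm_nonneg _) (norm_nonneg _) two_ne_zero).1 ?_
    rw [PiLp.norm_sq_eq_of_L2, PiLp.norm_sq_eq_of_L2]
    simp_rw [PiLp.norm_sq_eq_of_L2]
    exact Finset.sum_comm

theorem matAct_apply [DecidableEq ι] (A : Matrix.unitaryGroup ι ℂ) (v : PiLp 2 (fun _ : ι => E))
    (i : ι) : matAct A v i = ∑ j, A.1 i j • v j := rfl

theorem swapReg_apply (v : PiLp 2 (fun _ : ι => PiLp 2 (fun _ : κ => E))) (k : κ) (i : ι) :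
    swapReg v k i = v i k := rfl

/-- The reflection `2|u⟩⟨u| - I` through a unit vector `u`. -/
def reflectThrough (u : E) : E ≃ₗᵢ[ℂ] E := (Submodule.span ℂ {u}).reflection

end Unitaries

/-- The discrete Fourier transform `|j⟩ ↦ t^{-1/2} ∑_y exp(2πi j y / t) |y⟩` of `ℂ^t`. -/
def fourierMatrix (t : ℕ+) : Matrix (Fin t) (Fin t) ℂ := fun y j =>
  (((Real.sqrt (t : ℕ))⁻¹ : ℝ) : ℂ) *
    Complex.exp (2 * Real.pi * Complex.I / (t : ℕ)) ^ ((j : ℕ) * (y : ℕ))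

theorem fourierMatrix_mem (t : ℕ+) : fourierMatrix t ∈ Matrix.unitaryGroup (Fin t) ℂ := by
  have ht : ((t : ℕ) : ℂ) ≠ 0 := Nat.cast_ne_zero.2 t.ne_zero
  have hζ := Complex.isPrimitiveRoot_exp (t : ℕ) t.ne_zero
  set ζ := Complex.exp (2 * Real.pi * Complex.I / (t : ℕ)) with hζdef
  have hc : (starRingEnd ℂ) ζ = ζ⁻¹ := by
    have hn : ‖ζ‖ = 1 := hζ.norm'_eq_one t.ne_zero
    rw [Complex.inv_def, Complex.normSq_eq_norm_sq, hn]
    simp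
  have hs : (((Real.sqrt (t : ℕ))⁻¹ : ℝ) : ℂ) * (((Real.sqrt (t : ℕ))⁻¹ : ℝ) : ℂ) =
      ((t : ℕ) : ℂ)⁻¹ := by
    rw [← Complex.ofReal_mul, ← mul_inv, Real.mul_self_sqrt (Nat.cast_nonneg _)]
    simp
  have hz : ζ ≠ 0 := hζ.ne_zero t.ne_zero
  rw [Matrix.mem_unitaryGroup_iff]
  ext y y'
  rw [Matrix.mul_apply]
  have hterm : ∀ j : Fin t, fourierMatrix t y j * (star (fourierMatrix t)) j y' =
      ((t : ℕ) : ℂ)⁻¹ * (ζ ^ ((y : ℤ) - (y' : ℤ))) ^ (j : ℕ) := by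
    intro j
    rw [Matrix.star_apply]
    simp only [fourierMatrix, ← hζdef]
    rw [RCLike.star_def, map_mul, map_pow, hc, Complex.conj_ofReal, mul_mul_mul_comm, hs,
      zpow_sub₀ hz, div_pow, inv_pow, div_eq_mul_inv, zpow_natCast, zpow_natCast, ← pow_mul,
      ← pow_mul, mul_comm (y : ℕ), mul_comm (y' : ℕ)]
  simp_rw [hterm, ← Finset.mul_sum]
  rw [Fin.sum_univ_eq_sum_range (fun i => (ζ ^ ((y : ℤ) - (y' : ℤ))) ^ i) (t : ℕ)]
  by_cases hy : y = y'
  · subst hy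
    simp [ht]
  · have h1 : ζ ^ ((y : ℤ) - (y' : ℤ)) ≠ 1 := by
      intro h
      rw [hζ.zpow_eq_one_iff_dvd] at h
      have hlt : |(y : ℤ) - (y' : ℤ)| < (t : ℕ) := by
        have := y.2
        have := y'.2
        rw [abs_lt]
        constructor <;> omega
      have := Int.eq_zero_of_abs_lt_dvd h hlt
      exact hy (Fin.ext (by omega))
    rw [geom_sum_eq h1, ← zpow_natCast, zpow_comm, zpow_natCast, hζ.pow_eq_one, one_zpow]
    simp [hy]

def fourier (t : ℕ+) : Matrix.unitaryGroup (Fin t) ℂ := ⟨fourierMatrix t, fourierMatrix_mem t⟩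

/-! ### Quantum samplers -/

section Sampler

variable (G : Type*) [NormedAddCommGroup G] [InnerProductSpace ℂ G] (Ω : Finset ℝ≥0)

/-- `G ⊗ H_Ω`: the garbage register `G` together with the register whose basis is `Ω`. -/
abbrev Reg := PiLp 2 (fun _ : Ω => G)

/-- `G ⊗ H_Ω ⊗ ℂ²`. -/
abbrev Work := PiLp 2 (fun _ : Fin 2 => Reg G Ω)

/-- `ℂ^t ⊗ G ⊗ H_Ω ⊗ ℂ²`: the work space together with a `t`-dimensional phase register. -/
abbrev Machine (t : ℕ+) := PiLp 2 (fun _ : Fin t => Work G Ω)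

/-- The blank states `|0⟩` of the garbage register and of the register `H_Ω`. -/
structure Blank where
  garbage : G
  norm_garbage : ‖garbage‖ = 1
  sample : EuclideanSpace ℂ Ω
  norm_sample : ‖sample‖ = 1

variable {G Ω}

/-- The state `|0⟩|0⟩` of `G ⊗ H_Ω`. -/
def Blank.state (B : Blank G Ω) : Reg G Ω := WithLp.toLp 2 fun x => B.sample x • B.garbage

/-- The state `|0⟩|0⟩|0⟩` of `G ⊗ H_Ω ⊗ ℂ²`. -/
def Blank.work (B : Blank G Ω) : Work G Ω := PiLp.single 2 0 B.state

/-- The state of the machine with all registers blank. -/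
def Blank.machine (B : Blank G Ω) (t : ℕ+) : Machine G Ω t := PiLp.single 2 0 B.work

theorem Blank.norm_machine (B : Blank G Ω) (t : ℕ+) : ‖B.machine t‖ = 1 := by
  have hs : ‖B.state‖ = 1 := by
    refine (pow_left_inj₀ (norm_nonneg _) zero_le_one two_ne_zero).1 ?_
    rw [PiLp.norm_sq_eq_of_L2, one_pow]
    simp only [Blank.state, norm_smul, B.norm_garbage, mul_one]
    rw [← EuclideanSpace.norm_sq_eq, B.norm_sample, one_pow]
  rw [Blank.machine, PiLp.norm_single, Blank.work, PiLp.norm_single, hs]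

/-- `S` is a quantum sampler for the distribution `d` on `Ω`:
`S |0⟩|0⟩ = ∑_x √(d x) |ψ_x⟩|x⟩` for some unit vectors `ψ_x`. -/
def IsSampler (B : Blank G Ω) (S : Reg G Ω ≃ₗᵢ[ℂ] Reg G Ω) (d : PMF Ω) : Prop :=
  ∃ ψ : Ω → G, (∀ x, ‖ψ x‖ = 1) ∧
    S B.state = WithLp.toLp 2 fun x => ((Real.sqrt (d x).toReal : ℝ) : ℂ) • ψ x

end Sampler

/-- The mean `μ` of the output of a sampler for `d`. -/
def mean {Ω : Finset ℝ≥0} (d : PMF Ω) : ℝ := ∑ x : Ω, (d x).toReal * ((x : ℝ≥0) : ℝ)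

/-- The square root `φ` of the second moment of the output of a sampler for `d`. -/
def phi {Ω : Finset ℝ≥0} (d : PMF Ω) : ℝ :=
  Real.sqrt (∑ x : Ω, (d x).toReal * ((x : ℝ≥0) : ℝ) ^ 2)

/-! ### Bernoulli samplers -/

/-- `x / b` if `a ≤ x < b`, and `0` otherwise. -/
def nu (a b : ℝ) (x : ℝ≥0) : ℝ := if a ≤ x ∧ (x : ℝ) < b then x / b else 0

theorem nu_nonneg (a b : ℝ) (x : ℝ≥0) : 0 ≤ nu a b x := by
  unfold nu
  split_ifs with h
  · exact div_nonneg x.2 (x.2.trans h.2.le)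
  · exact le_rfl

theorem nu_le_one (a b : ℝ) (x : ℝ≥0) : nu a b x ≤ 1 := by
  unfold nu
  split_ifs with h
  · exact div_le_one_of_le₀ h.2.le (x.2.trans h.2.le)
  · exact zero_le_one

/-- The rotation of the qubit with `|0⟩ ↦ √(1 - ν) |0⟩ + √ν |1⟩`, where `ν = nu a b x`. -/
def rotMatrix (a b : ℝ) (x : ℝ≥0) : Matrix (Fin 2) (Fin 2) ℂ :=
  !![((Real.sqrt (1 - nu a b x) : ℝ) : ℂ), -((Real.sqrt (nu a b x) : ℝ) : ℂ);
     ((Real.sqrt (nu a b x) : ℝ) : ℂ), ((Real.sqrt (1 - nu a b x) : ℝ) : ℂ)]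

theorem rotMatrix_mem (a b : ℝ) (x : ℝ≥0) :
    rotMatrix a b x ∈ Matrix.unitaryGroup (Fin 2) ℂ := by
  have h0 := nu_nonneg a b x
  have h1 := nu_le_one a b x
  have e0 : ((Real.sqrt (nu a b x) : ℝ) : ℂ) * ((Real.sqrt (nu a b x) : ℝ) : ℂ) =
      ((nu a b x : ℝ) : ℂ) := by
    rw [← Complex.ofReal_mul, Real.mul_self_sqrt h0]
  have e1 : ((Real.sqrt (1 - nu a b x) : ℝ) : ℂ) * ((Real.sqrt (1 - nu a b x) : ℝ) : ℂ) =
      ((1 - nu a b x : ℝ) : ℂ) := by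
    rw [← Complex.ofReal_mul, Real.mul_self_sqrt (by linarith)]
  rw [Matrix.mem_unitaryGroup_iff]
  ext i j
  fin_cases i <;> fin_cases j <;>
    simp [rotMatrix, Matrix.mul_apply, Fin.sum_univ_two, Matrix.star_apply, e0, e1, mul_comm]

def rot (a b : ℝ) (x : ℝ≥0) : Matrix.unitaryGroup (Fin 2) ℂ :=
  ⟨rotMatrix a b x, rotMatrix_mem a b x⟩

section Circuits

variable {G : Type*} [NormedAddCommGroup G] [InnerProductSpace ℂ G] {Ω : Finset ℝ≥0}

/-- `I ⊗ R_{a,b}` on `G ⊗ H_Ω ⊗ ℂ²`, where `R_{a,b}` is the Bernoulli sampler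
`|x⟩|0⟩ ↦ |x⟩(√(1 - ν_x) |0⟩ + √ν_x |1⟩)`. -/
def bernoulliGate (a b : ℝ) : Work G Ω ≃ₗᵢ[ℂ] Work G Ω :=
  (swapReg.trans (LinearIsometryEquiv.piLpCongrRight 2 fun x : Ω => matAct (rot a b x))).trans
    swapReg

theorem bernoulliGate_blank (a b : ℝ) (v : Reg G Ω) (x : Ω) :
    bernoulliGate a b (PiLp.single 2 0 v : Work G Ω) 0 x =
        ((Real.sqrt (1 - nu a b x) : ℝ) : ℂ) • v x ∧
      bernoulliGate a b (PiLp.single 2 0 v : Work G Ω) 1 x =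
        ((Real.sqrt (nu a b x) : ℝ) : ℂ) • v x := by
  constructor <;>
  · rw [bernoulliGate, LinearIsometryEquiv.trans_apply, swapReg_apply,
      LinearIsometryEquiv.trans_apply, LinearIsometryEquiv.piLpCongrRight_apply]
    change matAct (rot a b x) _ _ = _
    rw [matAct_apply, Fin.sum_univ_two, swapReg_apply, swapReg_apply]
    simp [rot, rotMatrix]

/-- The reflection `I - 2Π`, where `Π` projects the qubit onto `|1⟩`. -/
def reflectGood : Work G Ω ≃ₗᵢ[ℂ] Work G Ω :=
  LinearIsometryEquiv.piLpCongrRight 2 fun q : Fin 2 =>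
    if q = 1 then LinearIsometryEquiv.neg ℂ else LinearIsometryEquiv.refl ℂ _

/-- The reflection `2|0⟩⟨0| - I` through the blank state of the work space. -/
def reflectBlank (B : Blank G Ω) : Work G Ω ≃ₗᵢ[ℂ] Work G Ω :=
  reflectThrough B.work

/-- Apply `V` to the work space if the content `j` of the phase register satisfies `c j`. -/
def controlled {t : ℕ+} (c : Fin t → Bool) (V : Work G Ω ≃ₗᵢ[ℂ] Work G Ω) :
    Machine G Ω t ≃ₗᵢ[ℂ] Machine G Ω t :=
  LinearIsometryEquiv.piLpCongrRight 2 fun j =>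
    if c j then V else LinearIsometryEquiv.refl ℂ (Work G Ω)

/-! ### Circuits with access to a sampler -/

variable (G Ω) in
/-- A gate is a fixed unitary, or a controlled execution of the unknown sampler or of its
inverse. -/
inductive Gate (t : ℕ+) where
  | free (V : Machine G Ω t ≃ₗᵢ[ℂ] Machine G Ω t)
  | sample (c : Fin t → Bool)
  | sampleInv (c : Fin t → Bool)

/-- The unitary executed by a gate when the sampler is `S`. -/
def Gate.unitary {t : ℕ+} (S : Reg G Ω ≃ₗᵢ[ℂ] Reg G Ω) :
    Gate G Ω t → (Machine G Ω t ≃ₗᵢ[ℂ] Machine G Ω t)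
  | .free V => V
  | .sample c => controlled c (LinearIsometryEquiv.piLpCongrRight 2 fun _ => S)
  | .sampleInv c => controlled c (LinearIsometryEquiv.piLpCongrRight 2 fun _ => S.symm)

/-- The number of quantum samples used by a gate. -/
def Gate.cost {t : ℕ+} : Gate G Ω t → ℕ
  | .free _ => 0
  | .sample _ => 1
  | .sampleInv _ => 1

/-- The unitary of a circuit; the first gate of the list is executed first. -/
def circuitUnitary {t : ℕ+} (S : Reg G Ω ≃ₗᵢ[ℂ] Reg G Ω) :
    List (Gate G Ω t) → (Machine G Ω t ≃ₗᵢ[ℂ] Machine G Ω t)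
  | [] => LinearIsometryEquiv.refl ℂ _
  | g :: gs => (g.unitary S).trans (circuitUnitary S gs)

/-- The number of quantum samples used by a circuit. -/
def circuitCost {t : ℕ+} (gs : List (Gate G Ω t)) : ℕ := (gs.map Gate.cost).sum

theorem sum_norm_sq_eq_one {E ι : Type*} [NormedAddCommGroup E] [Fintype ι]
    (Φ : PiLp 2 (fun _ : ι => E)) (h : ‖Φ‖ = 1) :
    ∑ y, ENNReal.ofReal (‖Φ y‖ ^ 2) = 1 := by
  rw [← ENNReal.ofReal_sum_of_nonneg fun _ _ => sq_nonneg _, ← PiLp.norm_sq_eq_of_L2, h]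
  simp

/-- The outcome of measuring the phase register after running a circuit on the blank state
(Born rule). -/
def measurePhase (B : Blank G Ω) (S : Reg G Ω ≃ₗᵢ[ℂ] Reg G Ω) {t : ℕ+}
    (gs : List (Gate G Ω t)) : PMF (Fin t) :=
  PMF.ofFintype (fun y => ENNReal.ofReal (‖circuitUnitary S gs (B.machine t) y‖ ^ 2))
    (sum_norm_sq_eq_one _ (by rw [LinearIsometryEquiv.norm_map, B.norm_machine]))

/-- Controlled execution of `U = (I ⊗ R_{a,b}) (S ⊗ I)`. -/
def gatesU {t : ℕ+} (a b : ℝ) (c : Fin t → Bool) : List (Gate G Ω t) :=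
  [.sample c, .free (controlled c (bernoulliGate a b))]

/-- Controlled execution of `U⁻¹`. -/
def gatesUInv {t : ℕ+} (a b : ℝ) (c : Fin t → Bool) : List (Gate G Ω t) :=
  [.free (controlled c (bernoulliGate a b).symm), .sampleInv c]

/-- Controlled execution of the Grover operator `U (2|0⟩⟨0| - I) U⁻¹ (I - 2Π)`. -/
def gatesGrover (B : Blank G Ω) {t : ℕ+} (a b : ℝ) (c : Fin t → Bool) : List (Gate G Ω t) :=
  .free (controlled c reflectGood) ::
    (gatesUInv a b c ++ .free (controlled c (reflectBlank B)) :: gatesU a b c)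

/-- The amplitude estimation circuit: phase estimation, with a `t`-dimensional phase register, of
the Grover operator in the state `U |0⟩`. The `i`-th Grover step is executed when the content `j` of
the phase register satisfies `i < j`, so that `j` steps are executed in total. -/
def gatesAmplEst (B : Blank G Ω) (a b : ℝ) (t : ℕ+) : List (Gate G Ω t) :=
  .free (matAct (fourier t)) ::
    (gatesU a b (fun _ => true) ++
      ((List.range (t : ℕ)).flatMap fun i : ℕ => gatesGrover B a b fun j : Fin t => decide (i < (j : ℕ))) ++
        [.free (matAct (fourier t)).symm])

end Circuits

/-! ### Randomized algorithms that count quantum samples -/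

/-- The law of the pair (result, number of quantum samples used) of a randomized computation. -/
def Run (α : Type) : Type := PMF (α × ℕ)

/-- Computations are composed sequentially, with fresh randomness, and their numbers of quantum
samples add up. -/
instance : Monad Run where
  pure a := PMF.pure (a, 0)
  bind m k := PMF.bind m fun r => PMF.map (fun s => (s.1, r.2 + s.2)) (k r.1)

/-- The law of a computation. -/
def Run.law {α : Type} (m : Run α) : PMF (α × ℕ) := m

/-- `n` independent executions of a computation. -/
def Run.replicate {α : Type} (m : Run α) : ℕ → Run (List α)
  | 0 => pure []
  | n + 1 => do
    let a ← m
    let l ← Run.replicate m n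
    pure (a :: l)

/-- The median of a list of odd length. -/
def median (l : List ℝ) : ℝ := (l.insertionSort (· ≤ ·)).getD (l.length / 2) 0

section Algorithms

variable {G : Type*} [NormedAddCommGroup G] [InnerProductSpace ℂ G] {Ω : Finset ℝ≥0}
variable (B : Blank G Ω) (S : Reg G Ω ≃ₗᵢ[ℂ] Reg G Ω)

/-- Amplitude estimation for `U = (I ⊗ R_{a,b}) (S ⊗ I)` and `Π = I ⊗ I ⊗ |1⟩⟨1|`: run the
circuit, measure `y` in the phase register and output `sin² (π y / t)`. -/
def amplEst (a b : ℝ) (t : ℕ+) : Run ℝ :=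
  PMF.map (fun y : Fin t => (Real.sin (Real.pi * (y : ℕ) / (t : ℕ)) ^ 2,
    circuitCost (gatesAmplEst B a b t))) (measurePhase B S (gatesAmplEst B a b t))

/-- The number `Θ(log (1/δ))` of repetitions of amplitude estimation. -/
def reps (δ : ℝ) : ℕ := 2 * ⌈12 * Real.log (1 / δ)⌉₊ + 1

/-- The basic estimation algorithm: the median of `Θ(log (1/δ))` amplitude estimations. -/
def basicEst (a b : ℝ) (t : ℕ+) (δ : ℝ) : Run ℝ := do
  let l ← Run.replicate (amplEst B S a b t) (reps δ)
  pure (median l)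

/-- `∑_{ℓ ≤ k} 2^ℓ Γ p_ℓ`, where `p_0` estimates the truncation to `[0, Γ)` and `p_ℓ` estimates the
truncation to `[2^(ℓ-1) Γ, 2^ℓ Γ)`, each with parameters `t₀` and `δ`. -/
def sApproxSum (Γ : ℝ) (t₀ : ℕ+) (δ : ℝ) : ℕ → Run ℝ
  | 0 => do
    let p ← basicEst B S 0 Γ t₀ δ
    pure (Γ * p)
  | ℓ + 1 => do
    let s ← sApproxSum Γ t₀ δ ℓ
    let p ← basicEst B S (2 ^ ℓ * Γ) (2 ^ (ℓ + 1) * Γ) t₀ δ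
    pure (s + 2 ^ (ℓ + 1) * Γ * p)

/-- Subroutine for approximating the mean, with `k = ⌈log₂ t⌉ - 1` and
`t₀ = ⌈3 π² t √(log₂ t)⌉`. -/
def sApprox (Γ : ℝ) (t : ℕ+) (δ : ℝ) : Run ℝ :=
  let k : ℕ := Nat.clog 2 t - 1
  let t₀ : ℕ+ := ⌈3 * Real.pi ^ 2 * (t : ℕ) * Real.sqrt (Real.logb 2 (t : ℕ))⌉₊.toPNat'
  sApproxSum B S Γ t₀ (δ / (k + 1)) k

/-- The loop "while `p = 0` and `M ≥ 2L`: halve `M` and set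
`p` to the basic estimate for `(0, M Δ²)`, `25 Δ`, `δ'`". It returns the final value of `M`. -/
def searchLoop (Δ : ℕ+) (L : ℝ) (hL : 0 < L) (δ' : ℝ) (M p : ℝ) : Run ℝ :=
  if h : p = 0 ∧ 2 * L ≤ M then do
    let p' ← basicEst B S 0 (M / 2 * (Δ : ℕ) ^ 2) (25 * Δ) δ'
    searchLoop Δ L hL δ' (M / 2) p'
  else pure M
termination_by ⌈M / L⌉₊
decreasing_by
  have h2 : 2 ≤ M / L := by rw [le_div_iff₀ hL]; exact h.2
  have h3 : M / 2 / L = M / L / 2 := by ring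
  have h4 : ⌈M / L - 1⌉₊ < ⌈M / L⌉₊ := by
    rw [Nat.ceil_sub_one]
    exact Nat.sub_lt (Nat.ceil_pos.2 (by linarith)) one_pos
  exact lt_of_le_of_lt (Nat.ceil_mono (by rw [h3]; linarith)) h4

/-- `ε`-approximation of the mean, given an integer `Δ ≥ φ/μ`. -/
def epsApprox (Δ : ℕ+) (L H : ℝ) (hL : 0 < L) (ε δ : ℝ) : Run ℝ := do
  let M ← searchLoop B S Δ L hL (δ / (2 * (3 + Real.logb 2 (H / L)))) (8 * H) 0
  if M < 2 * L then pure 0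
  else sApprox B S (M * (Δ : ℕ)) ⌈51 ^ 2 * ε⁻¹ * (Δ : ℕ)⌉₊.toPNat' (δ / 2)

/-- The value of `Δ` used for a real bound `y`: the least positive integer `Δ ≥ y`. -/
def toDelta (y : ℝ) : ℕ+ := ⌈y⌉₊.toPNat'

/-- The loop "while `m < M/6` and `M ≥ L/2`: halve `M` and set `m` to the result of `epsApprox` for
`Δ = f(M)`, accuracy `5/6` and failure parameter `δ'`". It returns the final value of `M`. -/
def decLoop (f : ℝ → ℝ) (L H : ℝ) (hL : 0 < L) (δ' : ℝ) (M m : ℝ) : Run ℝ :=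
  if h : m < M / 6 ∧ L / 2 ≤ M then do
    let m' ← epsApprox B S (toDelta (f (M / 2))) L H hL (5 / 6) δ'
    decLoop f L H hL δ' (M / 2) m'
  else pure M
termination_by ⌈4 * M / L⌉₊
decreasing_by
  have h2 : 2 ≤ 4 * M / L := by rw [le_div_iff₀ hL]; linarith [h.2]
  have h3 : 4 * (M / 2) / L = 4 * M / L / 2 := by ring
  have h4 : ⌈4 * M / L - 1⌉₊ < ⌈4 * M / L⌉₊ := by
    rw [Nat.ceil_sub_one]
    exact Nat.sub_lt (Nat.ceil_pos.2 (by linarith)) one_pos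
  exact lt_of_le_of_lt (Nat.ceil_mono (by rw [h3]; linarith)) h4

/-- `ε`-approximation of the mean, given a non-increasing function `f` with `f(μ) ≥ φ/μ`. -/
def epsApproxDec (f : ℝ → ℝ) (L H : ℝ) (hL : 0 < L) (ε δ : ℝ) : Run ℝ := do
  let M ← decLoop B S f L H hL (δ / (2 * (2 + Real.logb 2 (H / L)))) (2 * H) 0
  if M < L / 2 then pure 0
  else epsApprox B S (toDelta (f (M / (6 * (1 + 2 * Real.pi) ^ 2)))) L H hL ε (δ / 2)

end Algorithms

end QuantumMean

end

noncomputable section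

namespace QuantumMean

/-! ### Probabilities of events -/

/-! Amplitude estimation. Let p = sin²θ be the success probability of the Bernoulli sampler. The
Grover operator keeps the state in the span of the two components of the prepared state and rotates
it by 2θ, so the measured y has as law the average of the Fejér kernels centred at θ and -θ
(`measurePhase_gatesAmplEst`). The two grid points next to the phase carry mass at least 3/4
(`three_quarters_le_sum_fejer`), and so does y = 0 when p < 1/(4t²). The median lowers the failure
probability from 1/4 to δ³ (`pr_median_le`); the cube pays for all later union bounds. Two
guarantees result: an additive error 2π√p/t + π²/t², and the bound (1+2π)²p from above, which needs
no condition on p.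

Summation. The dyadic truncations add up to a truncated mean. By Cauchy–Schwarz over the blocks the
accumulated error is governed by φ (`sumError_le`), and the unconditional upper bound is inherited.

Explicit Δ ≥ φ/μ. The basic estimate is 0 for M > 2500μ and nonzero for 2μ ≤ M < 8μ, up to small
failure probability. If L ≤ 2μ the search thus stops at M of order μ, where the summation error is
at most εμ (`pr_epsApprox_far`).

Non-increasing f. Once M ≤ μ, f(M) is a valid bound and a 5/6-approximation is at least μ/6 ≥ M/6,
so the loop stops. Conversely, stopping at M forces M ≤ 6(1+2π)²μ, hence the last call also has a
valid bound (`pr_decLoop_window`). Ending below 2^(-ℓ)μ requires ℓ failures, each with fresh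
randomness, of total probability at most δ^(3ℓ) (`pr_decLoop_lt`). As f is non-increasing, the final
M controls the whole cost (`decLoop_support`), and T is the first index whose cost bound holds
(`exists_index`). -/

/-- The probability of an event, as a real number. -/
def prob {α : Type*} (p : PMF α) (s : Set α) : ℝ := (p.toOuterMeasure s).toReal

section Prob

variable {α β : Type*} (p : PMF α)

theorem toOuterMeasure_le_one (s : Set α) : p.toOuterMeasure s ≤ 1 := by
  rw [← (p.toOuterMeasure_apply_eq_one_iff _).2 (Set.subset_univ _)]
  exact p.toOuterMeasure.mono (Set.subset_univ _)

theorem toOuterMeasure_ne_top (s : Set α) : p.toOuterMeasure s ≠ ∞ :=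
  ((toOuterMeasure_le_one p s).trans_lt ENNReal.one_lt_top).ne

theorem ofReal_prob (s : Set α) : ENNReal.ofReal (prob p s) = p.toOuterMeasure s :=
  ENNReal.ofReal_toReal (toOuterMeasure_ne_top p s)

theorem prob_nonneg (s : Set α) : 0 ≤ prob p s := ENNReal.toReal_nonneg

theorem prob_le_one (s : Set α) : prob p s ≤ 1 :=
  ENNReal.toReal_le_of_le_ofReal zero_le_one (by simpa using toOuterMeasure_le_one p s)

theorem prob_mono_of_support {s t : Set α} (h : ∀ a ∈ p.support, a ∈ s → a ∈ t) :
    prob p s ≤ prob p t :=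
  ENNReal.toReal_mono (toOuterMeasure_ne_top p t)
    (p.toOuterMeasure_mono fun a ha => h a ha.2 ha.1)

theorem prob_mono {s t : Set α} (h : s ⊆ t) : prob p s ≤ prob p t :=
  prob_mono_of_support p fun _ _ ha => h ha

theorem prob_eq_zero {s : Set α} (h : ∀ a ∈ p.support, a ∉ s) : prob p s = 0 := by
  rw [prob, (p.toOuterMeasure_apply_eq_zero_iff _).2 (Set.disjoint_left.2 h), ENNReal.toReal_zero]

theorem prob_union_le (s t : Set α) : prob p (s ∪ t) ≤ prob p s + prob p t := by
  rw [prob, prob, prob,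
    ← ENNReal.toReal_add (toOuterMeasure_ne_top p s) (toOuterMeasure_ne_top p t)]
  exact ENNReal.toReal_mono
    (ENNReal.add_ne_top.2 ⟨toOuterMeasure_ne_top p s, toOuterMeasure_ne_top p t⟩)
    (MeasureTheory.measure_union_le s t)

theorem prob_add_compl (s : Set α) : prob p s + prob p sᶜ = 1 := by
  rw [prob, prob, ← ENNReal.toReal_add (toOuterMeasure_ne_top p s) (toOuterMeasure_ne_top p _),
    PMF.toOuterMeasure_apply, PMF.toOuterMeasure_apply, ← ENNReal.tsum_add]
  have : ∀ a, s.indicator p a + sᶜ.indicator p a = p a := fun a => by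
    by_cases h : a ∈ s <;> simp [h]
  simp_rw [this, p.tsum_coe, ENNReal.toReal_one]

theorem ofReal_le_toOuterMeasure {s : Set α} {δ : ℝ} (h : prob p sᶜ ≤ δ) :
    ENNReal.ofReal (1 - δ) ≤ p.toOuterMeasure s := by
  rw [← ofReal_prob]
  exact ENNReal.ofReal_le_ofReal (by linarith [prob_add_compl p s])

theorem prob_map (f : α → β) (s : Set β) : prob (p.map f) s = prob p (f ⁻¹' s) := by
  rw [prob, prob, PMF.toOuterMeasure_map_apply]

/-- Total probability, split by whether the intermediate result lies in `A`. Keeping both bounds `b`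
and `c` serves union bounds (`c = 1`), products of failure probabilities (`b = 0`), and the Chernoff
induction, which needs the two at once. -/
theorem prob_bind_le (k : α → PMF β) (A : Set α) (E : Set β) {b c : ℝ} (hb : 0 ≤ b) (hc : 0 ≤ c)
    (hA : ∀ a ∈ p.support, a ∈ A → prob (k a) E ≤ c)
    (hA' : ∀ a ∈ p.support, a ∉ A → prob (k a) E ≤ b) :
    prob (p.bind k) E ≤ prob p A * c + prob p Aᶜ * b := by
  refine ENNReal.toReal_le_of_le_ofReal (by
    have := prob_nonneg p A
    have := prob_nonneg p Aᶜ
    positivity) ?_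
  rw [ENNReal.ofReal_add (mul_nonneg (prob_nonneg p A) hc) (mul_nonneg (prob_nonneg p Aᶜ) hb),
    ENNReal.ofReal_mul (prob_nonneg p A), ENNReal.ofReal_mul (prob_nonneg p Aᶜ), ofReal_prob,
    ofReal_prob, PMF.toOuterMeasure_bind_apply, PMF.toOuterMeasure_apply, PMF.toOuterMeasure_apply,
    ← ENNReal.tsum_mul_right, ← ENNReal.tsum_mul_right, ← ENNReal.tsum_add]
  refine ENNReal.tsum_le_tsum fun a => ?_
  by_cases hs : a ∈ p.support
  · by_cases h : a ∈ A
    · simp only [h, Set.indicator_of_mem, Set.mem_compl_iff, not_true_eq_false, not_false_eq_true,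
        Set.indicator_of_notMem, zero_mul, add_zero]
      rw [← ofReal_prob]
      gcongr
      exact hA a hs h
    · simp only [h, Set.indicator_of_mem, Set.mem_compl_iff, not_false_eq_true,
        Set.indicator_of_notMem, zero_mul, zero_add]
      rw [← ofReal_prob]
      gcongr
      exact hA' a hs h
  · rw [(p.apply_eq_zero_iff a).2 hs, zero_mul]
    exact zero_le

end Prob

/-! ### Sequential computations: union bounds, products of failures, worst-case cost -/

namespace Run

variable {α β : Type}

theorem law_bind (m : Run α) (k : α → Run β) : (m >>= k).law =
    m.law.bind fun r => ((k r.1).law).map fun s => (s.1, r.2 + s.2) := rfl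

theorem law_pure (a : α) : (pure a : Run α).law = PMF.pure (a, 0) := rfl

theorem mem_support_bind {m : Run α} {k : α → Run β} {r : β × ℕ} :
    r ∈ (m >>= k).law.support ↔
      ∃ s ∈ m.law.support, ∃ u ∈ (k s.1).law.support, (u.1, s.2 + u.2) = r := by
  rw [law_bind, PMF.mem_support_bind_iff]
  simp_rw [PMF.mem_support_map_iff]

theorem mem_support_pure {a : α} {r : α × ℕ} :
    r ∈ (pure a : Run α).law.support ↔ r = (a, 0) := by
  rw [law_pure, PMF.mem_support_pure_iff]

theorem prob_law_bind_le (m : Run α) (k : α → Run β) (A : Set (α × ℕ)) (E : Set (β × ℕ))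
    (h : ∀ r ∈ m.law.support, r ∉ A → ∀ s ∈ (k r.1).law.support, (s.1, r.2 + s.2) ∉ E) :
    prob (m >>= k).law E ≤ prob m.law A := by
  rw [law_bind]
  refine (prob_bind_le m.law _ A E le_rfl zero_le_one (fun a _ _ => prob_le_one _ _)
    fun r hr hA => ?_).trans (by simp)
  rw [prob_map]
  exact (prob_eq_zero _ fun s hs => h r hr hA s hs).le

/-- The probability of an event that concerns the result of a computation. -/
def pr (m : Run α) (s : Set α) : ℝ := prob m.law (Prod.fst ⁻¹' s)

theorem pr_le_one (m : Run α) (s : Set α) : m.pr s ≤ 1 := prob_le_one _ _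

theorem pr_mono (m : Run α) {s t : Set α} (h : s ⊆ t) : m.pr s ≤ m.pr t :=
  prob_mono _ (Set.preimage_mono h)

theorem pr_union_le (m : Run α) (s t : Set α) : m.pr (s ∪ t) ≤ m.pr s + m.pr t :=
  prob_union_le _ _ _

theorem pr_add_compl (m : Run α) (s : Set α) : m.pr s + m.pr sᶜ = 1 := prob_add_compl _ _

theorem pr_pure_of_notMem {a : α} {s : Set α} (h : a ∉ s) : (pure a : Run α).pr s = 0 := by
  refine prob_eq_zero _ fun r hr => ?_
  rw [mem_support_pure.1 hr]
  exact h

theorem pr_bind_le (m : Run α) (k : α → Run β) (A : Set α) (E : Set β) {b c : ℝ} (hb : 0 ≤ b)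
    (hc : 0 ≤ c) (hA : ∀ a ∈ A, (k a).pr E ≤ c) (hA' : ∀ a, a ∉ A → (k a).pr E ≤ b) :
    (m >>= k).pr E ≤ m.pr A * c + m.pr Aᶜ * b := by
  rw [pr, law_bind]
  refine prob_bind_le m.law _ (Prod.fst ⁻¹' A) _ hb hc (fun r _ hr => ?_) fun r _ hr => ?_
  · rw [prob_map]
    exact hA r.1 hr
  · rw [prob_map]
    exact hA' r.1 hr

theorem pr_bind_le_add {m : Run α} {k : α → Run β} {E : Set β} (A : Set α) {a b : ℝ}
    (hb : 0 ≤ b) (hA : m.pr A ≤ a) (h : ∀ x, x ∉ A → (k x).pr E ≤ b) :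
    (m >>= k).pr E ≤ a + b := by
  refine (pr_bind_le m k A E hb zero_le_one (fun _ _ => pr_le_one _ _) h).trans ?_
  nlinarith [pr_le_one m Aᶜ]

/-- For events that require a failure now and another one later: the probabilities multiply because
the continuation uses fresh randomness. This is the source of the geometric tail of T. -/
theorem pr_bind_le_mul {m : Run α} {k : α → Run β} {E : Set β} (A : Set α) {a c : ℝ}
    (hc : 0 ≤ c) (hA : m.pr A ≤ a) (h : ∀ x ∈ A, (k x).pr E ≤ c)
    (h' : ∀ x, x ∉ A → (k x).pr E ≤ 0) : (m >>= k).pr E ≤ a * c := by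
  refine (pr_bind_le m k A E le_rfl hc h h').trans ?_
  nlinarith

theorem pr_bind_le_of_forall {m : Run α} {k : α → Run β} {E : Set β} {c : ℝ}
    (hc : 0 ≤ c) (h : ∀ x, (k x).pr E ≤ c) : (m >>= k).pr E ≤ c := by
  refine (pr_bind_le m k Set.univ E hc hc (fun x _ => h x) fun x _ => h x).trans ?_
  nlinarith [pr_add_compl m Set.univ]

theorem pr_bind_pure_le (m : Run α) (f : α → β) (E : Set β) :
    (m >>= fun a => pure (f a)).pr E ≤ m.pr (f ⁻¹' E) := by
  refine (pr_bind_le_add (f ⁻¹' E) le_rfl le_rfl fun x hx => ?_).trans (add_zero _).le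
  exact (pr_pure_of_notMem (a := f x) hx).le

/-- A computation always uses at most `c` quantum samples. -/
def CostLE (m : Run α) (c : ℝ) : Prop := ∀ r ∈ m.law.support, (r.2 : ℝ) ≤ c

theorem CostLE.mono {m : Run α} {c c' : ℝ} (h : m.CostLE c) (hc : c ≤ c') : m.CostLE c' :=
  fun r hr => (h r hr).trans hc

theorem costLE_pure (a : α) : (pure a : Run α).CostLE 0 := fun r hr => by
  rw [mem_support_pure.1 hr]
  simp

theorem CostLE.bind {m : Run α} {k : α → Run β} {c c' : ℝ} (hm : m.CostLE c)
    (hk : ∀ a, (k a).CostLE c') : (m >>= k).CostLE (c + c') := by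
  intro r hr
  obtain ⟨s, hs, u, hu, rfl⟩ := mem_support_bind.1 hr
  push_cast
  exact add_le_add (hm s hs) (hk s.1 u hu)

theorem CostLE.replicate {m : Run α} {c : ℝ} (hm : m.CostLE c) (n : ℕ) :
    (Run.replicate m n).CostLE (n * c) := by
  induction n with
  | zero => simpa [Run.replicate] using costLE_pure ([] : List α)
  | succ n ih =>
    refine (hm.bind fun a => ih.bind fun l => costLE_pure (a :: l)).mono ?_
    push_cast
    linarith

/-! ### Medians of repeated computations -/

open Classical in
-- Markov's inequality for 3^(number of bad results), whose mean is at most (1 + 2/4)^n, unrolled as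
-- an induction that peels off the first execution.
theorem pr_replicate_countP_le {m : Run α} {s : Set α} (hs : m.pr s ≤ 1 / 4) (n K : ℕ) :
    (Run.replicate m n).pr {l | K ≤ l.countP fun x => x ∈ s} ≤ (3 / 2) ^ n * (3⁻¹) ^ K := by
  induction n generalizing K with
  | zero =>
    rcases K with _ | K
    · simpa using pr_le_one _ _
    · refine (pr_pure_of_notMem ?_).le.trans (by positivity)
      simp
  | succ n ih =>
    rcases K with _ | K
    · refine (pr_le_one _ _).trans ?_
      rw [pow_zero, mul_one]
      exact one_le_pow₀ (by norm_num)
    · have hbad : ∀ a ∈ s, (Run.replicate m n >>= fun l => (pure (a :: l) : Run (List α))).pr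
          {l | K + 1 ≤ l.countP fun x => x ∈ s} ≤ (3 / 2) ^ n * (3⁻¹) ^ K := fun a ha =>
        (pr_bind_pure_le _ _ _).trans ((pr_mono _ fun l hl => by
          simpa [List.countP_cons, ha] using hl).trans (ih K))
      have hgood : ∀ a, a ∉ s → (Run.replicate m n >>= fun l => (pure (a :: l) : Run (List α))).pr
          {l | K + 1 ≤ l.countP fun x => x ∈ s} ≤ (3 / 2) ^ n * (3⁻¹) ^ (K + 1) := fun a ha =>
        (pr_bind_pure_le _ _ _).trans ((pr_mono _ fun l hl => by
          simpa [List.countP_cons, ha] using hl).trans (ih (K + 1)))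
      refine (pr_bind_le m _ s _ (by positivity) (by positivity) hbad hgood).trans ?_
      rw [pow_succ, pow_succ]
      have h1 := pr_add_compl m s
      have h2 : (0 : ℝ) ≤ (3 / 2) ^ n * 3⁻¹ ^ K := by positivity
      have h3 : m.pr sᶜ = 1 - m.pr s := by linarith
      rw [h3]
      nlinarith

end Run

open Classical in
-- A good entry on each side of a bad median in sorted order would sandwich it in the interval `sᶜ`.
-- So one of the two halves, median included, is entirely bad.
theorem countP_of_median_mem {l : List ℝ} {m : ℕ} (hl : l.length = 2 * m + 1) {s : Set ℝ}
    (hs : sᶜ.OrdConnected) (h : median l ∈ s) : m + 1 ≤ l.countP fun x => x ∈ s := by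
  set u := l.insertionSort (· ≤ ·) with hu
  have hlen : u.length = 2 * m + 1 := by rw [hu, List.length_insertionSort, hl]
  have hperm : u.Perm l := List.perm_insertionSort _ _
  have hsort : u.Pairwise (· ≤ ·) := List.pairwise_insertionSort _ _
  have hmed : median l = u[m]'(by omega) := by
    rw [median, List.getD_eq_getElem _ _ (by rw [← hu]; omega)]
    congr 1
    omega
  rw [hmed] at h
  have hmono : ∀ i j (hi : i < u.length) (hj : j < u.length), i ≤ j → u[i] ≤ u[j] := by
    intro i j hi hj hij
    rcases hij.eq_or_lt with rfl | hlt
    · exact le_rfl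
    · exact List.pairwise_iff_getElem.1 hsort i j hi hj hlt
  rw [← hperm.countP_eq]
  have hcase : (∀ i (hi : i < u.length), i ≤ m → u[i] ∈ s) ∨
      (∀ i (hi : i < u.length), m ≤ i → u[i] ∈ s) := by
    by_contra hcon
    push Not at hcon
    obtain ⟨⟨i, hi, him, his⟩, j, hj, hmj, hjs⟩ := hcon
    exact hs.out his hjs ⟨hmono i m hi (by omega) him, hmono m j (by omega) hj hmj⟩ h
  rcases hcase with hc | hc
  · have h1 : (u.take (m + 1)).countP (fun x => x ∈ s) = (u.take (m + 1)).length := by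
      rw [List.countP_eq_length]
      intro a ha
      obtain ⟨i, hi, rfl⟩ := List.mem_iff_getElem.1 ha
      rw [List.length_take] at hi
      simpa using hc i (by omega) (by omega)
    calc m + 1 = (u.take (m + 1)).length := by rw [List.length_take]; omega
      _ = (u.take (m + 1)).countP (fun x => x ∈ s) := h1.symm
      _ ≤ _ := (List.take_sublist _ _).countP_le
  · have h1 : (u.drop m).countP (fun x => x ∈ s) = (u.drop m).length := by
      rw [List.countP_eq_length]
      intro a ha
      obtain ⟨i, hi, rfl⟩ := List.mem_iff_getElem.1 ha
      rw [List.length_drop] at hi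
      simpa using hc (m + i) (by omega) (by omega)
    calc m + 1 = (u.drop m).length := by rw [List.length_drop]; omega
      _ = (u.drop m).countP (fun x => x ∈ s) := h1.symm
      _ ≤ _ := (List.drop_sublist _ _).countP_le

theorem length_of_mem_support_replicate {α : Type} {m : Run α} {n : ℕ} {r : List α × ℕ}
    (hr : r ∈ (Run.replicate m n).law.support) : r.1.length = n := by
  induction n generalizing r with
  | zero =>
    have := Run.mem_support_pure.1 hr
    rw [this]
    rfl
  | succ n ih =>
    obtain ⟨s, _, u, hu, rfl⟩ := Run.mem_support_bind.1 hr
    obtain ⟨v, hv, w, hw, rfl⟩ := Run.mem_support_bind.1 hu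
    rw [Run.mem_support_pure.1 hw]
    simp [ih hv]

/-- The median of `Θ(log (1/δ))` runs inherits every interval bound that a single run satisfies
with probability at least `3/4`. -/
theorem pr_median_le {m : Run ℝ} {s : Set ℝ} (hs : sᶜ.OrdConnected) (hm : m.pr s ≤ 1 / 4) {δ : ℝ}
    (hδ : 0 < δ) :
    (Run.replicate m (reps δ) >>= fun l => (pure (median l) : Run ℝ)).pr s ≤ δ ^ 3 := by
  classical
  set n := ⌈12 * Real.log (1 / δ)⌉₊ with hn
  have h1 : (Run.replicate m (reps δ)).pr (median ⁻¹' s) ≤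
      (Run.replicate m (reps δ)).pr {l | n + 1 ≤ l.countP fun x => x ∈ s} :=
    prob_mono_of_support _ fun r hr h =>
      countP_of_median_mem (length_of_mem_support_replicate hr) hs h
  refine (Run.pr_bind_pure_le _ _ _).trans (h1.trans ((Run.pr_replicate_countP_le hm _ _).trans ?_))
  -- There are 2n + 1 repetitions and a bad median needs n + 1 bad ones; (3/2)² / 3 = 3/4. Since 3/4
  -- ≤ e^(-1/4), the factor 12 in n yields the exponent 3 of δ.
  have h2 : ((3 : ℝ) / 2) ^ reps δ * 3⁻¹ ^ (n + 1) = (3 / 4) ^ n * (1 / 2) := by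
    rw [reps, ← hn, pow_succ, pow_succ, pow_mul, mul_mul_mul_comm, ← mul_pow]
    norm_num
  have h3 : (3 / 4 : ℝ) ≤ Real.exp (-(1 / 4)) := by
    have := Real.add_one_le_exp (-(1 / 4))
    linarith
  have h4 : (12 : ℝ) * Real.log (1 / δ) ≤ n := Nat.le_ceil _
  rw [one_div, Real.log_inv] at h4
  calc ((3 : ℝ) / 2) ^ reps δ * 3⁻¹ ^ (n + 1) = (3 / 4) ^ n * (1 / 2) := h2
    _ ≤ (3 / 4) ^ n := mul_le_of_le_one_right (by positivity) (by norm_num)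
    _ ≤ Real.exp (-(1 / 4)) ^ n := by gcongr
    _ = Real.exp (n * -(1 / 4)) := (Real.exp_nat_mul _ _).symm
    _ ≤ Real.exp ((3 : ℕ) * Real.log δ) := Real.exp_le_exp.2 (by push_cast; linarith)
    _ = δ ^ 3 := by rw [Real.exp_nat_mul, Real.exp_log hδ]

/-! ### The Fejér kernel -/

/-- The normalized Fejér kernel `|t⁻¹ ∑_{j < t} exp(2iβj)|²`. -/
def fejer (t : ℕ) (β : ℝ) : ℝ :=
  ‖∑ j ∈ Finset.range t, Complex.exp (Complex.I * (2 * β : ℝ)) ^ j‖ ^ 2 / (t : ℝ) ^ 2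

theorem fejer_nonneg (t : ℕ) (β : ℝ) : 0 ≤ fejer t β := by unfold fejer; positivity

theorem fejer_sub_int_mul_pi (t : ℕ) (β : ℝ) (n : ℤ) : fejer t (β - n * Real.pi) = fejer t β := by
  have : Complex.exp (Complex.I * (2 * (β - n * Real.pi) : ℝ)) =
      Complex.exp (Complex.I * (2 * β : ℝ)) := by
    rw [Complex.exp_eq_exp_iff_exists_int]
    exact ⟨-n, by push_cast; ring⟩
  rw [fejer, fejer, this]

theorem fejer_zero {t : ℕ} (ht : 0 < t) : fejer t 0 = 1 := by
  have : (t : ℝ) ≠ 0 := Nat.cast_ne_zero.2 ht.ne'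
  simp [fejer, this]

/-- The geometric sum times |sin β| has modulus |sin tβ|, and |sin β| ≤ |β|. The product form of
this sinc² lower bound survives sin β = 0. -/
theorem sin_sq_le_fejer_mul {t : ℕ} (ht : 0 < t) (β : ℝ) :
    Real.sin (t * β) ^ 2 ≤ fejer t β * (t * β) ^ 2 := by
  have htr : (t : ℝ) ≠ 0 := Nat.cast_ne_zero.2 ht.ne'
  have hn : ∀ x : ℝ, ‖Complex.exp (Complex.I * (2 * x : ℝ)) - 1‖ = 2 * |Real.sin x| := fun x => by
    rw [Complex.norm_exp_I_mul_ofReal_sub_one, mul_div_cancel_left₀ x two_ne_zero, norm_mul,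
      Real.norm_eq_abs, Real.norm_eq_abs, abs_two]
  set z := Complex.exp (Complex.I * (2 * β : ℝ)) with hz
  have hzt : z ^ t = Complex.exp (Complex.I * (2 * (t * β) : ℝ)) := by
    rw [hz, ← Complex.exp_nat_mul]
    push_cast
    ring_nf
  have h1 : ‖∑ j ∈ Finset.range t, z ^ j‖ * |Real.sin β| = |Real.sin (t * β)| := by
    have h2 := congrArg norm (geom_sum_mul z t)
    rw [norm_mul, hzt, hn, hz, hn] at h2
    linarith
  have h3 : fejer t β * (t * β) ^ 2 = ‖∑ j ∈ Finset.range t, z ^ j‖ ^ 2 * β ^ 2 := by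
    rw [fejer, ← hz]
    field_simp
  rw [h3, ← sq_abs, ← h1, mul_pow, sq_abs]
  exact mul_le_mul_of_nonneg_left Real.sin_sq_le_sq (by positivity)

theorem pi_sq_lt : Real.pi ^ 2 < 9.87 := by
  have := Real.pi_lt_d6
  have := Real.pi_pos
  nlinarith

/-- The two integers nearest to a real number carry at least three quarters of `sinc²`. -/
theorem three_quarters_le_of_sin_sq_le {f a b : ℝ} (h0 : 0 < f) (h1 : f < 1)
    (ha : Real.sin (Real.pi * f) ^ 2 ≤ a * (Real.pi * f) ^ 2)
    (hb : Real.sin (Real.pi * f) ^ 2 ≤ b * (Real.pi * (1 - f)) ^ 2) : 3 / 4 ≤ a + b := by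
  wlog hf : f ≤ 1 / 2 generalizing f a b
  · have hs : Real.sin (Real.pi * (1 - f)) = Real.sin (Real.pi * f) := by
      rw [mul_sub, mul_one, Real.sin_pi_sub]
    rw [add_comm]
    refine this (f := 1 - f) (by linarith) (by linarith) (by rwa [hs]) ?_ (by linarith)
    rwa [hs, sub_sub_cancel]
  have hpi := Real.pi_pos
  have hP := pi_sq_lt
  have hf1 : 0 < 1 - f := by linarith
  rcases le_total f (36 / 100) with hc | hc
  -- Here `g` bounds sinc(πf) from below by the cubic Taylor polynomial and `r` bounds f/(1-f), so
  -- the farther integer contributes at least g²r². The cases 0.28, 0.32, 0.36 take `r` from the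
  -- left endpoint (0, 7/18, 8/17) and `g` from the right one; 1.645 = 9.87/6.
  · have key : ∀ g r : ℝ, 0 ≤ g → 0 ≤ r → g ≤ 1 - Real.pi ^ 2 * f ^ 2 / 6 → r * (1 - f) ≤ f →
        g ^ 2 * (1 + r ^ 2) ≤ a + b := by
      intro g r hg hr hgf hrf
      have hsin : Real.pi * f * g ≤ Real.sin (Real.pi * f) := by
        have := Real.sin_ge_sub_cube (x := Real.pi * f) (by positivity)
        have : Real.pi * f * g ≤ Real.pi * f * (1 - Real.pi ^ 2 * f ^ 2 / 6) := by gcongr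
        linarith
      have hsq : (Real.pi * f * g) ^ 2 ≤ Real.sin (Real.pi * f) ^ 2 := by gcongr
      have h2 : g ^ 2 ≤ a := by
        have : g ^ 2 * (Real.pi * f) ^ 2 ≤ a * (Real.pi * f) ^ 2 := by linarith
        exact le_of_mul_le_mul_right this (by positivity)
      have h3 : g ^ 2 * r ^ 2 ≤ b := by
        have h4 : (Real.pi * (r * (1 - f)) * g) ^ 2 ≤ (Real.pi * f * g) ^ 2 := by gcongr
        have : g ^ 2 * r ^ 2 * (Real.pi * (1 - f)) ^ 2 ≤ b * (Real.pi * (1 - f)) ^ 2 := by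
          linarith
        exact le_of_mul_le_mul_right this (by positivity)
      linarith
    have hg : ∀ c : ℝ, f ≤ c → 1 - 1.645 * c ^ 2 ≤ 1 - Real.pi ^ 2 * f ^ 2 / 6 := by
      intro c hfc
      have : Real.pi ^ 2 * f ^ 2 ≤ 9.87 * c ^ 2 := by gcongr
      linarith
    rcases le_total f (28 / 100) with h28 | h28
    · have := key _ 0 (by norm_num) le_rfl (hg _ h28) (by linarith)
      norm_num at this
      linarith
    · rcases le_total f (32 / 100) with h32 | h32
      · have := key _ (7 / 18) (by norm_num) (by norm_num) (hg _ h32) (by linarith)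
        norm_num at this
        linarith
      · have := key _ (8 / 17) (by norm_num) (by norm_num) (hg _ hc) (by linarith)
        norm_num at this
        linarith
  -- Near f = 1/2 both integers count almost equally, and the sine becomes cos(πu), bounded below by
  -- 1 - π²u²/2 with 4.935 = 9.87/2.
  · obtain ⟨u, rfl⟩ : ∃ u, f = 1 / 2 - u := ⟨1 / 2 - f, by ring⟩
    have hu0 : 0 ≤ u := by linarith
    have hu1 : u ≤ 14 / 100 := by linarith
    have hw : u ^ 2 ≤ 196 / 10000 := by nlinarith
    have hw0 : 0 ≤ u ^ 2 := sq_nonneg u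
    have hsin : Real.sin (Real.pi * (1 / 2 - u)) = Real.cos (Real.pi * u) := by
      rw [← Real.sin_pi_div_two_sub]
      ring_nf
    rw [hsin] at ha hb
    have hcos : 1 - 4.935 * u ^ 2 ≤ Real.cos (Real.pi * u) := by
      have := Real.one_sub_sq_div_two_le_cos (x := Real.pi * u)
      nlinarith
    have hsq : (1 - 4.935 * u ^ 2) ^ 2 ≤ Real.cos (Real.pi * u) ^ 2 := by
      gcongr
      linarith
    have h2 : (1 - 4.935 * u ^ 2) ^ 2 * (1 / 2 + 2 * u ^ 2) ≤
        (a + b) * (Real.pi ^ 2 * ((1 / 2 - u) * (1 / 2 + u)) ^ 2) := by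
      have h3 : (1 - 4.935 * u ^ 2) ^ 2 * (1 / 2 + u) ^ 2 ≤
          a * (Real.pi * (1 / 2 - u)) ^ 2 * (1 / 2 + u) ^ 2 := by
        gcongr
        exact hsq.trans ha
      have h4 : (1 - 4.935 * u ^ 2) ^ 2 * (1 / 2 - u) ^ 2 ≤
          b * (Real.pi * (1 - (1 / 2 - u))) ^ 2 * (1 / 2 - u) ^ 2 := by
        gcongr
        exact hsq.trans hb
      linarith
    have h5 : 3 / 4 * (Real.pi ^ 2 * ((1 / 2 - u) * (1 / 2 + u)) ^ 2) ≤
        (1 - 4.935 * u ^ 2) ^ 2 * (1 / 2 + 2 * u ^ 2) := by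
      have h6 : Real.pi ^ 2 * ((1 / 2 - u) * (1 / 2 + u)) ^ 2 ≤
          9.87 * ((1 / 2 - u) * (1 / 2 + u)) ^ 2 := by gcongr
      generalize hwd : u ^ 2 = w at *
      have h7 : ((1 / 2 - u) * (1 / 2 + u)) ^ 2 = (1 / 4 - w) ^ 2 := by rw [← hwd]; ring
      rw [h7] at h6 ⊢
      nlinarith [mul_nonneg hw0 hw0, mul_nonneg hw0 (mul_nonneg hw0 hw0)]
    exact le_of_mul_le_mul_right (h5.trans h2) (by
      have : 0 < 1 / 2 - u := h0
      positivity)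

/-- Factor out sin d with d = a - b: what remains is 2 sin b cos b cos d + cos 2b sin d. The
first-order term thus keeps |sin b cos b|, which makes the estimation error scale like √p. -/
theorem abs_sin_sq_sub_sin_sq_le {a b c : ℝ} (h : |a - b| ≤ c) :
    |Real.sin a ^ 2 - Real.sin b ^ 2| ≤ 2 * c * |Real.sin b * Real.cos b| + c ^ 2 := by
  obtain ⟨d, rfl⟩ : ∃ d, a = b + d := ⟨a - b, by ring⟩
  rw [add_sub_cancel_left] at h
  have h1 : Real.sin (b + d) ^ 2 - Real.sin b ^ 2 =
      Real.sin d * (2 * (Real.sin b * Real.cos b) * Real.cos d + Real.cos (2 * b) * Real.sin d) := by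
    rw [Real.sin_add, Real.cos_two_mul']
    have h2 := Real.sin_sq_add_cos_sq d
    linear_combination (Real.sin b ^ 2) * h2
  have h2 : |Real.sin d| ≤ c := Real.abs_sin_le_abs.trans h
  have hc : 0 ≤ c := (abs_nonneg _).trans h
  rw [h1, abs_mul]
  have h3 : |2 * (Real.sin b * Real.cos b) * Real.cos d + Real.cos (2 * b) * Real.sin d| ≤
      2 * |Real.sin b * Real.cos b| + c := by
    refine (abs_add_le _ _).trans (add_le_add ?_ ?_)
    · rw [abs_mul, abs_mul, abs_two]
      exact mul_le_of_le_one_right (by positivity) (Real.abs_cos_le_one d)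
    · rw [abs_mul]
      exact (mul_le_of_le_one_left (abs_nonneg _) (Real.abs_cos_le_one _)).trans h2
  calc _ ≤ c * (2 * |Real.sin b * Real.cos b| + c) := by gcongr
    _ = _ := by ring

open Classical in
/-- Phase estimation returns one of the two best approximations with probability `≥ 3/4`. -/
theorem three_quarters_le_sum_fejer {t : ℕ} (ht : 0 < t) (θ : ℝ) (W : Finset (Fin t))
    (hW : ∀ y : Fin t, |Real.sin (Real.pi * y / t) ^ 2 - Real.sin θ ^ 2| ≤
      2 * (Real.pi / t) * |Real.sin θ * Real.cos θ| + (Real.pi / t) ^ 2 → y ∈ W) :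
    3 / 4 ≤ ∑ y ∈ W, fejer t (θ - Real.pi * y / t) := by
  have htr : (0 : ℝ) < t := Nat.cast_pos.2 ht
  have hpi := Real.pi_pos
  -- The neighbours of tθ/π are arbitrary integers. They may be reduced modulo t because `fejer` and
  -- sin² both have period π.
  have hmod : ∀ n : ℤ, ∃ y : Fin t, ∃ m : ℤ, (n : ℝ) = y + m * t := fun n => by
    have h1 := Int.emod_nonneg n (Int.natCast_ne_zero.2 ht.ne')
    have h2 := Int.emod_lt_of_pos n (Int.natCast_pos.2 ht)
    refine ⟨⟨(n % t).toNat, by omega⟩, n / t, ?_⟩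
    have h3 : n = ((n % t).toNat : ℤ) + n / t * t := by
      rw [Int.toNat_of_nonneg h1, mul_comm]
      exact (Int.emod_add_mul_ediv n t).symm
    exact_mod_cast congrArg (Int.cast : ℤ → ℝ) h3
  have hfe : ∀ (n m : ℤ) (y : Fin t), (n : ℝ) = y + m * t →
      fejer t (θ - Real.pi * n / t) = fejer t (θ - Real.pi * y / t) := fun n m y h => by
    rw [← fejer_sub_int_mul_pi t (θ - Real.pi * y / t) m, h]
    congr 1
    field_simp
    ring
  have hin : ∀ (n m : ℤ) (y : Fin t), (n : ℝ) = y + m * t → |Real.pi * n / t - θ| ≤ Real.pi / t →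
      y ∈ W := fun n m y h hn => by
    refine hW y ?_
    have hs : Real.sin (Real.pi * y / t) ^ 2 = Real.sin (Real.pi * n / t) ^ 2 := by
      have : Real.pi * n / t = Real.pi * y / t + m * Real.pi := by
        rw [h]
        field_simp
      rw [this, Real.sin_sq, Real.sin_sq, Real.cos_sq, Real.cos_sq]
      congr 3
      rw [← Real.cos_add_int_mul_two_pi _ m]
      ring_nf
    rw [hs]
    exact abs_sin_sq_sub_sin_sq_le hn
  set x := t * θ / Real.pi with hx
  have hθ : θ = Real.pi * x / t := by rw [hx]; field_simp
  have hfr0 := Int.fract_nonneg x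
  have hfr1 := Int.fract_lt_one x
  have hxf : (⌊x⌋ : ℝ) + Int.fract x = x := Int.floor_add_fract x
  set f := Int.fract x with hf
  have hθ' : θ = Real.pi * (⌊x⌋ + f) / t := by rw [hxf]; exact hθ
  obtain ⟨y₀, m₀, h₀⟩ := hmod ⌊x⌋
  obtain ⟨y₁, m₁, h₁⟩ := hmod (⌊x⌋ + 1)
  have hd0 : θ - Real.pi * (⌊x⌋ : ℤ) / t = Real.pi * f / t := by
    rw [hθ']
    field_simp
    ring
  have hd1 : θ - Real.pi * (⌊x⌋ + 1 : ℤ) / t = -(Real.pi * (1 - f) / t) := by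
    rw [hθ']
    push_cast
    field_simp
    ring
  have hy0 : y₀ ∈ W := hin _ m₀ y₀ h₀ (by
    rw [abs_sub_comm, hd0, abs_of_nonneg (by positivity)]
    gcongr
    nlinarith)
  have hy1 : y₁ ∈ W := hin _ m₁ y₁ h₁ (by
    rw [abs_sub_comm, hd1, abs_neg, abs_of_nonneg (by
      have : 0 ≤ 1 - f := by linarith
      positivity)]
    gcongr
    nlinarith)
  have hone : ∀ y ∈ W, fejer t (θ - Real.pi * y / t) ≤ ∑ y ∈ W, fejer t (θ - Real.pi * y / t) :=
    fun y hy => Finset.single_le_sum (f := fun y : Fin t => fejer t (θ - Real.pi * y / t))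
      (fun _ _ => fejer_nonneg _ _) hy
  rcases hfr0.eq_or_lt with hz | hpos
  · refine le_trans ?_ (hone y₀ hy0)
    rw [← hfe _ m₀ y₀ h₀, hd0, ← hz, mul_zero, zero_div, fejer_zero ht]
    norm_num
  -- Consecutive integers coincide modulo t only for t = 1, where the kernel is identically 1.
  · by_cases hne : y₀ = y₁
    · have ht1 : t = 1 := by
        have h2 : ((m₁ - m₀ : ℤ) : ℝ) * t = 1 := by
          push_cast at h₁ ⊢
          rw [hne] at h₀
          linarith
        have h3 : (m₁ - m₀) * (t : ℤ) = 1 := by exact_mod_cast h2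
        have h4 : (t : ℤ) ∣ 1 := ⟨m₁ - m₀, by rw [← h3, mul_comm]⟩
        exact_mod_cast Int.eq_one_of_dvd_one (by positivity) h4
      refine le_trans ?_ (hone y₀ hy0)
      have : ∀ β, fejer 1 β = 1 := fun β => by simp [fejer]
      subst ht1
      rw [this]
      norm_num
    · refine le_trans ?_ (Finset.sum_le_sum_of_subset_of_nonneg (s := {y₀, y₁})
        (by
          intro y hy
          rcases Finset.mem_insert.1 hy with rfl | hy
          · exact hy0
          · rwa [Finset.mem_singleton.1 hy]) fun _ _ _ => fejer_nonneg _ _)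
      rw [Finset.sum_pair hne, ← hfe _ m₀ y₀ h₀, ← hfe _ m₁ y₁ h₁, hd0, hd1]
      refine three_quarters_le_of_sin_sq_le hpos hfr1 ?_ ?_
      · have := sin_sq_le_fejer_mul ht (Real.pi * f / t)
        rwa [mul_div_cancel₀ _ htr.ne'] at this
      · have := sin_sq_le_fejer_mul ht (-(Real.pi * (1 - f) / t))
        rw [mul_neg, mul_div_cancel₀ _ htr.ne', Real.sin_neg, neg_sq, neg_sq, mul_sub, mul_one,
          Real.sin_pi_sub] at this
        rwa [mul_sub, mul_one]

/-- With z = t|θ| ≤ π/4 one has sin z / z ≥ 1 - z²/6 ≥ 0.87, and 0.87² > 3/4. This makes the single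
outcome y = 0 likely for tiny amplitudes. -/
theorem three_quarters_le_fejer {t : ℕ} (ht : 0 < t) {θ : ℝ} (h : t * |θ| ≤ Real.pi / 4) :
    3 / 4 ≤ fejer t θ := by
  have htr : (0 : ℝ) < t := Nat.cast_pos.2 ht
  rcases eq_or_ne θ 0 with rfl | hθ
  · rw [fejer_zero ht]
    norm_num
  · have h1 := sin_sq_le_fejer_mul ht θ
    set z := t * |θ| with hz
    have hz0 : 0 < z := mul_pos htr (abs_pos.2 hθ)
    have h2 : Real.sin (t * θ) ^ 2 = Real.sin z ^ 2 := by
      rw [hz]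
      rcases abs_choice θ with h | h <;> rw [h]
      rw [mul_neg, Real.sin_neg, neg_sq]
    have h3 : (t * θ) ^ 2 = z ^ 2 := by rw [hz, mul_pow, mul_pow, sq_abs]
    rw [h2, h3] at h1
    have h4 := Real.sin_ge_sub_cube hz0.le
    have h5 : z ^ 2 ≤ 9.87 / 16 := by
      have := pi_sq_lt
      nlinarith
    have h6 : z * (87 / 100) ≤ Real.sin z := by nlinarith
    have h7 : (z * (87 / 100)) ^ 2 ≤ Real.sin z ^ 2 := by gcongr
    have h8 : 3 / 4 * z ^ 2 ≤ fejer t θ * z ^ 2 := by nlinarith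
    exact le_of_mul_le_mul_right h8 (by positivity)

/-! ### The amplitude estimation circuit -/

section Circuits

variable {G : Type*} [NormedAddCommGroup G] [InnerProductSpace ℂ G] {Ω : Finset ℝ≥0}
variable (B : Blank G Ω) (S : Reg G Ω ≃ₗᵢ[ℂ] Reg G Ω) (a b : ℝ) {t : ℕ+}

/-- The unitary `U = (I ⊗ R_{a,b}) (S ⊗ I)`. -/
def prepare : Work G Ω ≃ₗᵢ[ℂ] Work G Ω :=
  (LinearIsometryEquiv.piLpCongrRight 2 fun _ : Fin 2 => S).trans (bernoulliGate a b)

/-- The Grover operator `U (2|0⟩⟨0| - I) U⁻¹ (I - 2Π)`. -/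
def grover : Work G Ω ≃ₗᵢ[ℂ] Work G Ω :=
  reflectGood.trans ((prepare S a b).symm.trans ((reflectBlank B).trans (prepare S a b)))

theorem circuitUnitary_append (l₁ l₂ : List (Gate G Ω t)) (v : Machine G Ω t) :
    circuitUnitary S (l₁ ++ l₂) v = circuitUnitary S l₂ (circuitUnitary S l₁ v) := by
  induction l₁ generalizing v with
  | nil => rfl
  | cons g gs ih => exact ih _

theorem circuitUnitary_free_cons (V : Machine G Ω t ≃ₗᵢ[ℂ] Machine G Ω t)
    (l : List (Gate G Ω t)) (v : Machine G Ω t) :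
    circuitUnitary S (.free V :: l) v = circuitUnitary S l (V v) := rfl

theorem matAct_symm_apply {E ι : Type*} [NormedAddCommGroup E] [InnerProductSpace ℂ E] [Fintype ι]
    [DecidableEq ι] (A : Matrix.unitaryGroup ι ℂ) (v : PiLp 2 (fun _ : ι => E)) (i : ι) :
    (matAct A).symm v i = ∑ j, (star A.1) i j • v j := rfl

theorem controlled_apply (c : Fin t → Bool) (V : Work G Ω ≃ₗᵢ[ℂ] Work G Ω) (v : Machine G Ω t)
    (j : Fin t) : controlled c V v j = if c j then V (v j) else v j := by
  rw [controlled, LinearIsometryEquiv.piLpCongrRight_apply]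
  change (if c j then V else LinearIsometryEquiv.refl ℂ _) (v j) = _
  split_ifs <;> rfl

theorem circuitUnitary_gatesU (c : Fin t → Bool) (v : Machine G Ω t) (j : Fin t) :
    circuitUnitary S (gatesU a b c) v j = if c j then prepare S a b (v j) else v j := by
  change controlled c (bernoulliGate a b)
    (controlled c (LinearIsometryEquiv.piLpCongrRight 2 fun _ => S) v) j = _
  rw [controlled_apply, controlled_apply]
  split_ifs <;> rfl

theorem circuitUnitary_gatesUInv (c : Fin t → Bool) (v : Machine G Ω t) (j : Fin t) :
    circuitUnitary S (gatesUInv a b c) v j = if c j then (prepare S a b).symm (v j) else v j := by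
  change controlled c (LinearIsometryEquiv.piLpCongrRight 2 fun _ => S.symm)
    (controlled c (bernoulliGate a b).symm v) j = _
  rw [controlled_apply, controlled_apply]
  split_ifs <;> rfl

theorem circuitUnitary_gatesGrover (c : Fin t → Bool) (v : Machine G Ω t) (j : Fin t) :
    circuitUnitary S (gatesGrover B a b c) v j = if c j then grover B S a b (v j) else v j := by
  change circuitUnitary S (gatesUInv a b c ++ .free (controlled c (reflectBlank B)) :: gatesU a b c)
    (controlled c reflectGood v) j = _
  rw [circuitUnitary_append]
  change circuitUnitary S (gatesU a b c) (controlled c (reflectBlank B)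
    (circuitUnitary S (gatesUInv a b c) (controlled c reflectGood v))) j = _
  rw [circuitUnitary_gatesU, controlled_apply, circuitUnitary_gatesUInv, controlled_apply]
  split_ifs <;> rfl

/-- The control is unary: branch j performs exactly the steps i < j, so n controlled steps act there
as `min n j` iterations. -/
theorem circuitUnitary_flatMap_gatesGrover (n : ℕ) (v : Machine G Ω t) (j : Fin t) :
    circuitUnitary S ((List.range n).flatMap fun i : ℕ =>
      gatesGrover B a b fun j : Fin t => decide (i < (j : ℕ))) v j =
        (grover B S a b)^[min n j] (v j) := by
  induction n with
  | zero => simp [circuitUnitary]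
  | succ n ih =>
    rw [List.range_succ, List.flatMap_append, circuitUnitary_append, List.flatMap_singleton,
      circuitUnitary_gatesGrover, ih]
    by_cases h : n < (j : ℕ)
    · rw [min_eq_left h.le, min_eq_left (Nat.succ_le_of_lt h), Function.iterate_succ_apply']
      simp [h]
    · rw [min_eq_right (by omega), min_eq_right (by omega)]
      simp [h]

theorem circuitUnitary_gatesAmplEst (y : Fin t) :
    circuitUnitary S (gatesAmplEst B a b t) (B.machine t) y =
      ∑ j : Fin t, ((star (fourierMatrix t)) y j * fourierMatrix t j 0) •
        (grover B S a b)^[j] (prepare S a b B.work) := by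
  rw [gatesAmplEst, circuitUnitary_free_cons, circuitUnitary_append, circuitUnitary_append,
    circuitUnitary_free_cons]
  refine (matAct_symm_apply (fourier t) _ y).trans ?_
  refine Finset.sum_congr rfl fun j _ => ?_
  rw [circuitUnitary_flatMap_gatesGrover, circuitUnitary_gatesU, if_pos rfl,
    min_eq_right j.2.le, matAct_apply]
  have h1 : ∑ i, (fourier t).1 j i • (B.machine t) i = fourierMatrix t j 0 • B.work := by
    rw [Finset.sum_eq_single 0]
    · simp [Blank.machine, fourier]
    · intro i _ hi
      simp [Blank.machine, hi]
    · simp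
  rw [h1, map_smul]
  have h2 : ∀ (n : ℕ) (c : ℂ) (w : Work G Ω),
      (grover B S a b)^[n] (c • w) = c • (grover B S a b)^[n] w := fun n c w => by
    induction n with
    | zero => rfl
    | succ n ih => rw [Function.iterate_succ_apply', Function.iterate_succ_apply', ih, map_smul]
  rw [h2, smul_smul]
  rfl

theorem circuitCost_gatesAmplEst : circuitCost (gatesAmplEst B a b t) = 2 * t + 1 := by
  have h : ∀ n : ℕ, (((List.range n).flatMap fun i : ℕ =>
      gatesGrover B a b fun j : Fin t => decide (i < (j : ℕ))).map Gate.cost).sum = 2 * n := by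
    intro n
    induction n with
    | zero => simp
    | succ n ih =>
      rw [List.range_succ, List.flatMap_append, List.map_append, List.sum_append, ih,
        List.flatMap_singleton]
      simp [gatesGrover, gatesUInv, gatesU, Gate.cost]
      ring
  rw [circuitCost, gatesAmplEst, List.map_cons, List.sum_cons, List.map_append, List.sum_append,
    List.map_append, List.sum_append, h]
  simp [gatesU, Gate.cost]
  ring

/-- The success probability `∑_x d(x) ν_x` of the Bernoulli sampler. -/
def amplitude (d : PMF Ω) (a b : ℝ) : ℝ := ∑ x : Ω, (d x).toReal * nu a b x

theorem Blank.norm_work : ‖B.work‖ = 1 := by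
  have h := B.norm_machine 1
  rwa [Blank.machine, PiLp.norm_single] at h

variable {B S} {d : PMF Ω}

theorem prepare_work (x : Ω) :
    prepare S a b B.work 0 x = ((Real.sqrt (1 - nu a b x) : ℝ) : ℂ) • S B.state x ∧
      prepare S a b B.work 1 x = ((Real.sqrt (nu a b x) : ℝ) : ℂ) • S B.state x := by
  have h : (LinearIsometryEquiv.piLpCongrRight 2 fun _ : Fin 2 => S) B.work =
      PiLp.single 2 0 (S B.state) := by
    ext i : 1
    rw [LinearIsometryEquiv.piLpCongrRight_apply]
    change S (B.work i) = _
    rw [Blank.work]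
    fin_cases i <;> simp
  rw [prepare, LinearIsometryEquiv.trans_apply, h]
  exact bernoulliGate_blank a b _ x

theorem norm_prepare_work (hS : IsSampler B S d) :
    ‖prepare S a b B.work 1‖ ^ 2 = amplitude d a b ∧
      ‖prepare S a b B.work 0‖ ^ 2 = 1 - amplitude d a b := by
  obtain ⟨ψ, hψ, hS⟩ := hS
  have h1 : ‖prepare S a b B.work 1‖ ^ 2 = amplitude d a b := by
    rw [PiLp.norm_sq_eq_of_L2, amplitude]
    refine Finset.sum_congr rfl fun x _ => ?_
    rw [(prepare_work a b x).2, hS]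
    change ‖_ • (_ • ψ x)‖ ^ 2 = _
    rw [norm_smul, norm_smul, hψ, mul_one, mul_pow, Complex.norm_real, Complex.norm_real,
      Real.norm_eq_abs, Real.norm_eq_abs, sq_abs, sq_abs, Real.sq_sqrt (nu_nonneg _ _ _),
      Real.sq_sqrt ENNReal.toReal_nonneg, mul_comm]
  refine ⟨h1, ?_⟩
  have h2 : ‖prepare S a b B.work‖ ^ 2 = 1 := by
    rw [LinearIsometryEquiv.norm_map, B.norm_work, one_pow]
  rw [PiLp.norm_sq_eq_of_L2, Fin.sum_univ_two, h1] at h2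
  linarith

/-- Conjugating the reflection through the blank state by `U` gives the reflection through `U|0⟩`.
The inner product splits over the qubit, where `reflectGood` flips the sign of the component at 1.
-/
theorem grover_apply (v : Work G Ω) (q : Fin 2) :
    grover B S a b v q =
      (2 * (inner ℂ (prepare S a b B.work 0) (v 0) - inner ℂ (prepare S a b B.work 1) (v 1))) •
        prepare S a b B.work q - reflectGood v q := by
  have h0 : ∀ w : Work G Ω, (reflectGood w 0 : Reg G Ω) = w 0 := fun w => rfl
  have h1 : ∀ w : Work G Ω, (reflectGood w 1 : Reg G Ω) = -w 1 := fun w => rfl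
  have h2 : grover B S a b v = (2 * inner ℂ (prepare S a b B.work) (reflectGood v)) •
      prepare S a b B.work - reflectGood v := by
    change prepare S a b (reflectBlank B ((prepare S a b).symm (reflectGood v))) = _
    rw [reflectBlank, reflectThrough, Submodule.reflection_singleton_apply, two_smul, map_sub,
      map_add, map_smul, LinearIsometryEquiv.apply_symm_apply, B.norm_work]
    have h3 : inner ℂ B.work ((prepare S a b).symm (reflectGood v)) =
        inner ℂ (prepare S a b B.work) (reflectGood v) := by
      rw [← LinearIsometryEquiv.inner_map_map (prepare S a b),
        LinearIsometryEquiv.apply_symm_apply]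
    rw [h3, two_mul, add_smul]
    simp
  rw [h2, PiLp.inner_apply, Fin.sum_univ_two, h0, h1, inner_neg_right, ← sub_eq_add_neg]
  rfl

/-- Each step rotates by 2θ. The coefficients refer to the unnormalised components and are tied to θ
by products, so that amplitudes 0 and 1, where a component vanishes, need no separate treatment. -/
theorem grover_iterate (hS : IsSampler B S d) {θ : ℝ} (hθ : Real.sin θ ^ 2 = amplitude d a b)
    (n : ℕ) : ∃ α β : ℝ, α * Real.cos θ = Real.cos ((2 * n + 1) * θ) ∧
      β * Real.sin θ = Real.sin ((2 * n + 1) * θ) ∧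
      (grover B S a b)^[n] (prepare S a b B.work) 0 = (α : ℂ) • prepare S a b B.work 0 ∧
      (grover B S a b)^[n] (prepare S a b B.work) 1 = (β : ℂ) • prepare S a b B.work 1 := by
  obtain ⟨hn1, hn0⟩ := norm_prepare_work a b hS
  induction n with
  | zero => exact ⟨1, 1, by simp, by simp, by simp, by simp⟩
  | succ n ih =>
    obtain ⟨α, β, hα, hβ, h0, h1⟩ := ih
    have hcs := Real.sin_sq_add_cos_sq θ
    have hc : 1 - amplitude d a b = Real.cos θ ^ 2 := by rw [← hθ]; linarith
    have harg : ((2 * (n + 1 : ℕ) + 1) * θ : ℝ) = (2 * n + 1) * θ + 2 * θ := by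
      push_cast
      ring
    set κ : ℝ := 2 * (α * Real.cos θ ^ 2 - β * Real.sin θ ^ 2) with hκ
    have hin : 2 * (inner ℂ (prepare S a b B.work 0)
          ((grover B S a b)^[n] (prepare S a b B.work) 0) -
        inner ℂ (prepare S a b B.work 1) ((grover B S a b)^[n] (prepare S a b B.work) 1)) =
          (κ : ℂ) := by
      rw [h0, h1, inner_smul_right, inner_smul_right, inner_self_eq_norm_sq_to_K,
        inner_self_eq_norm_sq_to_K, hκ, ← hc, hθ, ← hn0, ← hn1]
      push_cast
      rfl
    refine ⟨κ - α, κ + β, ?_, ?_, ?_, ?_⟩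
    · rw [harg, Real.cos_add, ← hα, ← hβ, Real.cos_two_mul, Real.sin_two_mul, hκ]
      ring
    · rw [harg, Real.sin_add, ← hα, ← hβ, Real.cos_two_mul, Real.sin_two_mul, hκ]
      linear_combination (-2 * β * Real.sin θ) * hcs
    · rw [Function.iterate_succ_apply', grover_apply, hin]
      change _ - (grover B S a b)^[n] (prepare S a b B.work) 0 = _
      rw [h0, ← sub_smul]
      push_cast
      rfl
    · rw [Function.iterate_succ_apply', grover_apply, hin]
      change _ - -((grover B S a b)^[n] (prepare S a b B.work) 1) = _
      rw [h1, sub_neg_eq_add, ← add_smul]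
      push_cast
      rfl

/-- If P and Q are the cosine and sine sums, P ± iQ are geometric sums whose squared moduli are
Fejér kernels at ±θ; the parallelogram law adds them. This replaces the spectral decomposition of
the Grover operator. -/
theorem norm_sum_cos_sq_add_norm_sum_sin_sq (t : ℕ+) (y : ℕ) (θ : ℝ) :
    ‖∑ j ∈ Finset.range t, ((t : ℕ) : ℂ)⁻¹ *
        Complex.exp (Complex.I * (-(2 * Real.pi * y / (t : ℕ)) : ℝ)) ^ j *
          (Real.cos ((2 * j + 1) * θ) : ℂ)‖ ^ 2 +
      ‖∑ j ∈ Finset.range t, ((t : ℕ) : ℂ)⁻¹ *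
        Complex.exp (Complex.I * (-(2 * Real.pi * y / (t : ℕ)) : ℝ)) ^ j *
          (Real.sin ((2 * j + 1) * θ) : ℂ)‖ ^ 2 =
    1 / 2 * (fejer t (θ - Real.pi * y / (t : ℕ)) + fejer t (-θ - Real.pi * y / (t : ℕ))) := by
  set P := ∑ j ∈ Finset.range t, ((t : ℕ) : ℂ)⁻¹ *
        Complex.exp (Complex.I * (-(2 * Real.pi * y / (t : ℕ)) : ℝ)) ^ j *
          (Real.cos ((2 * j + 1) * θ) : ℂ) with hP
  set Q := ∑ j ∈ Finset.range t, ((t : ℕ) : ℂ)⁻¹ *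
        Complex.exp (Complex.I * (-(2 * Real.pi * y / (t : ℕ)) : ℝ)) ^ j *
          (Real.sin ((2 * j + 1) * θ) : ℂ) with hQ
  have key : ∀ s : ℝ, s ^ 2 = 1 → ‖P + (s : ℂ) * (Q * Complex.I)‖ ^ 2 =
      fejer t (s * θ - Real.pi * y / (t : ℕ)) := by
    intro s hs
    have hpq : P + (s : ℂ) * (Q * Complex.I) =
        ((t : ℕ) : ℂ)⁻¹ * Complex.exp (Complex.I * (s * θ : ℝ)) *
          ∑ j ∈ Finset.range t,
            Complex.exp (Complex.I * (2 * (s * θ - Real.pi * y / (t : ℕ)) : ℝ)) ^ j := by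
      rw [hP, hQ, Finset.sum_mul, Finset.mul_sum, ← Finset.sum_add_distrib, Finset.mul_sum]
      refine Finset.sum_congr rfl fun j _ => ?_
      have h1 : ((Real.cos ((2 * j + 1) * θ) : ℝ) : ℂ) +
          (s : ℂ) * (Real.sin ((2 * j + 1) * θ) : ℝ) * Complex.I =
            Complex.exp (Complex.I * (s * θ : ℝ)) * Complex.exp (Complex.I * (2 * (s * θ) : ℝ)) ^ j
          := by
        have h2 : Real.cos (s * ((2 * j + 1) * θ)) = Real.cos ((2 * j + 1) * θ) ∧
            Real.sin (s * ((2 * j + 1) * θ)) = s * Real.sin ((2 * j + 1) * θ) := by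
          rcases mul_self_eq_one_iff.1 ((sq s).symm.trans hs) with rfl | rfl
          · simp
          · simp
        rw [← h2.1, ← Complex.ofReal_mul, ← h2.2, Complex.ofReal_cos, Complex.ofReal_sin,
          ← Complex.exp_mul_I, ← Complex.exp_nat_mul, ← Complex.exp_add]
        congr 1
        push_cast
        ring
      have h3 : Complex.exp (Complex.I * (2 * (s * θ - Real.pi * y / (t : ℕ)) : ℝ)) =
          Complex.exp (Complex.I * (2 * (s * θ) : ℝ)) *
            Complex.exp (Complex.I * (-(2 * Real.pi * y / (t : ℕ)) : ℝ)) := by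
        rw [← Complex.exp_add]
        congr 1
        push_cast
        ring
      rw [h3, mul_pow]
      linear_combination (((t : ℕ) : ℂ)⁻¹ *
        Complex.exp (Complex.I * (-(2 * Real.pi * y / (t : ℕ)) : ℝ)) ^ j) * h1
    rw [hpq, norm_mul, norm_mul, norm_inv, Complex.norm_natCast, mul_comm Complex.I,
      Complex.norm_exp_ofReal_mul_I, mul_one, fejer, mul_pow]
    ring
  have h1 := key 1 (by norm_num)
  have h2 := key (-1) (by norm_num)
  have hpar := parallelogram_law_with_norm ℂ P (Q * Complex.I)
  rw [Complex.ofReal_one, one_mul, one_mul] at h1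
  rw [Complex.ofReal_neg, Complex.ofReal_one, neg_one_mul, neg_one_mul, ← sub_eq_add_neg] at h2
  rw [← h1, ← h2]
  have h3 : ‖Q * Complex.I‖ = ‖Q‖ := by rw [norm_mul, Complex.norm_I, mul_one]
  rw [h3] at hpar
  linarith

theorem measurePhase_gatesAmplEst (hS : IsSampler B S d) {θ : ℝ}
    (hθ : Real.sin θ ^ 2 = amplitude d a b) (y : Fin t) :
    (measurePhase B S (gatesAmplEst B a b t) y).toReal =
      1 / 2 * (fejer t (θ - Real.pi * (y : ℕ) / (t : ℕ)) +
        fejer t (-θ - Real.pi * (y : ℕ) / (t : ℕ))) := by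
  obtain ⟨hn1, hn0⟩ := norm_prepare_work a b hS
  choose α β hα hβ h0 h1 using grover_iterate a b hS hθ
  have hcs := Real.sin_sq_add_cos_sq θ
  have hc : 1 - amplitude d a b = Real.cos θ ^ 2 := by rw [← hθ]; linarith
  rw [measurePhase, PMF.ofFintype_apply, ENNReal.toReal_ofReal (sq_nonneg _),
    circuitUnitary_gatesAmplEst, ← norm_sum_cos_sq_add_norm_sum_sin_sq, PiLp.norm_sq_eq_of_L2,
    Fin.sum_univ_two]
  have hcoef : ∀ j : Fin t, (star (fourierMatrix t)) y j * fourierMatrix t j 0 =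
      ((t : ℕ) : ℂ)⁻¹ *
        Complex.exp (Complex.I * (-(2 * Real.pi * (y : ℕ) / (t : ℕ)) : ℝ)) ^ (j : ℕ) := by
    intro j
    have hs : (((Real.sqrt (t : ℕ))⁻¹ : ℝ) : ℂ) * (((Real.sqrt (t : ℕ))⁻¹ : ℝ) : ℂ) =
        ((t : ℕ) : ℂ)⁻¹ := by
      rw [← Complex.ofReal_mul, ← mul_inv, Real.mul_self_sqrt (Nat.cast_nonneg _)]
      simp
    have hz : ((0 : Fin t) : ℕ) = 0 := rfl
    rw [Matrix.star_apply, fourierMatrix, fourierMatrix, hz, zero_mul, pow_zero, mul_one,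
      RCLike.star_def, map_mul, Complex.conj_ofReal, mul_right_comm, hs, map_pow,
      ← Complex.exp_conj, ← Complex.exp_nat_mul, ← Complex.exp_nat_mul]
    congr 2
    simp only [map_mul, map_div₀, Complex.conj_ofReal, Complex.conj_I, map_natCast, map_ofNat]
    push_cast
    ring
  have hsum : ∀ (q : Fin 2) (γ s : ℕ → ℝ) (σ : ℝ),
      (∀ n, (grover B S a b)^[n] (prepare S a b B.work) q =
        (γ n : ℂ) • prepare S a b B.work q) →
      (∀ n, γ n * σ = s n) → ‖prepare S a b B.work q‖ ^ 2 = σ ^ 2 →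
      ‖(∑ j : Fin t, ((star (fourierMatrix t)) y j * fourierMatrix t j 0) •
        (grover B S a b)^[j] (prepare S a b B.work)) q‖ ^ 2 =
      ‖∑ j ∈ Finset.range t, ((t : ℕ) : ℂ)⁻¹ *
        Complex.exp (Complex.I * (-(2 * Real.pi * (y : ℕ) / (t : ℕ)) : ℝ)) ^ j * (s j : ℂ)‖ ^ 2 := by
    intro q γ s σ hγ hs hσ
    have e1 : (∑ j : Fin t, ((star (fourierMatrix t)) y j * fourierMatrix t j 0) •
        (grover B S a b)^[j] (prepare S a b B.work)) q =
        (∑ j : Fin t, (((t : ℕ) : ℂ)⁻¹ *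
          Complex.exp (Complex.I * (-(2 * Real.pi * (y : ℕ) / (t : ℕ)) : ℝ)) ^ (j : ℕ)) *
            (γ j : ℂ)) • prepare S a b B.work q := by
      rw [WithLp.ofLp_sum, Finset.sum_apply, Finset.sum_smul]
      refine Finset.sum_congr rfl fun j _ => ?_
      rw [PiLp.smul_apply, hγ, smul_smul, hcoef]
    rw [e1, norm_smul, mul_pow, hσ, ← sq_abs σ, ← Real.norm_eq_abs, ← Complex.norm_real, ← mul_pow,
      ← norm_mul, Finset.sum_mul, ← Fin.sum_univ_eq_sum_range (fun j => ((t : ℕ) : ℂ)⁻¹ *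
        Complex.exp (Complex.I * (-(2 * Real.pi * (y : ℕ) / (t : ℕ)) : ℝ)) ^ j * (s j : ℂ))]
    congr 2
    refine Finset.sum_congr rfl fun j _ => ?_
    rw [mul_assoc, ← Complex.ofReal_mul, hs]
  rw [hsum 0 α _ _ h0 hα (hn0.trans hc), hsum 1 β _ _ h1 hβ (hn1.trans hθ.symm)]

end Circuits

section Estimation

variable {G : Type*} [NormedAddCommGroup G] [InnerProductSpace ℂ G] {Ω : Finset ℝ≥0}
variable {B : Blank G Ω} {S : Reg G Ω ≃ₗᵢ[ℂ] Reg G Ω} {d : PMF Ω} (a b : ℝ) {t : ℕ+}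

theorem sum_toReal (d : PMF Ω) : ∑ x : Ω, (d x).toReal = 1 := by
  rw [← ENNReal.toReal_sum fun x _ => d.apply_ne_top x, ← tsum_fintype (L := .unconditional Ω),
    d.tsum_coe, ENNReal.toReal_one]

theorem amplitude_nonneg (d : PMF Ω) : 0 ≤ amplitude d a b :=
  Finset.sum_nonneg fun x _ => mul_nonneg ENNReal.toReal_nonneg (nu_nonneg a b x)

theorem amplitude_le_one (d : PMF Ω) : amplitude d a b ≤ 1 := by
  rw [← sum_toReal d]
  exact Finset.sum_le_sum fun x _ =>
    mul_le_of_le_one_right ENNReal.toReal_nonneg (nu_le_one a b x)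

/-! ### Amplitude estimation -/

/-- The accuracy `2π√p/t + π²/t²` of amplitude estimation. -/
def estError (p : ℝ) (t : ℕ) : ℝ := 2 * (Real.pi / t) * Real.sqrt p + (Real.pi / t) ^ 2

theorem exists_angle (d : PMF Ω) : ∃ θ : ℝ, 0 ≤ θ ∧ θ ≤ Real.pi / 2 ∧
    Real.sin θ = Real.sqrt (amplitude d a b) ∧ Real.sin θ ^ 2 = amplitude d a b := by
  have h0 := amplitude_nonneg a b d
  have h1 := amplitude_le_one a b d
  have hs : Real.sin (Real.arcsin (Real.sqrt (amplitude d a b))) = Real.sqrt (amplitude d a b) :=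
    Real.sin_arcsin (by linarith [Real.sqrt_nonneg (amplitude d a b)]) (Real.sqrt_le_one.2 h1)
  exact ⟨_, Real.arcsin_nonneg.2 (Real.sqrt_nonneg _), Real.arcsin_le_pi_div_two _, hs,
    by rw [hs, Real.sq_sqrt h0]⟩

theorem pr_amplEst_le (s : Set ℝ) (W : Finset (Fin t))
    (hW : ∀ y ∈ W, Real.sin (Real.pi * (y : ℕ) / (t : ℕ)) ^ 2 ∉ s) {c : ℝ}
    (h : 1 - c ≤ ∑ y ∈ W, (measurePhase B S (gatesAmplEst B a b t) y).toReal) :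
    (amplEst B S a b t).pr s ≤ c := by
  have h1 : (amplEst B S a b t).pr s =
      prob (measurePhase B S (gatesAmplEst B a b t))
        {y | Real.sin (Real.pi * (y : ℕ) / (t : ℕ)) ^ 2 ∈ s} := prob_map _ _ _
  have h2 : prob (measurePhase B S (gatesAmplEst B a b t)) (W : Set (Fin t)) =
      ∑ y ∈ W, (measurePhase B S (gatesAmplEst B a b t) y).toReal := by
    rw [prob, PMF.toOuterMeasure_apply_finset, ENNReal.toReal_sum fun _ _ => PMF.apply_ne_top _ _]
  have h3 : prob (measurePhase B S (gatesAmplEst B a b t))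
      {y | Real.sin (Real.pi * (y : ℕ) / (t : ℕ)) ^ 2 ∈ s} ≤
        prob (measurePhase B S (gatesAmplEst B a b t)) (W : Set (Fin t))ᶜ :=
    prob_mono _ fun y hy hyW => hW y hyW hy
  have := prob_add_compl (measurePhase B S (gatesAmplEst B a b t)) (W : Set (Fin t))
  linarith

/-- The window of good outcomes depends on θ only through sin²θ and |sin θ cos θ|, hence is the same
for -θ. Each of the two kernels puts mass 3/4 on it, and so does their average. -/
theorem pr_amplEst_far (hS : IsSampler B S d) :
    (amplEst B S a b t).pr {p | estError (amplitude d a b) t < |p - amplitude d a b|} ≤ 1 / 4 := by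
  classical
  obtain ⟨θ, h0, h1, hs, hθ⟩ := exists_angle a b d
  refine pr_amplEst_le a b _ (Finset.univ.filter fun y : Fin t =>
    |Real.sin (Real.pi * (y : ℕ) / (t : ℕ)) ^ 2 - Real.sin θ ^ 2| ≤
      2 * (Real.pi / (t : ℕ)) * |Real.sin θ * Real.cos θ| + (Real.pi / (t : ℕ)) ^ 2) ?_ ?_
  · intro y hy
    rw [Finset.mem_filter, hθ] at hy
    change ¬estError _ _ < _
    rw [not_lt]
    refine hy.2.trans ?_
    rw [estError, ← hs]
    have hsin : 0 ≤ Real.sin θ := hs ▸ Real.sqrt_nonneg _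
    have hcos : |Real.cos θ| ≤ 1 := Real.abs_cos_le_one θ
    have hpi := Real.pi_pos
    rw [abs_mul, abs_of_nonneg hsin]
    gcongr
    exact mul_le_of_le_one_right hsin hcos
  · simp_rw [measurePhase_gatesAmplEst a b hS hθ, ← Finset.mul_sum, Finset.sum_add_distrib]
    have e1 := three_quarters_le_sum_fejer t.pos θ _ fun y hy =>
      Finset.mem_filter.2 ⟨Finset.mem_univ y, hy⟩
    have e2 := three_quarters_le_sum_fejer t.pos (-θ) _ fun y hy =>
      Finset.mem_filter.2 ⟨Finset.mem_univ y, hy⟩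
    simp only [Real.sin_neg, Real.cos_neg, neg_sq, neg_mul, abs_neg] at e2
    linarith

/-- Jordan's inequality turns sin θ ≤ 1/(2t) into tθ ≤ π/4, so the outcome y = 0, which returns 0,
is likely. -/
theorem pr_amplEst_ne_zero (hS : IsSampler B S d)
    (hp : amplitude d a b < 1 / (4 * ((t : ℕ) : ℝ) ^ 2)) :
    (amplEst B S a b t).pr {0}ᶜ ≤ 1 / 4 := by
  obtain ⟨θ, h0, h1, hs, hθ⟩ := exists_angle a b d
  have ht : (0 : ℝ) < (t : ℕ) := Nat.cast_pos.2 t.pos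
  refine pr_amplEst_le a b _ {0} ?_ ?_
  · intro y hy
    rw [Finset.mem_singleton] at hy
    simp [hy]
  · rw [Finset.sum_singleton, measurePhase_gatesAmplEst a b hS hθ]
    have hsin : Real.sin θ ≤ 1 / (2 * (t : ℕ)) := by
      rw [hs]
      refine Real.sqrt_le_iff.2 ⟨by positivity, hp.le.trans (le_of_eq ?_)⟩
      ring
    have hjor := Real.mul_le_sin h0 h1
    have hpi := Real.pi_pos
    have hz : (t : ℕ) * |θ| ≤ Real.pi / 4 := by
      rw [abs_of_nonneg h0]
      have h3 : 2 / Real.pi * θ ≤ 1 / (2 * (t : ℕ)) := hjor.trans hsin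
      rw [div_mul_eq_mul_div, div_le_div_iff₀ hpi (by positivity)] at h3
      linarith
    have e1 := three_quarters_le_fejer t.pos hz
    have e2 := three_quarters_le_fejer t.pos (θ := -θ) (by rwa [abs_neg])
    have hz0 : (((0 : Fin t) : ℕ) : ℝ) = 0 := by simp
    rw [hz0, mul_zero, zero_div, sub_zero, sub_zero]
    linarith

/-! ### Basic estimation -/

variable {δ : ℝ}

theorem pr_basicEst_le {s : Set ℝ} (hs : sᶜ.OrdConnected) (hδ : 0 < δ)
    (h : (amplEst B S a b t).pr s ≤ 1 / 4) : (basicEst B S a b t δ).pr s ≤ δ ^ 3 :=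
  pr_median_le hs h hδ

theorem pr_basicEst_far (hS : IsSampler B S d) (hδ : 0 < δ) :
    (basicEst B S a b t δ).pr {p | estError (amplitude d a b) t < |p - amplitude d a b|} ≤
      δ ^ 3 := by
  refine pr_basicEst_le a b ?_ hδ (pr_amplEst_far a b hS)
  have : {p | estError (amplitude d a b) t < |p - amplitude d a b|}ᶜ =
      Metric.closedBall (amplitude d a b) (estError (amplitude d a b) t) := by
    ext p
    simp [Real.dist_eq]
  rw [this, Real.closedBall_eq_Icc]
  exact Set.ordConnected_Icc

theorem pr_basicEst_ne_zero (hS : IsSampler B S d) (hδ : 0 < δ)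
    (hp : amplitude d a b < 1 / (4 * ((t : ℕ) : ℝ) ^ 2)) :
    (basicEst B S a b t δ).pr {0}ᶜ ≤ δ ^ 3 := by
  refine pr_basicEst_le a b ?_ hδ (pr_amplEst_ne_zero a b hS hp)
  rw [compl_compl]
  exact Set.ordConnected_singleton

/-- Below 1/(4t²) the estimate is 0. Otherwise π/t ≤ 2π√p, and the additive error is at most (4π +
4π²)p, which is where (1+2π)² comes from. -/
theorem pr_basicEst_upper (hS : IsSampler B S d) (hδ : 0 < δ) :
    (basicEst B S a b t δ).pr {p | (1 + 2 * Real.pi) ^ 2 * amplitude d a b < p} ≤ δ ^ 3 := by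
  have h0 := amplitude_nonneg a b d
  have ht : (0 : ℝ) < (t : ℕ) := Nat.cast_pos.2 t.pos
  have hpi := Real.pi_pos
  rcases lt_or_ge (amplitude d a b) (1 / (4 * ((t : ℕ) : ℝ) ^ 2)) with hp | hp
  · refine (Run.pr_mono _ fun p hlt => ?_).trans (pr_basicEst_ne_zero a b hS hδ hp)
    rintro rfl
    have : 0 ≤ (1 + 2 * Real.pi) ^ 2 * amplitude d a b := by positivity
    exact absurd hlt (not_lt.2 this)
  · refine (Run.pr_mono _ fun p (hlt : _ < p) => ?_).trans (pr_basicEst_far a b hS hδ)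
    change estError _ _ < |p - amplitude d a b|
    refine lt_of_lt_of_le ?_ (le_abs_self _)
    refine lt_of_le_of_lt ?_ (sub_lt_sub_right hlt _)
    have h1 : Real.pi / (t : ℕ) ≤ 2 * Real.pi * Real.sqrt (amplitude d a b) := by
      have : 1 / (2 * ((t : ℕ) : ℝ)) ≤ Real.sqrt (amplitude d a b) :=
        Real.le_sqrt_of_sq_le (le_trans (le_of_eq (by ring)) hp)
      rw [div_le_iff₀ (by positivity)] at this
      rw [div_le_iff₀ ht]
      nlinarith
    have h2 := Real.sq_sqrt h0
    set q := Real.sqrt (amplitude d a b) with hq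
    rw [estError, ← hq, ← h2]
    have hq0 : 0 ≤ q := Real.sqrt_nonneg _
    calc 2 * (Real.pi / (t : ℕ)) * q + (Real.pi / (t : ℕ)) ^ 2
        ≤ 2 * (2 * Real.pi * q) * q + (2 * Real.pi * q) ^ 2 := by gcongr
      _ = _ := by ring

theorem costLE_basicEst : (basicEst B S a b t δ).CostLE (reps δ * (2 * (t : ℕ) + 1)) := by
  have h : (amplEst B S a b t).CostLE (2 * (t : ℕ) + 1) := by
    intro r hr
    obtain ⟨y, _, rfl⟩ := (PMF.mem_support_map_iff _ _ _).1 hr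
    rw [circuitCost_gatesAmplEst]
    push_cast
    exact le_rfl
  exact ((h.replicate (reps δ)).bind fun l => Run.costLE_pure (median l)).mono (by linarith)

end Estimation

/-! ### Moments -/

section Moments

variable {Ω : Finset ℝ≥0} (d : PMF Ω)

/-- The mean of the truncation of the output to `[0, b)`. -/
def truncMean (b : ℝ) : ℝ :=
  ∑ x : Ω, (d x).toReal * if ((x : ℝ≥0) : ℝ) < b then ((x : ℝ≥0) : ℝ) else 0

theorem mean_nonneg : 0 ≤ mean d :=
  Finset.sum_nonneg fun x _ => mul_nonneg ENNReal.toReal_nonneg x.1.2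

theorem phi_nonneg : 0 ≤ phi d := Real.sqrt_nonneg _

theorem phi_sq : phi d ^ 2 = ∑ x : Ω, (d x).toReal * ((x : ℝ≥0) : ℝ) ^ 2 :=
  Real.sq_sqrt (Finset.sum_nonneg fun _ _ => mul_nonneg ENNReal.toReal_nonneg (sq_nonneg _))

theorem mul_nu {b : ℝ} (hb : 0 < b) (a : ℝ) (x : ℝ≥0) :
    b * nu a b x = if a ≤ x ∧ (x : ℝ) < b then (x : ℝ) else 0 := by
  unfold nu
  split_ifs
  · field_simp
  · simp

theorem mul_amplitude {b : ℝ} (hb : 0 < b) (a : ℝ) :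
    b * amplitude d a b = ∑ x : Ω, (d x).toReal *
      if a ≤ ((x : ℝ≥0) : ℝ) ∧ ((x : ℝ≥0) : ℝ) < b then ((x : ℝ≥0) : ℝ) else 0 := by
  rw [amplitude, Finset.mul_sum]
  refine Finset.sum_congr rfl fun x _ => ?_
  rw [← mul_nu hb, mul_left_comm]

theorem mul_amplitude_zero {b : ℝ} (hb : 0 < b) : b * amplitude d 0 b = truncMean d b := by
  rw [mul_amplitude d hb, truncMean]
  simp

theorem truncMean_add {a b : ℝ} (hb : 0 < b) (hab : a ≤ b) :
    truncMean d a + b * amplitude d a b = truncMean d b := by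
  rw [mul_amplitude d hb, truncMean, truncMean, ← Finset.sum_add_distrib]
  refine Finset.sum_congr rfl fun x _ => ?_
  rw [← mul_add]
  congr 1
  split_ifs <;> grind

theorem truncMean_le_mean (b : ℝ) : truncMean d b ≤ mean d :=
  Finset.sum_le_sum fun x _ => mul_le_mul_of_nonneg_left
    (by split_ifs; exacts [le_rfl, x.1.2]) ENNReal.toReal_nonneg

/-- Only values x ≥ b are lost, and for them x ≤ x²/b. -/
theorem mean_sub_truncMean_le {b : ℝ} (hb : 0 < b) : mean d - truncMean d b ≤ phi d ^ 2 / b := by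
  rw [phi_sq, mean, truncMean, ← Finset.sum_sub_distrib, Finset.sum_div]
  refine Finset.sum_le_sum fun x _ => ?_
  rw [← mul_sub, mul_div_assoc]
  refine mul_le_mul_of_nonneg_left ?_ ENNReal.toReal_nonneg
  rw [le_div_iff₀ hb]
  have hx : (0 : ℝ) ≤ (x : ℝ≥0) := x.1.2
  split_ifs with h
  · nlinarith
  · rw [sub_zero, sq]
    exact mul_le_mul_of_nonneg_left (not_lt.1 h) hx

end Moments

/-! ### Summation -/

section Summation

variable {G : Type*} [NormedAddCommGroup G] [InnerProductSpace ℂ G] {Ω : Finset ℝ≥0}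
variable {B : Blank G Ω} {S : Reg G Ω ≃ₗᵢ[ℂ] Reg G Ω} {d : PMF Ω} {Γ δ : ℝ} {t : ℕ+}

theorem pr_sApproxSum_upper (hS : IsSampler B S d) (hΓ : 0 < Γ) (hδ : 0 < δ) (k : ℕ) :
    (sApproxSum B S Γ t δ k).pr {s | (1 + 2 * Real.pi) ^ 2 * truncMean d (2 ^ k * Γ) < s} ≤
      (k + 1) * δ ^ 3 := by
  induction k with
  | zero =>
    refine ((Run.pr_bind_pure_le _ _ _).trans (Run.pr_mono _ ?_)).trans
      ((pr_basicEst_upper 0 Γ hS hδ).trans (by simp))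
    intro p hp
    replace hp : (1 + 2 * Real.pi) ^ 2 * truncMean d (2 ^ 0 * Γ) < Γ * p := hp
    rw [pow_zero, one_mul, ← mul_amplitude_zero d hΓ, mul_left_comm] at hp
    exact lt_of_mul_lt_mul_left hp hΓ.le
  | succ k ih =>
    have hb : 0 < 2 ^ (k + 1) * Γ := by positivity
    have hab : 2 ^ k * Γ ≤ 2 ^ (k + 1) * Γ := by gcongr <;> norm_num
    refine (Run.pr_bind_le_add (b := δ ^ 3) _ (by positivity) ih fun s hs => ?_).trans
      (by push_cast; linarith)
    refine ((Run.pr_bind_pure_le _ _ _).trans (Run.pr_mono _ ?_)).trans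
      (pr_basicEst_upper _ _ hS hδ)
    intro p hp
    replace hp : (1 + 2 * Real.pi) ^ 2 * truncMean d (2 ^ (k + 1) * Γ) < s + 2 ^ (k + 1) * Γ * p := hp
    rw [← truncMean_add d hb hab, mul_add, mul_left_comm] at hp
    replace hs : s ≤ (1 + 2 * Real.pi) ^ 2 * truncMean d (2 ^ k * Γ) := not_lt.1 hs
    refine lt_of_mul_lt_mul_left ?_ hb.le
    linarith

/-- The accumulated error of the estimates that are summed up. -/
def sumError (d : PMF Ω) (Γ : ℝ) (t k : ℕ) : ℝ :=
  Γ * estError (amplitude d 0 Γ) t +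
    ∑ ℓ ∈ Finset.range k,
      2 ^ (ℓ + 1) * Γ * estError (amplitude d (2 ^ ℓ * Γ) (2 ^ (ℓ + 1) * Γ)) t

theorem pr_sApproxSum_far (hS : IsSampler B S d) (hΓ : 0 < Γ) (hδ : 0 < δ) (k : ℕ) :
    (sApproxSum B S Γ t δ k).pr {s | sumError d Γ t k < |s - truncMean d (2 ^ k * Γ)|} ≤
      (k + 1) * δ ^ 3 := by
  induction k with
  | zero =>
    refine ((Run.pr_bind_pure_le _ _ _).trans (Run.pr_mono _ ?_)).trans
      ((pr_basicEst_far 0 Γ hS hδ).trans (by simp))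
    intro p hp
    replace hp : sumError d Γ t 0 < |Γ * p - truncMean d (2 ^ 0 * Γ)| := hp
    rw [sumError, Finset.sum_range_zero, add_zero, pow_zero, one_mul, ← mul_amplitude_zero d hΓ,
      ← mul_sub, abs_mul, abs_of_pos hΓ] at hp
    exact lt_of_mul_lt_mul_left hp hΓ.le
  | succ k ih =>
    have hb : 0 < 2 ^ (k + 1) * Γ := by positivity
    have hab : 2 ^ k * Γ ≤ 2 ^ (k + 1) * Γ := by gcongr <;> norm_num
    refine (Run.pr_bind_le_add (b := δ ^ 3) _ (by positivity) ih fun s hs => ?_).trans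
      (by push_cast; linarith)
    refine ((Run.pr_bind_pure_le _ _ _).trans (Run.pr_mono _ ?_)).trans
      (pr_basicEst_far _ _ hS hδ)
    intro p hp
    replace hp : sumError d Γ t (k + 1) < |s + 2 ^ (k + 1) * Γ * p - truncMean d (2 ^ (k + 1) * Γ)| := hp
    replace hs : |s - truncMean d (2 ^ k * Γ)| ≤ sumError d Γ t k := not_lt.1 hs
    have htri := abs_add_le (s - truncMean d (2 ^ k * Γ)) (2 ^ (k + 1) * Γ *
      (p - amplitude d (2 ^ k * Γ) (2 ^ (k + 1) * Γ)))
    rw [abs_mul, abs_of_pos hb] at htri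
    have heq : s + 2 ^ (k + 1) * Γ * p - truncMean d (2 ^ (k + 1) * Γ) =
        s - truncMean d (2 ^ k * Γ) + 2 ^ (k + 1) * Γ *
          (p - amplitude d (2 ^ k * Γ) (2 ^ (k + 1) * Γ)) := by
      rw [← truncMean_add d hb hab]
      ring
    rw [heq, sumError, Finset.sum_range_succ, ← add_assoc, ← sumError] at hp
    refine lt_of_mul_lt_mul_left ?_ hb.le
    linarith

/-- On a dyadic block ending at b one has b ≤ 2x, so (b√p)² = b·(bp) is at most twice the block's
share of φ²; Cauchy–Schwarz over k blocks gives √(2k)φ. The block starting at 0 has no such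
comparison and contributes √(Γμ). -/
theorem sumError_le (d : PMF Ω) (hΓ : 0 < Γ) (t k : ℕ) :
    sumError d Γ t k ≤ 2 * (Real.pi / t) * (Real.sqrt (Γ * mean d) + Real.sqrt (2 * k) * phi d) +
      2 ^ (k + 1) * Γ * (Real.pi / t) ^ 2 := by
  have hpt : 0 ≤ Real.pi / t := div_nonneg Real.pi_pos.le (Nat.cast_nonneg _)
  have hsq : ∀ b a : ℝ, 0 < b → b * Real.sqrt (amplitude d a b) =
      Real.sqrt (b * (b * amplitude d a b)) := fun b a hb => by
    rw [← mul_assoc, ← sq, Real.sqrt_mul (sq_nonneg b), Real.sqrt_sq hb.le]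
  have h0 : Γ * Real.sqrt (amplitude d 0 Γ) ≤ Real.sqrt (Γ * mean d) := by
    rw [hsq Γ 0 hΓ, mul_amplitude_zero d hΓ]
    exact Real.sqrt_le_sqrt (mul_le_mul_of_nonneg_left (truncMean_le_mean d Γ) hΓ.le)
  have hgeom : ∀ k : ℕ, Γ + ∑ ℓ ∈ Finset.range k, 2 ^ (ℓ + 1) * Γ ≤ 2 ^ (k + 1) * Γ := by
    intro k
    induction k with
    | zero => simp; linarith
    | succ k ih => rw [Finset.sum_range_succ, pow_succ 2 (k + 1)]; linarith
  have hcs : ∑ ℓ ∈ Finset.range k,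
      2 ^ (ℓ + 1) * Γ * Real.sqrt (amplitude d (2 ^ ℓ * Γ) (2 ^ (ℓ + 1) * Γ)) ≤
        Real.sqrt (2 * k) * phi d := by
    refine abs_le_of_sq_le_sq' ?_ (mul_nonneg (Real.sqrt_nonneg _) (phi_nonneg d)) |>.2
    refine (sq_sum_le_card_mul_sum_sq).trans ?_
    rw [mul_pow, Real.sq_sqrt (by positivity), Finset.card_range, mul_comm (2 : ℝ), mul_assoc]
    refine mul_le_mul_of_nonneg_left ?_ (Nat.cast_nonneg _)
    have hsum : ∀ n : ℕ, ∑ ℓ ∈ Finset.range n,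
        (2 ^ (ℓ + 1) * Γ * Real.sqrt (amplitude d (2 ^ ℓ * Γ) (2 ^ (ℓ + 1) * Γ))) ^ 2 ≤
          2 * ∑ x : Ω, (d x).toReal *
            if ((x : ℝ≥0) : ℝ) < 2 ^ n * Γ then ((x : ℝ≥0) : ℝ) ^ 2 else 0 := by
      intro n
      induction n with
      | zero =>
        rw [Finset.sum_range_zero]
        refine mul_nonneg zero_le_two (Finset.sum_nonneg fun x _ => mul_nonneg
          ENNReal.toReal_nonneg ?_)
        split_ifs <;> positivity
      | succ n ih =>
        rw [Finset.sum_range_succ]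
        refine (add_le_add_left ih _).trans ?_
        have hb : 0 < 2 ^ (n + 1) * Γ := by positivity
        rw [hsq _ _ hb, Real.sq_sqrt (mul_nonneg hb.le (mul_nonneg hb.le (amplitude_nonneg _ _ d))),
          mul_amplitude d hb, Finset.mul_sum, Finset.mul_sum, Finset.mul_sum,
          ← Finset.sum_add_distrib]
        refine Finset.sum_le_sum fun x _ => ?_
        have hx : (0 : ℝ) ≤ (x : ℝ≥0) := x.1.2
        have hd : 0 ≤ (d x).toReal := ENNReal.toReal_nonneg
        rw [mul_left_comm (2 : ℝ), mul_left_comm (2 ^ (n + 1) * Γ), mul_left_comm (2 : ℝ), ← mul_add]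
        refine mul_le_mul_of_nonneg_left ?_ hd
        have hn : (2 : ℝ) ^ (n + 1) * Γ = 2 * (2 ^ n * Γ) := by ring
        rw [hn]
        have hpos : 0 < 2 ^ n * Γ := by positivity
        generalize (2 : ℝ) ^ n * Γ = c at hpos ⊢
        generalize ((x : ℝ≥0) : ℝ) = z at hx ⊢
        by_cases h1 : z < c
        · have h2 : z < 2 * c := by linarith
          simp [h1, h2, not_le.2 h1]
        · by_cases h2 : z < 2 * c
          · simp only [h1, h2, not_lt.1 h1, if_true, if_false, and_self]
            nlinarith [not_lt.1 h1]
          · simp [h1, h2]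
    refine (hsum k).trans (mul_le_mul_of_nonneg_left ?_ zero_le_two)
    rw [phi_sq]
    refine Finset.sum_le_sum fun x _ => mul_le_mul_of_nonneg_left ?_ ENNReal.toReal_nonneg
    split_ifs <;> [exact le_rfl; positivity]
  have hsplit : sumError d Γ t k = 2 * (Real.pi / t) * (Γ * Real.sqrt (amplitude d 0 Γ) +
      ∑ ℓ ∈ Finset.range k,
        2 ^ (ℓ + 1) * Γ * Real.sqrt (amplitude d (2 ^ ℓ * Γ) (2 ^ (ℓ + 1) * Γ))) +
      (Γ + ∑ ℓ ∈ Finset.range k, 2 ^ (ℓ + 1) * Γ) * (Real.pi / t) ^ 2 := by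
    have : ∀ ℓ : ℕ, 2 ^ (ℓ + 1) * Γ * estError (amplitude d (2 ^ ℓ * Γ) (2 ^ (ℓ + 1) * Γ)) t =
        2 * (Real.pi / t) * (2 ^ (ℓ + 1) * Γ *
          Real.sqrt (amplitude d (2 ^ ℓ * Γ) (2 ^ (ℓ + 1) * Γ))) +
          2 ^ (ℓ + 1) * Γ * (Real.pi / t) ^ 2 := fun ℓ => by
      rw [estError]
      ring
    rw [sumError, Finset.sum_congr rfl fun ℓ _ => this ℓ, Finset.sum_add_distrib,
      ← Finset.mul_sum, ← Finset.sum_mul, estError]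
    ring
  rw [hsplit]
  have := hgeom k
  gcongr

theorem succ_mul_div_pow_three_le (k : ℕ) (hδ : 0 < δ) :
    ((k : ℝ) + 1) * (δ / (k + 1)) ^ 3 ≤ δ ^ 3 := by
  have h1 : (1 : ℝ) ≤ (k : ℝ) + 1 := by
    have : (0 : ℝ) ≤ k := Nat.cast_nonneg k
    linarith
  have h2 : ((k : ℝ) + 1) * (δ / (k + 1)) ^ 3 = δ ^ 3 / (k + 1) ^ 2 := by
    field_simp
  rw [h2]
  exact div_le_self (by positivity) (one_le_pow₀ h1)

theorem pr_sApprox_upper (hS : IsSampler B S d) (hΓ : 0 < Γ) (hδ : 0 < δ) :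
    (sApprox B S Γ t δ).pr {s | (1 + 2 * Real.pi) ^ 2 * mean d < s} ≤ δ ^ 3 := by
  obtain ⟨k, hk⟩ : ∃ k, k = Nat.clog 2 t - 1 := ⟨_, rfl⟩
  obtain ⟨t₀, ht₀⟩ : ∃ t₀ : ℕ+, t₀ =
    ⌈3 * Real.pi ^ 2 * (t : ℕ) * Real.sqrt (Real.logb 2 (t : ℕ))⌉₊.toPNat' := ⟨_, rfl⟩
  rw [sApprox, ← hk, ← ht₀]
  have hup := pr_sApproxSum_upper (t := t₀) hS hΓ (δ := δ / (k + 1)) (by positivity) k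
  refine (Run.pr_mono _ fun s hs => ?_).trans (hup.trans (succ_mul_div_pow_three_le _ hδ))
  replace hs : (1 + 2 * Real.pi) ^ 2 * mean d < s := hs
  refine lt_of_le_of_lt ?_ hs
  have := truncMean_le_mean d (2 ^ k * Γ)
  gcongr

/-- Since 2^k < t ≤ 2^(k+1), the cut-off tail costs at most 2φ²/(Γt). The factor √(log t) in `t₀`
cancels the √(2k) of `sumError_le`, leaving an error of order 1/t. -/
theorem pr_sApprox_far (hS : IsSampler B S d) (hΓ : 0 < Γ) (hδ : 0 < δ) (ht : 2 ≤ (t : ℕ)) :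
    (sApprox B S Γ t δ).pr {s | (2 * phi d ^ 2 / Γ + Real.sqrt (Γ * mean d) + phi d + Γ) /
      (t : ℕ) < |s - mean d|} ≤ δ ^ 3 := by
  obtain ⟨k, hk⟩ : ∃ k, k = Nat.clog 2 t - 1 := ⟨_, rfl⟩
  obtain ⟨t₀, ht₀⟩ : ∃ t₀ : ℕ+, t₀ =
    ⌈3 * Real.pi ^ 2 * (t : ℕ) * Real.sqrt (Real.logb 2 (t : ℕ))⌉₊.toPNat' := ⟨_, rfl⟩
  rw [sApprox, ← hk, ← ht₀]
  have hfar := pr_sApproxSum_far (t := t₀) hS hΓ (δ := δ / (k + 1)) (by positivity) k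
  refine (Run.pr_mono _ fun s hs => ?_).trans (hfar.trans (succ_mul_div_pow_three_le _ hδ))
  replace hs : (2 * phi d ^ 2 / Γ + Real.sqrt (Γ * mean d) + phi d + Γ) / (t : ℕ) <
    |s - mean d| := hs
  change sumError d Γ t₀ k < |s - truncMean d (2 ^ k * Γ)|
  have hclog : 0 < Nat.clog 2 t := Nat.clog_pos one_lt_two ht
  have htr : (2 : ℝ) ≤ (t : ℕ) := by exact_mod_cast ht
  have htpos : (0 : ℝ) < (t : ℕ) := by linarith
  have hk1 : (2 : ℝ) ^ k < (t : ℕ) := by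
    have : 2 ^ k < (t : ℕ) := by
      rw [hk]
      exact Nat.pow_pred_clog_lt_self one_lt_two (by omega)
    exact_mod_cast this
  have hk2 : ((t : ℕ) : ℝ) ≤ 2 * 2 ^ k := by
    have h1 : (t : ℕ) ≤ 2 ^ (k + 1) := by
      have := Nat.le_pow_clog one_lt_two (t : ℕ)
      rwa [hk, Nat.sub_add_cancel hclog]
    rw [pow_succ, mul_comm] at h1
    exact_mod_cast h1
  set lg := Real.logb 2 (t : ℕ) with hlg
  have hlg1 : 1 ≤ lg := by
    rw [hlg, Real.le_logb_iff_rpow_le one_lt_two htpos, Real.rpow_one]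
    exact htr
  have hklg : (k : ℝ) ≤ lg := by
    rw [hlg, Real.le_logb_iff_rpow_le one_lt_two htpos, Real.rpow_natCast]
    exact hk1.le
  have hsq1 : 1 ≤ Real.sqrt lg := Real.one_le_sqrt.2 hlg1
  have hpi := Real.pi_gt_three
  have ht0 : 3 * Real.pi ^ 2 * (t : ℕ) * Real.sqrt lg ≤ (t₀ : ℕ) := by
    refine (Nat.le_ceil _).trans ?_
    rw [ht₀, Nat.toPNat'_coe]
    split_ifs with h
    · exact le_rfl
    · exact_mod_cast (not_lt.1 h).trans zero_le_one
  have hpt : Real.pi / (t₀ : ℕ) ≤ 1 / (9 * (t : ℕ) * Real.sqrt lg) := by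
    have hpos : 0 < 3 * Real.pi ^ 2 * (t : ℕ) * Real.sqrt lg := by positivity
    rw [div_le_div_iff₀ (hpos.trans_le ht0) (by positivity)]
    have h1 : Real.pi * (9 * (t : ℕ) * Real.sqrt lg) ≤ 3 * Real.pi ^ 2 * (t : ℕ) * Real.sqrt lg := by
      have : 0 ≤ (t : ℕ) * Real.sqrt lg * Real.pi * (Real.pi - 3) := by
        have : 0 ≤ Real.pi - 3 := by linarith
        positivity
      nlinarith
    linarith
  have hsqk : Real.sqrt (2 * k) ≤ 2 * Real.sqrt lg := by
    rw [Real.sqrt_le_left (by positivity), mul_pow, Real.sq_sqrt (by linarith)]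
    linarith
  have hφ := phi_nonneg d
  have htail : mean d - truncMean d (2 ^ k * Γ) ≤ 2 * phi d ^ 2 / Γ / (t : ℕ) := by
    refine (mean_sub_truncMean_le d (by positivity)).trans ?_
    rw [div_div, div_le_div_iff₀ (by positivity) (by positivity)]
    have : phi d ^ 2 * Γ * (t : ℕ) ≤ phi d ^ 2 * Γ * (2 * 2 ^ k) := by gcongr
    linarith
  have hse : sumError d Γ t₀ k ≤ (Real.sqrt (Γ * mean d) + phi d + Γ) / (t : ℕ) := by
    refine (sumError_le d hΓ t₀ k).trans ?_
    have hsm := Real.sqrt_nonneg (Γ * mean d)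
    have e1 : 2 * (Real.pi / (t₀ : ℕ)) * (Real.sqrt (Γ * mean d) + Real.sqrt (2 * k) * phi d) ≤
        2 * (1 / (9 * (t : ℕ) * Real.sqrt lg)) *
          (Real.sqrt (Γ * mean d) * Real.sqrt lg + 2 * Real.sqrt lg * phi d) := by
      gcongr
      exact le_mul_of_one_le_right hsm hsq1
    have e2 : 2 ^ (k + 1) * Γ * (Real.pi / (t₀ : ℕ)) ^ 2 ≤
        2 * (t : ℕ) * Γ * (1 / (9 * (t : ℕ))) ^ 2 := by
      have h1 : (2 : ℝ) ^ (k + 1) ≤ 2 * (t : ℕ) := by rw [pow_succ]; linarith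
      have h2 : Real.pi / (t₀ : ℕ) ≤ 1 / (9 * (t : ℕ)) := by
        exact hpt.trans (one_div_le_one_div_of_le (by positivity)
          (le_mul_of_one_le_right (by positivity) hsq1))
      gcongr
    have e3 : 2 * (1 / (9 * (t : ℕ) * Real.sqrt lg)) *
          (Real.sqrt (Γ * mean d) * Real.sqrt lg + 2 * Real.sqrt lg * phi d) =
        (2 / 9 * Real.sqrt (Γ * mean d) + 4 / 9 * phi d) / (t : ℕ) := by
      have : Real.sqrt lg ≠ 0 := by positivity
      field_simp
      ring
    have e4 : 2 * (t : ℕ) * Γ * (1 / (9 * (t : ℕ))) ^ 2 = (2 / 81 * Γ) / (t : ℕ) := by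
      field_simp
      ring
    refine (add_le_add e1 e2).trans ?_
    rw [e3, e4, ← add_div]
    refine div_le_div_of_nonneg_right ?_ htpos.le
    linarith
  have htri : |s - mean d| ≤ |s - truncMean d (2 ^ k * Γ)| + (mean d - truncMean d (2 ^ k * Γ)) := by
    have h1 := truncMean_le_mean d (2 ^ k * Γ)
    have h2 := abs_sub_le s (truncMean d (2 ^ k * Γ)) (mean d)
    rw [abs_sub_comm (truncMean d (2 ^ k * Γ)), abs_of_nonneg (by linarith : 0 ≤ mean d - _)] at h2
    exact h2
  have hfin : (2 * phi d ^ 2 / Γ + Real.sqrt (Γ * mean d) + phi d + Γ) / (t : ℕ) =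
      2 * phi d ^ 2 / Γ / (t : ℕ) + (Real.sqrt (Γ * mean d) + phi d + Γ) / (t : ℕ) := by
    rw [← add_div]
    ring_nf
  rw [hfin] at hs
  linarith

theorem costLE_sApproxSum (k : ℕ) :
    (sApproxSum B S Γ t δ k).CostLE ((k + 1) * (reps δ * (2 * (t : ℕ) + 1))) := by
  induction k with
  | zero =>
    exact ((costLE_basicEst 0 Γ).bind fun p => Run.costLE_pure (Γ * p)).mono (by simp)
  | succ k ih =>
    exact (ih.bind fun s => (costLE_basicEst _ _).bind fun p => Run.costLE_pure _).mono
      (by push_cast; linarith)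

end Summation

section Search

variable {G : Type*} [NormedAddCommGroup G] [InnerProductSpace ℂ G] {Ω : Finset ℝ≥0}
variable {B : Blank G Ω} {S : Reg G Ω ≃ₗᵢ[ℂ] Reg G Ω} {d : PMF Ω} {Δ : ℕ+} {L H ε δ : ℝ}

/-! ### Estimation with an explicit bound -/

theorem coe_twentyFive_mul (Δ : ℕ+) : (((25 * Δ : ℕ+) : ℕ) : ℝ) = 25 * (Δ : ℕ) := by
  push_cast
  rfl

/-- The amplitude is at most μ/(MΔ²), and 2500 = 4·25² is the threshold below which estimation with
25Δ returns 0. -/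
theorem amplitude_lt_of_large {M : ℝ} (hμ : 0 ≤ mean d) (hM : 2500 * mean d < M) :
    amplitude d 0 (M * (Δ : ℕ) ^ 2) < 1 / (4 * (((25 * Δ : ℕ+) : ℕ) : ℝ) ^ 2) := by
  have hΔ : (0 : ℝ) < (Δ : ℕ) := Nat.cast_pos.2 Δ.pos
  have hM0 : 0 < M := by linarith
  have h1 := mul_amplitude_zero d (b := M * (Δ : ℕ) ^ 2) (by positivity)
  have h2 := truncMean_le_mean d (M * (Δ : ℕ) ^ 2)
  rw [coe_twentyFive_mul, lt_div_iff₀ (by positivity)]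
  have h3 : M * (amplitude d 0 (M * (Δ : ℕ) ^ 2) * (4 * (25 * ((Δ : ℕ) : ℝ)) ^ 2)) < M * 1 := by
    linarith
  exact lt_of_mul_lt_mul_left h3 hM0.le

/-- Truncation loses at most φ²/(MΔ²) ≤ μ²/M, so with s = μ/M in (1/8, 1/2] the amplitude times Δ²
is at least s - s² ≥ 7/64. An error smaller than the amplitude means that the estimate cannot be 0.
-/
theorem estError_lt_amplitude {M : ℝ} (hμ : 0 < mean d) (hφ : phi d ≤ (Δ : ℕ) * mean d)
    (h1 : 2 * mean d ≤ M) (h2 : M < 8 * mean d) :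
    estError (amplitude d 0 (M * (Δ : ℕ) ^ 2)) ((25 * Δ : ℕ+) : ℕ) <
      amplitude d 0 (M * (Δ : ℕ) ^ 2) := by
  have hΔ : (0 : ℝ) < (Δ : ℕ) := Nat.cast_pos.2 Δ.pos
  have hM0 : 0 < M := by linarith
  have hb : 0 < M * ((Δ : ℕ) : ℝ) ^ 2 := by positivity
  have e1 := mul_amplitude_zero d hb
  have e2 := mean_sub_truncMean_le d hb
  have hφ2 : phi d ^ 2 ≤ ((Δ : ℕ) * mean d) ^ 2 := pow_le_pow_left₀ (phi_nonneg d) hφ 2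
  have e3 : phi d ^ 2 / (M * ((Δ : ℕ) : ℝ) ^ 2) ≤ mean d ^ 2 / M := by
    rw [div_le_div_iff₀ hb hM0]
    nlinarith
  set p := amplitude d 0 (M * (Δ : ℕ) ^ 2) with hp
  have hp0 : 0 ≤ p := amplitude_nonneg _ _ d
  set q := Real.sqrt p * (Δ : ℕ) with hq
  have hq0 : 0 ≤ q := by positivity
  have hq2 : q ^ 2 = p * ((Δ : ℕ) : ℝ) ^ 2 := by rw [hq, mul_pow, Real.sq_sqrt hp0]
  have e4 : mean d - mean d ^ 2 / M ≤ M * q ^ 2 := by rw [hq2]; linarith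
  have e5 : 7 / 64 ≤ q ^ 2 := by
    have e6 : mean d * M - mean d ^ 2 ≤ M ^ 2 * q ^ 2 := by
      have e7 : M * (mean d - mean d ^ 2 / M) = mean d * M - mean d ^ 2 := by field_simp
      nlinarith
    have e8 : 7 / 64 * M ^ 2 ≤ mean d * M - mean d ^ 2 := by nlinarith
    have e9 : M ^ 2 * (7 / 64) ≤ M ^ 2 * q ^ 2 := by linarith
    exact le_of_mul_le_mul_left e9 (by positivity)
  have e10 : 33 / 100 ≤ q := by
    by_contra hlt
    push Not at hlt
    nlinarith
  have hpi := Real.pi_lt_d2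
  have hpi2 := pi_sq_lt
  have e11 : 2 * Real.pi / 25 * q + Real.pi ^ 2 / 625 < q ^ 2 := by nlinarith
  have e12 : estError p ((25 * Δ : ℕ+) : ℕ) * ((Δ : ℕ) : ℝ) ^ 2 =
      2 * Real.pi / 25 * q + Real.pi ^ 2 / 625 := by
    rw [estError, coe_twentyFive_mul, hq]
    field_simp
    ring
  have e13 : estError p ((25 * Δ : ℕ+) : ℕ) * ((Δ : ℕ) : ℝ) ^ 2 < p * ((Δ : ℕ) : ℝ) ^ 2 := by
    rw [e12, ← hq2]
    exact e11
  exact lt_of_mul_lt_mul_right e13 (by positivity)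

/-- Above 2500μ the loop must continue and in [c, 2c) it must stop; in between both are harmless.
Since c ≥ 2L the test against L does not interfere before that, and n bounds the number of halvings.
-/
theorem pr_searchLoop (hS : IsSampler B S d) (hL : 0 < L) (hδ : 0 < δ) (hμ : 0 < mean d)
    (hφ : phi d ≤ (Δ : ℕ) * mean d) {c : ℝ} (hcL : 2 * L ≤ c) (hcμ : 2 * mean d ≤ c)
    (hcμ' : c ≤ 4 * mean d) (n : ℕ) {M : ℝ} (hM : 2 * c ≤ M) (hMn : M < 2 ^ (n + 1) * c) :
    (searchLoop B S Δ L hL δ M 0).pr {x | ¬(c ≤ x ∧ x ≤ 2500 * mean d)} ≤ n * δ ^ 3 := by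
  induction n generalizing M with
  | zero =>
    rw [zero_add, pow_one] at hMn
    exact absurd hMn (not_lt.2 hM)
  | succ n ih =>
    have hη : 0 ≤ δ ^ 3 := by positivity
    rw [searchLoop, dif_pos ⟨rfl, by linarith⟩]
    -- `A` collects the estimates that would take the wrong branch at this value of M; it is empty
    -- where either branch is right.
    obtain ⟨A, hA, hA1, hA2⟩ : ∃ A : Set ℝ,
        (basicEst B S 0 (M / 2 * (Δ : ℕ) ^ 2) (25 * Δ) δ).pr A ≤ δ ^ 3 ∧
        (0 ∉ A → 2 * c ≤ M / 2) ∧ ∀ p, p ≠ 0 → p ∉ A → M / 2 ≤ 2500 * mean d := by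
      rcases lt_or_ge (2500 * mean d) (M / 2) with h | h
      · exact ⟨{0}ᶜ, pr_basicEst_ne_zero _ _ hS hδ (amplitude_lt_of_large hμ.le h),
          fun _ => by linarith, fun p hp hpA => absurd hp hpA⟩
      · rcases lt_or_ge (M / 2) (2 * c) with h' | h'
        · have hlt := estError_lt_amplitude (M := M / 2) hμ hφ (by linarith) (by linarith)
          have hpos := amplitude_nonneg 0 (M / 2 * (Δ : ℕ) ^ 2) d
          refine ⟨_, pr_basicEst_far _ _ hS hδ, fun h0 => absurd ?_ h0, fun _ _ _ => h⟩
          change _ < |0 - amplitude d 0 (M / 2 * (Δ : ℕ) ^ 2)|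
          rwa [zero_sub, abs_neg, abs_of_nonneg hpos]
        · refine ⟨∅, ?_, fun _ => h', fun _ _ _ => h⟩
          rw [Run.pr, Set.preimage_empty, prob_eq_zero _ fun _ _ => Set.notMem_empty _]
          exact hη
    refine (Run.pr_bind_le_add (b := n * δ ^ 3) A (by positivity) hA fun p hp => ?_).trans
      (by push_cast; linarith)
    rcases eq_or_ne p 0 with rfl | hne
    · refine ih (hA1 hp) ?_
      rw [pow_succ] at hMn
      linarith
    · rw [searchLoop, dif_neg fun h => hne h.1]
      refine (Run.pr_pure_of_notMem ?_).le.trans (by positivity)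
      exact not_not.2 ⟨by linarith, hA2 p hne hp⟩

theorem exists_pow_bound {c : ℝ} (hL : 0 < L) (hLH : L < H) (hc : 2 * L ≤ c) :
    ∃ n : ℕ, (n : ℝ) ≤ 2 + Real.logb 2 (H / L) ∧ 8 * H < 2 ^ (n + 1) * c := by
  have hH : 0 < H := hL.trans hLH
  have hlog : 0 ≤ Real.logb 2 (H / L) :=
    Real.logb_nonneg one_lt_two ((one_le_div hL).2 hLH.le)
  refine ⟨⌊2 + Real.logb 2 (H / L)⌋₊, Nat.floor_le (by positivity), ?_⟩
  have h1 := Nat.lt_floor_add_one (2 + Real.logb 2 (H / L))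
  have h2 : H / L * 4 < 2 ^ (⌊2 + Real.logb 2 (H / L)⌋₊ + 1) := by
    have h3 : Real.logb 2 (H / L * 4) < (⌊2 + Real.logb 2 (H / L)⌋₊ + 1 : ℕ) := by
      rw [Real.logb_mul (by positivity) (by norm_num), show (4 : ℝ) = 2 ^ (2 : ℝ) by norm_num,
        Real.logb_rpow two_pos (by norm_num)]
      push_cast
      linarith
    rwa [Real.logb_lt_iff_lt_rpow one_lt_two (by positivity), Real.rpow_natCast] at h3
  rw [div_mul_eq_mul_div, div_lt_iff₀ hL] at h2
  have : (2 : ℝ) ^ (⌊2 + Real.logb 2 (H / L)⌋₊ + 1) * (2 * L) ≤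
      2 ^ (⌊2 + Real.logb 2 (H / L)⌋₊ + 1) * c := by gcongr
  linarith

theorem mul_div_pow_three_le {n N : ℝ} (hN : 1 ≤ N) (hn : n ≤ N) (hδ : 0 < δ) :
    n * (δ / (2 * N)) ^ 3 ≤ (δ / 2) ^ 3 := by
  have h1 : n * (δ / (2 * N)) ^ 3 ≤ N * (δ / (2 * N)) ^ 3 := by gcongr
  have h2 : N * (δ / (2 * N)) ^ 3 = (δ / 2) ^ 3 / N ^ 2 := by field_simp
  rw [h2] at h1
  exact h1.trans (div_le_self (by positivity) (one_le_pow₀ hN))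

theorem le_toPNat' (x : ℝ) : x ≤ ((⌈x⌉₊.toPNat' : ℕ+) : ℕ) := by
  refine (Nat.le_ceil _).trans ?_
  rw [Nat.toPNat'_coe]
  split_ifs with h
  · exact le_rfl
  · exact_mod_cast (not_lt.1 h).trans zero_le_one

theorem pr_epsApprox_upper (hS : IsSampler B S d) (hL : 0 < L) (hδ : 0 < δ) :
    (epsApprox B S Δ L H hL ε δ).pr {m | (1 + 2 * Real.pi) ^ 2 * mean d < m} ≤ δ ^ 3 / 8 := by
  have hμ := mean_nonneg d
  have hΔ : (0 : ℝ) < (Δ : ℕ) := Nat.cast_pos.2 Δ.pos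
  rw [epsApprox]
  refine Run.pr_bind_le_of_forall (by positivity) fun M => ?_
  split_ifs with h
  · refine (Run.pr_pure_of_notMem ?_).le.trans (by positivity)
    change ¬(1 + 2 * Real.pi) ^ 2 * mean d < 0
    rw [not_lt]
    positivity
  · have hM : 0 < M := by linarith
    refine (pr_sApprox_upper hS (by positivity) (by positivity)).trans (le_of_eq ?_)
    ring

/-- The range L ≤ 2μ, wider than L ≤ μ, is what the tail of the cost requires; this is why the
search window starts at 2 max(L, μ). -/
theorem pr_epsApprox_far (hS : IsSampler B S d) (hL : 0 < L) (hLH : L < H) (hδ : 0 < δ)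
    (hε : 0 < ε) (hε1 : ε ≤ 1) (hLμ : L ≤ 2 * mean d) (hμH : mean d < H)
    (hφ : phi d ≤ (Δ : ℕ) * mean d) :
    (epsApprox B S Δ L H hL ε δ).pr {m | ε * mean d < |m - mean d|} ≤ δ ^ 3 / 4 := by
  have hμ : 0 < mean d := by linarith
  have hΔ : (1 : ℝ) ≤ (Δ : ℕ) := by exact_mod_cast Δ.pos
  have hlog : 0 ≤ Real.logb 2 (H / L) :=
    Real.logb_nonneg one_lt_two ((one_le_div hL).2 hLH.le)
  set c := 2 * max L (mean d) with hc
  have hcL : 2 * L ≤ c := by rw [hc]; gcongr; exact le_max_left _ _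
  have hcμ : 2 * mean d ≤ c := by rw [hc]; gcongr; exact le_max_right _ _
  have hcμ' : c ≤ 4 * mean d := by
    have : max L (mean d) ≤ 2 * mean d := max_le hLμ (by linarith)
    linarith
  have hcH : c ≤ 2 * H := by
    have : max L (mean d) ≤ H := max_le hLH.le hμH.le
    linarith
  obtain ⟨n, hn, hn'⟩ := exists_pow_bound (H := H) hL hLH hcL
  have hsearch := pr_searchLoop (Δ := Δ) (δ := δ / (2 * (3 + Real.logb 2 (H / L)))) hS hL
    (by positivity) hμ hφ hcL hcμ hcμ' n (M := 8 * H) (by linarith) hn'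
  have hsearch' := hsearch.trans (mul_div_pow_three_le (by linarith) (by linarith) hδ)
  rw [epsApprox]
  refine (Run.pr_bind_le_add (b := (δ / 2) ^ 3) _ (by positivity) hsearch' fun M hM => ?_).trans
    (le_of_eq (by ring))
  obtain ⟨hM1, hM2⟩ : c ≤ M ∧ M ≤ 2500 * mean d := not_not.1 hM
  rw [if_neg (by linarith)]
  have hM0 : 0 < M := by linarith
  have ht := le_toPNat' (51 ^ 2 * ε⁻¹ * (Δ : ℕ))
  set t := ⌈51 ^ 2 * ε⁻¹ * ((Δ : ℕ) : ℝ)⌉₊.toPNat' with htdef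
  have hε1' : 1 ≤ ε⁻¹ := (one_le_inv₀ hε).2 hε1
  have ht2 : (2 : ℝ) ≤ (t : ℕ) := by
    refine le_trans ?_ ht
    have : (1 : ℝ) ≤ ε⁻¹ * (Δ : ℕ) := one_le_mul_of_one_le_of_one_le hε1' hΔ
    linarith
  refine (Run.pr_mono _ fun s hs => ?_).trans
    (pr_sApprox_far (t := t) (Γ := M * (Δ : ℕ)) hS (by positivity) (by positivity)
      (by exact_mod_cast ht2))
  replace hs : ε * mean d < |s - mean d| := hs
  refine lt_of_le_of_lt ?_ hs
  rw [div_le_iff₀ (by linarith)]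
  have hφ2 : phi d ^ 2 ≤ ((Δ : ℕ) * mean d) ^ 2 := pow_le_pow_left₀ (phi_nonneg d) hφ 2
  -- The four error terms are at most 1, 50, 1 and 2500 times Δμ, in total 2552 ≤ 51².
  have e1 : 2 * phi d ^ 2 / (M * (Δ : ℕ)) ≤ (Δ : ℕ) * mean d := by
    rw [div_le_iff₀ (by positivity)]
    have : 2 * ((Δ : ℕ) * mean d) ^ 2 ≤ (Δ : ℕ) * mean d * (M * (Δ : ℕ)) := by
      have : ((Δ : ℕ) : ℝ) ^ 2 * mean d * (2 * mean d) ≤ ((Δ : ℕ) : ℝ) ^ 2 * mean d * M := by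
        gcongr
        linarith
      linarith
    linarith
  have e2 : Real.sqrt (M * (Δ : ℕ) * mean d) ≤ 50 * ((Δ : ℕ) * mean d) := by
    refine Real.sqrt_le_iff.2 ⟨by positivity, ?_⟩
    calc M * (Δ : ℕ) * mean d ≤ 2500 * mean d * ((Δ : ℕ) * (Δ : ℕ)) * mean d := by
          gcongr
          exact le_mul_of_one_le_left (by positivity) hΔ
      _ = _ := by ring
  have e3 : M * (Δ : ℕ) ≤ 2500 * ((Δ : ℕ) * mean d) := by
    have : M * (Δ : ℕ) ≤ 2500 * mean d * (Δ : ℕ) := by gcongr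
    linarith
  have e4 : ε * mean d * (51 ^ 2 * ε⁻¹ * (Δ : ℕ)) ≤ ε * mean d * (t : ℕ) := by gcongr
  have e5 : ε * mean d * (51 ^ 2 * ε⁻¹ * (Δ : ℕ)) = 2601 * ((Δ : ℕ) * mean d) := by
    field_simp
    norm_num
  have e6 : 0 ≤ (Δ : ℕ) * mean d := by positivity
  linarith

end Search

section Decreasing

variable {G : Type*} [NormedAddCommGroup G] [InnerProductSpace ℂ G] {Ω : Finset ℝ≥0}
variable {B : Blank G Ω} {S : Reg G Ω ≃ₗᵢ[ℂ] Reg G Ω} {d : PMF Ω} {L H ε δ : ℝ} {f : ℝ → ℝ}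

/-! ### Estimation with a non-increasing bound -/

theorem phi_le_toDelta_mul (hf : AntitoneOn f (Set.Ioi 0)) (hμ : 0 < mean d)
    (hfμ : phi d / mean d ≤ f (mean d)) {x : ℝ} (hx : 0 < x) (hxμ : x ≤ mean d) :
    phi d ≤ (toDelta (f x) : ℕ) * mean d := by
  rw [← div_le_iff₀ hμ]
  exact (hfμ.trans (hf hx hμ hxμ)).trans (le_toPNat' (f x))

theorem sixth_mean_le {m : ℝ} (h : |m - mean d| ≤ 5 / 6 * mean d) : mean d / 6 ≤ m := by
  have := (abs_le.1 h).1
  linarith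

/-- Stopping at x needs x/6 ≤ m ≤ (1+2π)²μ, the upper bound on m holding for every Δ. At the first
threshold that is at most μ, hence at least μ/2 ≥ L/2, the estimate is at least μ/6 and the loop
stops. -/
theorem pr_decLoop_window (hS : IsSampler B S d) (hL : 0 < L) (hLH : L < H) (hδ : 0 < δ)
    (hf : AntitoneOn f (Set.Ioi 0)) (hfμ : phi d / mean d ≤ f (mean d)) (hLμ : L ≤ mean d)
    (hμH : mean d < H) (n : ℕ) {M m : ℝ} (hm : m < M / 6) (hM : mean d < M)
    (hMn : M ≤ 2 ^ n * mean d) :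
    (decLoop B S f L H hL δ M m).pr
      {x | ¬(L / 2 ≤ x ∧ x ≤ 6 * (1 + 2 * Real.pi) ^ 2 * mean d)} ≤ n * δ ^ 3 := by
  have hμ : 0 < mean d := hL.trans_le hLμ
  induction n generalizing M m with
  | zero =>
    rw [pow_zero, one_mul] at hMn
    exact absurd hM (not_lt.2 hMn)
  | succ n ih =>
    have hη : 0 < δ ^ 3 := by positivity
    rw [decLoop, dif_pos ⟨hm, by linarith⟩]
    set e := epsApprox B S (toDelta (f (M / 2))) L H hL (5 / 6) δ with he
    have hup : e.pr {m | (1 + 2 * Real.pi) ^ 2 * mean d < m} ≤ δ ^ 3 / 8 :=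
      pr_epsApprox_upper hS hL hδ
    obtain ⟨A, hA, hA1⟩ : ∃ A : Set ℝ, e.pr A ≤ δ ^ 3 / 4 ∧
        ∀ m ∉ A, M / 2 ≤ mean d → mean d / 6 ≤ m := by
      rcases le_or_gt (M / 2) (mean d) with h | h
      · exact ⟨_, pr_epsApprox_far hS hL hLH hδ (by norm_num) (by norm_num) (by linarith) hμH
          (phi_le_toDelta_mul hf hμ hfμ (by linarith) h),
          fun m hm _ => sixth_mean_le (not_lt.1 hm)⟩
      · refine ⟨∅, ?_, fun _ _ h' => absurd h' (not_le.2 h)⟩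
        rw [Run.pr, Set.preimage_empty, prob_eq_zero _ fun _ _ => Set.notMem_empty _]
        positivity
    have hbad := (Run.pr_union_le e {m | (1 + 2 * Real.pi) ^ 2 * mean d < m} A).trans
      (add_le_add hup hA)
    refine (Run.pr_bind_le_add (b := n * δ ^ 3) _ (by positivity) hbad fun m' hm' => ?_).trans
      (by push_cast; linarith)
    have h1 : m' ≤ (1 + 2 * Real.pi) ^ 2 * mean d := not_lt.1 fun h => hm' (Or.inl h)
    have h2 := hA1 m' fun h => hm' (Or.inr h)
    rcases lt_or_ge m' (M / 2 / 6) with h | h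
    · refine ih h ?_ ?_
      · by_contra hcon
        have := h2 (not_lt.1 hcon)
        linarith
      · rw [pow_succ] at hMn
        linarith
    · rw [decLoop, dif_neg fun h' => not_lt.2 h h'.1]
      refine (Run.pr_pure_of_notMem ?_).le.trans (by positivity)
      exact not_not.2 ⟨by linarith, by linarith⟩

theorem pr_epsApproxDec_far (hS : IsSampler B S d) (hL : 0 < L) (hLH : L < H) (hδ : 0 < δ)
    (hε : 0 < ε) (hε1 : ε ≤ 1) (hf : AntitoneOn f (Set.Ioi 0))
    (hfμ : phi d / mean d ≤ f (mean d)) (hLμ : L ≤ mean d) (hμH : mean d < H) :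
    (epsApproxDec B S f L H hL ε δ).pr {m | ε * mean d < |m - mean d|} ≤ δ ^ 3 := by
  have hμ : 0 < mean d := hL.trans_le hLμ
  have hlog : 0 ≤ Real.logb 2 (H / L) :=
    Real.logb_nonneg one_lt_two ((one_le_div hL).2 hLH.le)
  obtain ⟨n, hn, hn'⟩ := exists_pow_bound (H := H) (c := 2 * mean d) hL hLH (by linarith)
  rw [pow_succ] at hn'
  have hloop := pr_decLoop_window (δ := δ / (2 * (2 + Real.logb 2 (H / L)))) (m := 0) hS hL hLH
    (by positivity) hf hfμ hLμ hμH n (M := 2 * H) (by linarith) (by linarith) (by linarith)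
  have hloop' := hloop.trans (mul_div_pow_three_le (by linarith) hn hδ)
  have hη : 0 < δ ^ 3 := by positivity
  rw [epsApproxDec]
  refine (Run.pr_bind_le_add (b := (δ / 2) ^ 3 / 4) _ (by positivity) hloop' fun M hM => ?_).trans
    (by ring_nf; linarith)
  obtain ⟨hM1, hM2⟩ := not_not.1 hM
  rw [if_neg (not_lt.2 hM1)]
  have hM0 : 0 < M := by linarith
  have hpi := Real.pi_pos
  refine pr_epsApprox_far hS hL hLH (by positivity) hε hε1 (by linarith) hμH
    (phi_le_toDelta_mul hf hμ hfμ (by positivity) ?_)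
  rw [div_le_iff₀ (by positivity)]
  linarith

theorem pr_epsApproxDec_upper (hS : IsSampler B S d) (hL : 0 < L) (hδ : 0 < δ) :
    (epsApproxDec B S f L H hL ε δ).pr {m | (1 + 2 * Real.pi) ^ 2 * mean d < m} ≤ δ ^ 3 := by
  have hμ := mean_nonneg d
  have hη : 0 < δ ^ 3 := by positivity
  rw [epsApproxDec]
  refine Run.pr_bind_le_of_forall (by positivity) fun M => ?_
  split_ifs with h
  · refine (Run.pr_pure_of_notMem ?_).le.trans (by positivity)
    change ¬(1 + 2 * Real.pi) ^ 2 * mean d < 0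
    rw [not_lt]
    positivity
  · refine (pr_epsApprox_upper hS hL (by positivity)).trans ?_
    ring_nf
    linarith

/-- Here `j` counts the failures still needed before the threshold can drop below 2^(-ℓ)μ. Each
round with M/2 ≤ μ either stops the loop above that level or consumes one failure; rounds with M/2 >
μ leave `j` unchanged. `n` only bounds the number of rounds. -/
theorem pr_decLoop_lt (hS : IsSampler B S d) (hL : 0 < L) (hLH : L < H) (hδ : 0 < δ)
    (hf : AntitoneOn f (Set.Ioi 0)) (hfμ : phi d / mean d ≤ f (mean d))
    (hLμ : L ≤ 2 * mean d) (hμH : mean d < H) (ℓ n : ℕ) {j : ℕ} (hj : j ≤ ℓ) {M m : ℝ}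
    (hM : 2 ^ j * (2⁻¹ ^ ℓ * mean d) ≤ M) (hMn : M < 2 ^ n * (L / 2)) :
    (decLoop B S f L H hL δ M m).pr {x | x < 2⁻¹ ^ ℓ * mean d} ≤ (δ ^ 3) ^ j := by
  have hμ : 0 < mean d := by linarith
  have hη : 0 < δ ^ 3 := by positivity
  have hbase : ∀ (j : ℕ) (M : ℝ), 2 ^ j * (2⁻¹ ^ ℓ * mean d) ≤ M →
      (pure M : Run ℝ).pr {x | x < 2⁻¹ ^ ℓ * mean d} ≤ 0 := fun j M hM => by
    refine (Run.pr_pure_of_notMem ?_).le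
    change ¬M < 2⁻¹ ^ ℓ * mean d
    refine not_lt.2 (le_trans ?_ hM)
    exact le_mul_of_one_le_left (by positivity) (one_le_pow₀ one_le_two)
  induction n generalizing M m j with
  | zero =>
    rw [decLoop, dif_neg fun h => by linarith [h.2]]
    exact (hbase j M hM).trans (by positivity)
  | succ n ih =>
    rw [decLoop]
    split_ifs with hent
    · have hMn' : M / 2 < 2 ^ n * (L / 2) := by
        rw [pow_succ] at hMn
        linarith
      rcases j with _ | j
      · rw [pow_zero]
        exact Run.pr_le_one _ _
      have hM' : 2 ^ j * (2⁻¹ ^ ℓ * mean d) ≤ M / 2 := by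
        rw [pow_succ] at hM
        linarith
      rcases le_or_gt (M / 2) (mean d) with h | h
      · have hA := pr_epsApprox_far (ε := 5 / 6) (Δ := toDelta (f (M / 2))) hS hL hLH hδ
          (by norm_num) (by norm_num) hLμ hμH
          (phi_le_toDelta_mul hf hμ hfμ (by linarith [hent.2]) h)
        rw [pow_succ (δ ^ 3) j, mul_comm ((δ ^ 3) ^ j)]
        refine Run.pr_bind_le_mul _ (by positivity) (hA.trans (by linarith))
          (fun m' _ => ih (by omega) hM' hMn') fun m' hm' => ?_
        have := sixth_mean_le (d := d) (not_lt.1 hm')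
        rw [decLoop, dif_neg fun h' => by linarith [h'.1]]
        exact hbase j _ hM'
      · refine Run.pr_bind_le_of_forall (by positivity) fun m' => ih hj ?_ hMn'
        refine le_trans ?_ h.le
        have h1 : (2 : ℝ) ^ (j + 1) * 2⁻¹ ^ ℓ ≤ 1 := by
          rw [inv_pow, mul_inv_le_iff₀ (by positivity), one_mul]
          exact pow_le_pow_right₀ one_le_two hj
        rw [← mul_assoc]
        exact mul_le_of_le_one_left hμ.le h1
    · exact (hbase j M hM).trans (by positivity)

/-- Every threshold used is at least the final one and `K` is antitone, so the final threshold
dominates the cost of each round. This holds on every run, not only with high probability. -/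
theorem decLoop_support (hL : 0 < L) {K : ℝ → ℝ} (hK : AntitoneOn K (Set.Ioi 0))
    (hcost : ∀ x, 0 < x → (epsApprox B S (toDelta (f x)) L H hL (5 / 6) δ).CostLE (K x))
    (hK0 : ∀ x, 0 ≤ K x) (n : ℕ) {M m : ℝ} (hM : L / 4 ≤ M) (hMn : M < 2 ^ n * (L / 2)) :
    ∀ r ∈ (decLoop B S f L H hL δ M m).law.support,
      L / 4 ≤ r.1 ∧ r.1 ≤ M ∧ (r.2 : ℝ) ≤ n * K r.1 := by
  have hbase : ∀ (n : ℕ) (M : ℝ), L / 4 ≤ M → ∀ r ∈ (pure M : Run ℝ).law.support,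
      L / 4 ≤ r.1 ∧ r.1 ≤ M ∧ (r.2 : ℝ) ≤ n * K r.1 := fun n M hM r hr => by
    rw [Run.mem_support_pure.1 hr]
    refine ⟨hM, le_rfl, ?_⟩
    have := hK0 M
    simp only [Nat.cast_zero]
    positivity
  induction n generalizing M m with
  | zero =>
    rw [decLoop, dif_neg fun h => by linarith [h.2]]
    exact hbase _ M hM
  | succ n ih =>
    rw [decLoop]
    split_ifs with hent
    · intro r hr
      obtain ⟨s, hs, u, hu, rfl⟩ := Run.mem_support_bind.1 hr
      have hM2 : 0 < M / 2 := by linarith [hent.2]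
      rw [pow_succ] at hMn
      obtain ⟨h1, h2, h3⟩ := ih (M := M / 2) (m := s.1) (by linarith [hent.2]) (by linarith) u hu
      have hu0 : 0 < u.1 := by linarith
      refine ⟨h1, by linarith, ?_⟩
      have h4 := (hcost (M / 2) hM2 s hs).trans (hK hu0 hM2 h2)
      push_cast
      linarith
    · exact hbase _ M hM

end Decreasing

section Cost

variable {G : Type*} [NormedAddCommGroup G] [InnerProductSpace ℂ G] {Ω : Finset ℝ≥0}
variable {B : Blank G Ω} {S : Reg G Ω ≃ₗᵢ[ℂ] Reg G Ω} {Δ : ℕ+} {L H ε δ : ℝ}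

/-! ### Numbers of quantum samples -/

theorem log_le_logb_two {x : ℝ} (hx : 1 ≤ x) : Real.log x ≤ Real.logb 2 x := by
  have h1 : Real.log 2 ≤ 1 := by
    have := Real.log_two_lt_d9
    linarith
  rw [Real.logb, le_div_iff₀ (Real.log_pos one_lt_two)]
  exact mul_le_of_le_one_right (Real.log_nonneg hx) h1

theorem logb_two_le_self {x : ℝ} (hx : 1 ≤ x) : Real.logb 2 x ≤ x := by
  have h1 : x < 2 ^ ⌈x⌉₊ := (Nat.le_ceil x).trans_lt (by exact_mod_cast Nat.lt_two_pow_self)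
  rw [Real.logb_le_iff_le_rpow one_lt_two (by linarith)]
  have h2 := one_add_mul_self_le_rpow_one_add (s := 1) (p := x) (by norm_num) hx
  norm_num at h2
  linarith

theorem reps_div_le {c a l lg : ℝ} (hδ : 0 < δ) (hδ1 : δ ≤ 1) (hc : 1 ≤ c)
    (hl : Real.logb 2 (1 / δ) = l) (hl1 : 1 ≤ l) (hlg : 1 ≤ lg) (ha : 0 ≤ a)
    (hca : Real.logb 2 c ≤ a * lg) :
    (reps (δ / c) : ℝ) ≤ (24 * a + 27) * (lg * l) := by
  have hc0 : 0 < c := by linarith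
  have h1 : (1 : ℝ) ≤ 1 / δ := (one_le_div hδ).2 hδ1
  have h2 : Real.log (1 / (δ / c)) = Real.log (1 / δ) + Real.log c := by
    rw [← Real.log_mul (by positivity) (by positivity)]
    congr 1
    field_simp
  have h3 := log_le_logb_two h1
  have h4 := log_le_logb_two hc
  have h5 : 0 ≤ 12 * Real.log (1 / (δ / c)) := by
    rw [h2]
    have := Real.log_nonneg h1
    have := Real.log_nonneg hc
    positivity
  have h6 := (Nat.ceil_lt_add_one h5).le
  rw [reps]
  push_cast
  have h7 : a * lg ≤ a * (lg * l) := by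
    gcongr
    exact le_mul_of_one_le_right (by linarith) hl1
  have h8 : l ≤ lg * l := le_mul_of_one_le_left (by linarith) hlg
  linarith

theorem costLE_searchLoop (hL : 0 < L) (n : ℕ) {M p : ℝ} (hM : M < 2 ^ n * (2 * L)) :
    (searchLoop B S Δ L hL δ M p).CostLE (n * (reps δ * (50 * (Δ : ℕ) + 1))) := by
  induction n generalizing M p with
  | zero =>
    rw [searchLoop, dif_neg fun h => by linarith [h.2]]
    exact (Run.costLE_pure M).mono (by simp)
  | succ n ih =>
    rw [searchLoop]
    split_ifs with h
    · rw [pow_succ] at hM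
      refine ((costLE_basicEst _ _).bind fun p => ih (by linarith)).mono (le_of_eq ?_)
      rw [coe_twentyFive_mul]
      push_cast
      ring
    · exact (Run.costLE_pure M).mono (by positivity)

theorem toPNat'_le {x : ℝ} (hx : 0 ≤ x) : ((⌈x⌉₊.toPNat' : ℕ+) : ℝ) ≤ x + 1 := by
  have h := (Nat.ceil_lt_add_one hx).le
  have h2 : (((⌈x⌉₊.toPNat' : ℕ+) : ℕ) : ℝ) ≤ x + 1 := by
    rw [Nat.toPNat'_coe]
    split_ifs
    · exact h
    · push_cast
      linarith
  exact h2

theorem costLE_sApprox {Γ δ' W R : ℝ} {t : ℕ+} (ht2 : 2 ≤ (t : ℕ)) (hW : 1 ≤ W)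
    (htW : Real.logb 2 (t : ℕ) ≤ W)
    (hR : ∀ k : ℕ, (k : ℝ) + 1 ≤ 2 * W → (reps (δ' / (k + 1)) : ℝ) ≤ R) :
    (sApprox B S Γ t δ').CostLE (2 * W * (R * (63 * (t : ℕ) * W))) := by
  have htr : (2 : ℝ) ≤ (t : ℕ) := by exact_mod_cast ht2
  have hlg1 : 1 ≤ Real.logb 2 (t : ℕ) := by
    rw [Real.le_logb_iff_rpow_le one_lt_two (by linarith), Real.rpow_one]
    exact htr
  obtain ⟨k, hk⟩ : ∃ k, k = Nat.clog 2 t - 1 := ⟨_, rfl⟩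
  obtain ⟨t₀, ht₀⟩ : ∃ t₀ : ℕ+, t₀ =
    ⌈3 * Real.pi ^ 2 * (t : ℕ) * Real.sqrt (Real.logb 2 (t : ℕ))⌉₊.toPNat' := ⟨_, rfl⟩
  rw [sApprox, ← hk, ← ht₀]
  have hk1 : (k : ℝ) ≤ Real.logb 2 (t : ℕ) := by
    rw [Real.le_logb_iff_rpow_le one_lt_two (by linarith), Real.rpow_natCast]
    have : 2 ^ k < (t : ℕ) := by
      rw [hk]
      exact Nat.pow_pred_clog_lt_self one_lt_two (by omega)
    exact_mod_cast this.le
  have hkW : (k : ℝ) + 1 ≤ 2 * W := by linarith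
  have hsq : Real.sqrt (Real.logb 2 (t : ℕ)) ≤ W := by
    refine le_trans ?_ htW
    exact Real.sqrt_le_iff.2 ⟨by linarith, le_self_pow₀ hlg1 two_ne_zero⟩
  have hpi := pi_sq_lt
  have ht0 : ((t₀ : ℕ) : ℝ) ≤ 30 * (t : ℕ) * W + 1 := by
    have h1 := toPNat'_le (x := 3 * Real.pi ^ 2 * (t : ℕ) * Real.sqrt (Real.logb 2 (t : ℕ)))
      (by positivity)
    rw [← ht₀] at h1
    refine h1.trans ?_
    have : 3 * Real.pi ^ 2 * (t : ℕ) * Real.sqrt (Real.logb 2 (t : ℕ)) ≤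
        30 * ((t : ℕ) : ℝ) * W := by
      gcongr
      linarith
    linarith
  have htW1 : 1 ≤ ((t : ℕ) : ℝ) * W := one_le_mul_of_one_le_of_one_le (by linarith) hW
  have hR0 : 0 ≤ R := (Nat.cast_nonneg _).trans (hR k hkW)
  refine (costLE_sApproxSum k).mono ?_
  gcongr
  · exact hR k hkW
  · linarith

/-- All logarithms are absorbed in `lg`: the failure parameters are divided by quantities of order h
or log t. The search costs order X·lg; the summation has a factor `lg` each for the number of
blocks, the length `t₀` and the repetitions, hence lg³. -/
theorem costLE_epsApprox {c F ε' h l lg : ℝ} (hL : 0 < L) (hLH : L < H) (hε : 0 < ε)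
    (hε2 : ε < 1 / 2) (hεε' : ε ≤ ε') (hε1 : ε' ≤ 1) (hδ : 0 < δ) (hδ2 : δ < 1 / 2)
    (hh : max 1 (Real.logb 2 (H / L)) = h) (hl : Real.logb 2 (1 / δ) = l)
    (hF : 1 ≤ F) (hΔF : ((Δ : ℕ) : ℝ) ≤ 2 * F) (hc1 : 1 ≤ c) (hch : c ≤ 6 * h)
    (hlg : Real.logb 2 (2 + F * ε⁻¹ * h * l) = lg) :
    (epsApprox B S Δ L H hL ε' (δ / c)).CostLE (10 ^ 12 * (F * ε⁻¹ * h * l * lg ^ 3)) := by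
  have hh1 : 1 ≤ h := hh ▸ le_max_left _ _
  have hhl : Real.logb 2 (H / L) ≤ h := hh ▸ le_max_right _ _
  have hlog : 0 ≤ Real.logb 2 (H / L) :=
    Real.logb_nonneg one_lt_two ((one_le_div hL).2 hLH.le)
  have hl1 : 1 ≤ l := by
    rw [← hl, Real.le_logb_iff_rpow_le one_lt_two (by positivity), Real.rpow_one,
      le_div_iff₀ hδ]
    linarith
  have hε' : 2 ≤ ε⁻¹ := by
    rw [le_inv_comm₀ two_pos hε]
    linarith
  set X := F * ε⁻¹ * h * l with hX
  have hFε : F ≤ F * ε⁻¹ := le_mul_of_one_le_right (by linarith) (by linarith)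
  have hFε2 : ε⁻¹ ≤ F * ε⁻¹ := le_mul_of_one_le_left (by linarith) hF
  have hX1 : F * ε⁻¹ ≤ X := by
    rw [hX, mul_assoc]
    exact le_mul_of_one_le_right (by positivity) (one_le_mul_of_one_le_of_one_le hh1 hl1)
  have hX2 : 2 ≤ X := by linarith
  have hhX : h ≤ X := by
    have h1 : h ≤ F * ε⁻¹ * h := le_mul_of_one_le_left (by linarith) (by linarith)
    exact h1.trans (le_mul_of_one_le_right (by positivity) hl1)
  have hlogle : ∀ x, 0 < x → x ≤ 2 + X → Real.logb 2 x ≤ lg := fun x hx hxX => by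
    rw [← hlg]
    exact Real.logb_le_logb_of_le one_lt_two hx hxX
  have hlg2 : 2 ≤ lg := by
    refine le_trans ?_ (hlogle 4 (by norm_num) (by linarith))
    rw [show (4 : ℝ) = 2 ^ (2 : ℝ) by norm_num, Real.logb_rpow two_pos (by norm_num)]
  have hΔ1 : (1 : ℝ) ≤ (Δ : ℕ) := by exact_mod_cast Δ.pos
  have hlogpow : ∀ (n : ℕ) (x : ℝ), x ≤ 2 ^ n → 0 < x → Real.logb 2 x ≤ n := fun n x hx hx0 => by
    rw [Real.logb_le_iff_le_rpow one_lt_two hx0, Real.rpow_natCast]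
    exact hx
  have hlogc : Real.logb 2 c ≤ 3 + lg := by
    have h1 : Real.logb 2 c ≤ Real.logb 2 (6 * h) :=
      Real.logb_le_logb_of_le one_lt_two (by linarith) hch
    rw [Real.logb_mul (by norm_num) (by positivity)] at h1
    have h2 := hlogpow 3 6 (by norm_num) (by norm_num)
    have h3 := hlogle h (by linarith) (by linarith)
    push_cast at h2
    linarith
  have hlgh : Real.logb 2 (2 * (3 + Real.logb 2 (H / L))) ≤ 3 + lg := by
    have h1 : Real.logb 2 (2 * (3 + Real.logb 2 (H / L))) ≤ Real.logb 2 (8 * h) :=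
      Real.logb_le_logb_of_le one_lt_two (by positivity) (by linarith)
    rw [Real.logb_mul (x := 8) (y := h) (by norm_num) (by positivity)] at h1
    have h2 := hlogpow 3 8 (by norm_num) (by norm_num)
    have h3 := hlogle h (by linarith) (by linarith)
    push_cast at h2
    linarith
  have hll : 0 ≤ lg * l := by positivity
  obtain ⟨n, hn, hn'⟩ := exists_pow_bound (H := H) hL hLH le_rfl
  have hsearch := costLE_searchLoop (B := B) (S := S) (Δ := Δ) (p := 0)
    (δ := δ / c / (2 * (3 + Real.logb 2 (H / L)))) hL (n + 1) hn'
  -- The divisor has logarithm at most 6 + 2lg ≤ 5lg because lg ≥ 2, and 147 = 24·5 + 27. Below, 4 +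
  -- 17lg ≤ 19lg gives 483 in the same way.
  have hRs : (reps (δ / c / (2 * (3 + Real.logb 2 (H / L)))) : ℝ) ≤ 147 * (lg * l) := by
    rw [div_div]
    refine (reps_div_le (a := 5) (lg := lg) hδ (by linarith) ?_ hl hl1 (by linarith) (by norm_num) ?_).trans
      (le_of_eq (by norm_num))
    · exact one_le_mul_of_one_le_of_one_le hc1 (by linarith)
    · rw [Real.logb_mul (by positivity) (by positivity)]
      linarith
  have hsc : ((n + 1 : ℕ) : ℝ) * (reps (δ / c / (2 * (3 + Real.logb 2 (H / L)))) *
      (50 * (Δ : ℕ) + 1)) ≤ 4 * h * (147 * (lg * l) * (101 * (F * ε⁻¹))) := by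
    gcongr
    · push_cast
      linarith
    · linarith
  have hinv : ε'⁻¹ ≤ ε⁻¹ := inv_anti₀ hε hεε'
  have hinv1 : 1 ≤ ε'⁻¹ := (one_le_inv₀ (hε.trans_le hεε')).2 hε1
  set t := ⌈51 ^ 2 * ε'⁻¹ * ((Δ : ℕ) : ℝ)⌉₊.toPNat' with ht
  have ht2 : (2 : ℝ) ≤ (t : ℕ) := by
    refine le_trans ?_ (le_toPNat' _)
    have : (1 : ℝ) ≤ ε'⁻¹ * (Δ : ℕ) := one_le_mul_of_one_le_of_one_le hinv1 hΔ1
    linarith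
  have htX : ((t : ℕ) : ℝ) ≤ 5203 * (F * ε⁻¹) := by
    refine (toPNat'_le (by positivity)).trans ?_
    have : 51 ^ 2 * ε'⁻¹ * ((Δ : ℕ) : ℝ) ≤ 51 ^ 2 * ε⁻¹ * (2 * F) := by gcongr
    linarith
  have hlogt : Real.logb 2 (t : ℕ) ≤ 8 * lg := by
    have h1 : Real.logb 2 (t : ℕ) ≤ Real.logb 2 (5203 * X) :=
      Real.logb_le_logb_of_le one_lt_two (by linarith) (by linarith)
    rw [Real.logb_mul (by norm_num) (by positivity)] at h1
    have h2 := hlogpow 13 5203 (by norm_num) (by norm_num)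
    have h3 := hlogle X (by linarith) (by linarith)
    push_cast at h2
    linarith
  have hRk : ∀ k : ℕ, (k : ℝ) + 1 ≤ 2 * (8 * lg) →
      (reps (δ / c / 2 / (k + 1)) : ℝ) ≤ 483 * (lg * l) := by
    intro k hk
    have hk1 : (1 : ℝ) ≤ (k : ℝ) + 1 := by
      have : (0 : ℝ) ≤ k := Nat.cast_nonneg k
      linarith
    rw [div_div, div_div]
    refine (reps_div_le (a := 19) (lg := lg) hδ (by linarith) ?_ hl hl1 (by linarith) (by norm_num) ?_).trans
      (le_of_eq (by norm_num))
    · exact one_le_mul_of_one_le_of_one_le hc1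
        (one_le_mul_of_one_le_of_one_le one_le_two hk1)
    · rw [Real.logb_mul (by positivity) (by positivity),
        Real.logb_mul (by positivity) (by positivity), Real.logb_self_eq_one one_lt_two]
      have := logb_two_le_self hk1
      linarith
  have hsa : ∀ Γ : ℝ, (sApprox B S Γ t (δ / c / 2)).CostLE
      (2 * (8 * lg) * (483 * (lg * l) * (63 * (5203 * (F * ε⁻¹)) * (8 * lg)))) := fun Γ => by
    refine (costLE_sApprox (by exact_mod_cast ht2) (by linarith) hlogt hRk).mono ?_
    gcongr
  rw [epsApprox]
  refine (hsearch.bind (c' := 2 * (8 * lg) * (483 * (lg * l) *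
    (63 * (5203 * (F * ε⁻¹)) * (8 * lg)))) fun M => ?_).mono ?_
  · split_ifs
    · exact (Run.costLE_pure 0).mono (by positivity)
    · exact hsa _
  · have e1 : 4 * h * (147 * (lg * l) * (101 * (F * ε⁻¹))) = 59388 * (X * lg) := by
      rw [hX]
      ring
    have e2 : 2 * (8 * lg) * (483 * (lg * l) * (63 * (5203 * (F * ε⁻¹)) * (8 * lg))) =
        2 * 8 * 483 * 63 * 5203 * 8 * (F * ε⁻¹ * 1 * l * lg ^ 3) := by ring
    have e3 : F * ε⁻¹ * 1 * l * lg ^ 3 ≤ X * lg ^ 3 := by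
      rw [hX]
      gcongr
    have e4 : X * lg ≤ X * lg ^ 3 := by
      gcongr
      exact le_self_pow₀ (by linarith) three_ne_zero
    have e5 : 0 ≤ X * lg ^ 3 := by positivity
    linarith

end Cost

/-! ### Total cost as a function of the final threshold, and its tail -/

section Total

variable {G : Type*} [NormedAddCommGroup G] [InnerProductSpace ℂ G] {Ω : Finset ℝ≥0}
variable {B : Blank G Ω} {S : Reg G Ω ≃ₗᵢ[ℂ] Reg G Ω} {d : PMF Ω} {L H ε δ : ℝ} {f : ℝ → ℝ}

theorem toDelta_le (y : ℝ) : ((toDelta y : ℕ) : ℝ) ≤ 2 * max 1 y := by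
  have h1 : (1 : ℝ) ≤ max 1 y := le_max_left _ _
  rw [toDelta, Nat.toPNat'_coe]
  split_ifs
  · have h2 : (⌈y⌉₊ : ℝ) ≤ ⌈max 1 y⌉₊ := by exact_mod_cast Nat.ceil_mono (le_max_right 1 y)
    have h3 := (Nat.ceil_lt_add_one (zero_le_one.trans h1)).le
    linarith
  · push_cast
    linarith

/-- The leading factor of the bound on the number of quantum samples, in terms of the final
threshold `x` of the search. -/
def leading (f : ℝ → ℝ) (L H ε δ x : ℝ) : ℝ :=
  max 1 (f (x / (6 * (1 + 2 * Real.pi) ^ 2))) * ε⁻¹ * max 1 (Real.logb 2 (H / L)) *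
    Real.logb 2 (1 / δ)

/-- The bound on the number of quantum samples, in terms of the final threshold `x` of the
search. -/
def sampleBound (f : ℝ → ℝ) (L H ε δ x : ℝ) : ℝ :=
  5 * 10 ^ 12 * (leading f L H ε δ x * max 1 (Real.logb 2 (H / L))) *
    Real.logb 2 (2 + leading f L H ε δ x) ^ 3

theorem leading_nonneg (hε : 0 < ε) (hδ : 0 < δ) (hδ1 : δ ≤ 1) (x : ℝ) :
    0 ≤ leading f L H ε δ x := by
  have h1 : 0 ≤ Real.logb 2 (1 / δ) := Real.logb_nonneg one_lt_two ((one_le_div hδ).2 hδ1)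
  have h2 : 0 ≤ max 1 (f (x / (6 * (1 + 2 * Real.pi) ^ 2))) := zero_le_one.trans (le_max_left _ _)
  have h3 : 0 ≤ max 1 (Real.logb 2 (H / L)) := zero_le_one.trans (le_max_left _ _)
  unfold leading
  positivity

theorem leading_antitone (hf : AntitoneOn f (Set.Ioi 0)) (hε : 0 < ε) (hδ : 0 < δ)
    (hδ1 : δ ≤ 1) : AntitoneOn (leading f L H ε δ) (Set.Ioi 0) := by
  intro x (hx : 0 < x) y (hy : 0 < y) hxy
  have h1 : 0 ≤ Real.logb 2 (1 / δ) := Real.logb_nonneg one_lt_two ((one_le_div hδ).2 hδ1)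
  have h3 : 0 ≤ max 1 (Real.logb 2 (H / L)) := zero_le_one.trans (le_max_left _ _)
  have hpi := Real.pi_pos
  have h4 : f (y / (6 * (1 + 2 * Real.pi) ^ 2)) ≤ f (x / (6 * (1 + 2 * Real.pi) ^ 2)) := by
    refine hf ?_ ?_ (by gcongr)
    · change 0 < x / (6 * (1 + 2 * Real.pi) ^ 2)
      positivity
    · change 0 < y / (6 * (1 + 2 * Real.pi) ^ 2)
      positivity
  unfold leading
  gcongr

theorem costLE_epsApprox_toDelta {ε' c x y : ℝ} (hL : 0 < L) (hLH : L < H) (hε : 0 < ε)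
    (hε2 : ε < 1 / 2) (hεε' : ε ≤ ε') (hε1 : ε' ≤ 1) (hδ : 0 < δ) (hδ2 : δ < 1 / 2)
    (hc1 : 1 ≤ c) (hch : c ≤ 6 * max 1 (Real.logb 2 (H / L)))
    (hy : f y ≤ max 1 (f (x / (6 * (1 + 2 * Real.pi) ^ 2)))) :
    (epsApprox B S (toDelta (f y)) L H hL ε' (δ / c)).CostLE
      (10 ^ 12 * (leading f L H ε δ x * Real.logb 2 (2 + leading f L H ε δ x) ^ 3)) := by
  refine costLE_epsApprox hL hLH hε hε2 hεε' hε1 hδ hδ2 rfl rfl (le_max_left _ _) ?_ hc1 hch rfl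
  exact (toDelta_le _).trans
    (mul_le_mul_of_nonneg_left (max_le (le_max_left _ _) hy) zero_le_two)

/-- Every run of `epsApproxDec` consists of a run of its loop, whose final threshold controls the
number of quantum samples, and of one more estimation. -/
theorem exists_threshold_of_mem_support (hL : 0 < L) (hLH : L < H) (hε : 0 < ε)
    (hε2 : ε < 1 / 2) (hδ : 0 < δ) (hδ2 : δ < 1 / 2) (hf : AntitoneOn f (Set.Ioi 0))
    {s : ℝ × ℕ}
    (hs : s ∈ (decLoop B S f L H hL (δ / (2 * (2 + Real.logb 2 (H / L)))) (2 * H) 0).law.support) :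
    L / 4 ≤ s.1 ∧ ∀ u ∈ (if s.1 < L / 2 then (pure 0 : Run ℝ)
      else epsApprox B S (toDelta (f (s.1 / (6 * (1 + 2 * Real.pi) ^ 2)))) L H hL ε
        (δ / 2)).law.support, ((s.2 + u.2 : ℕ) : ℝ) ≤ sampleBound f L H ε δ s.1 := by
  have hlog : 0 ≤ Real.logb 2 (H / L) :=
    Real.logb_nonneg one_lt_two ((one_le_div hL).2 hLH.le)
  set h := max 1 (Real.logb 2 (H / L)) with hh
  have hh1 : 1 ≤ h := le_max_left _ _
  have hhl : Real.logb 2 (H / L) ≤ h := le_max_right _ _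
  have hX0 := leading_nonneg (f := f) (L := L) (H := H) hε hδ (by linarith)
  have hpi := Real.pi_pos
  set K : ℝ → ℝ := fun x =>
    10 ^ 12 * (leading f L H ε δ x * Real.logb 2 (2 + leading f L H ε δ x) ^ 3) with hKdef
  have hlg0 : ∀ x, 0 ≤ Real.logb 2 (2 + leading f L H ε δ x) := fun x =>
    Real.logb_nonneg one_lt_two (by linarith [hX0 x])
  have hK0 : ∀ x, 0 ≤ K x := fun x => by
    have := hX0 x
    have := hlg0 x
    simp only [hKdef]
    positivity
  have hK : AntitoneOn K (Set.Ioi 0) := fun x hx y hy hxy => by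
    have h1 := leading_antitone (L := L) (H := H) hf hε hδ (by linarith) hx hy hxy
    have h2 : Real.logb 2 (2 + leading f L H ε δ y) ≤ Real.logb 2 (2 + leading f L H ε δ x) :=
      Real.logb_le_logb_of_le one_lt_two (by linarith [hX0 y]) (by linarith)
    have := hX0 x
    have := hlg0 y
    simp only [hKdef]
    gcongr
  have hloop : ∀ x, 0 < x → (epsApprox B S (toDelta (f x)) L H hL (5 / 6)
      (δ / (2 * (2 + Real.logb 2 (H / L))))).CostLE (K x) := fun x hx => by
    refine costLE_epsApprox_toDelta hL hLH hε hε2 (by linarith) (by norm_num) hδ hδ2 (by linarith)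
      (by linarith) ((hf ?_ hx ?_).trans (le_max_right _ _))
    · change 0 < x / (6 * (1 + 2 * Real.pi) ^ 2)
      positivity
    · refine div_le_self hx.le ?_
      nlinarith
  obtain ⟨n, hn, hn'⟩ := exists_pow_bound (H := H) hL hLH le_rfl
  rw [pow_succ] at hn'
  obtain ⟨h1, -, h3⟩ := decLoop_support hL hK hloop hK0 (n + 1) (by linarith)
    (by rw [pow_succ]; linarith) s hs
  refine ⟨h1, fun u hu => ?_⟩
  have hfin : (u.2 : ℝ) ≤ K s.1 := by
    split_ifs at hu with hlt
    · exact (Run.costLE_pure 0 u hu).trans (hK0 _)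
    · exact costLE_epsApprox_toDelta hL hLH hε hε2 le_rfl (by linarith) hδ hδ2 (by norm_num)
        (by linarith) (le_max_right _ _) u hu
  have hKs := hK0 s.1
  have hn4 : ((n + 1 : ℕ) : ℝ) ≤ 4 * h := by
    push_cast
    linarith
  -- At most 4h rounds of the loop and one final estimation, each costing at most `K s.1`.
  have hsb : sampleBound f L H ε δ s.1 = 5 * h * K s.1 := by
    rw [sampleBound, ← hh]
    ring
  have e1 : ((n + 1 : ℕ) : ℝ) * K s.1 ≤ 4 * h * K s.1 := by gcongr
  have e2 : K s.1 ≤ h * K s.1 := le_mul_of_one_le_left hKs hh1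
  rw [hsb]
  push_cast at *
  linarith

theorem sampleBound_antitone (hf : AntitoneOn f (Set.Ioi 0)) (hε : 0 < ε) (hδ : 0 < δ)
    (hδ1 : δ ≤ 1) : AntitoneOn (sampleBound f L H ε δ) (Set.Ioi 0) := by
  intro x hx y hy hxy
  have h1 := leading_antitone (L := L) (H := H) hf hε hδ hδ1 hx hy hxy
  have h2 := leading_nonneg (f := f) (L := L) (H := H) hε hδ hδ1 x
  have h3 := leading_nonneg (f := f) (L := L) (H := H) hε hδ hδ1 y
  have h4 : Real.logb 2 (2 + leading f L H ε δ y) ≤ Real.logb 2 (2 + leading f L H ε δ x) :=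
    Real.logb_le_logb_of_le one_lt_two (by linarith) (by linarith)
  have h5 : 0 ≤ Real.logb 2 (2 + leading f L H ε δ y) :=
    Real.logb_nonneg one_lt_two (by linarith)
  have h6 : 0 ≤ max 1 (Real.logb 2 (H / L)) := zero_le_one.trans (le_max_left _ _)
  unfold sampleBound
  gcongr

/-- The loop never ends below L/4, so the bound at L/4 holds on every run. It settles the indices ℓ
with 2^(-ℓ)μ ≤ L/4, which include all of them when μ = 0. -/
theorem le_sampleBound_of_le (hL : 0 < L) (hLH : L < H) (hε : 0 < ε) (hε2 : ε < 1 / 2)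
    (hδ : 0 < δ) (hδ2 : δ < 1 / 2) (hf : AntitoneOn f (Set.Ioi 0)) {x : ℝ} (hx : x ≤ L / 4) :
    ∀ r ∈ (epsApproxDec B S f L H hL ε δ).law.support,
      (r.2 : ℝ) ≤ sampleBound f L H ε δ (max (L / 4) x) := by
  intro r hr
  obtain ⟨s, hs, u, hu, rfl⟩ := Run.mem_support_bind.1 hr
  obtain ⟨h1, h2⟩ := exists_threshold_of_mem_support hL hLH hε hε2 hδ hδ2 hf hs
  have h4 : 0 < L / 4 := by linarith
  rw [max_eq_left hx]
  exact (h2 u hu).trans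
    (sampleBound_antitone hf hε hδ (by linarith) h4 (h4.trans_le h1) h1)

/-- The number of quantum samples has an exponentially decaying tail. -/
theorem prob_sampleBound_lt_le (hS : IsSampler B S d) (hL : 0 < L) (hLH : L < H) (hε : 0 < ε)
    (hε2 : ε < 1 / 2) (hδ : 0 < δ) (hδ2 : δ < 1 / 2) (hf : AntitoneOn f (Set.Ioi 0))
    (hfμ : 0 < mean d → phi d / mean d ≤ f (mean d)) (hμH : mean d < H) {ℓ : ℕ} (hℓ : 1 ≤ ℓ) :
    prob (epsApproxDec B S f L H hL ε δ).law
      {r | sampleBound f L H ε δ (max (L / 4) (2⁻¹ ^ ℓ * mean d)) < r.2} ≤ δ ^ (ℓ + 1) := by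
  rcases le_or_gt (2⁻¹ ^ ℓ * mean d) (L / 4) with h | h
  · rw [prob_eq_zero]
    · positivity
    · exact fun r hr => not_lt.2 (le_sampleBound_of_le hL hLH hε hε2 hδ hδ2 hf h r hr)
  · have hμ0 := mean_nonneg d
    have hlog : 0 ≤ Real.logb 2 (H / L) :=
      Real.logb_nonneg one_lt_two ((one_le_div hL).2 hLH.le)
    have hhalf : (2⁻¹ : ℝ) ^ ℓ ≤ 2⁻¹ := by
      refine (pow_le_pow_of_le_one (by norm_num) (by norm_num) hℓ).trans (pow_one _).le
    have hLμ : L ≤ 2 * mean d := by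
      have : (2⁻¹ : ℝ) ^ ℓ * mean d ≤ 2⁻¹ * mean d := by gcongr
      linarith
    have hμ : 0 < mean d := by linarith
    obtain ⟨n, hn⟩ := pow_unbounded_of_one_lt (2 * H / (L / 2)) (one_lt_two : (1 : ℝ) < 2)
    rw [div_lt_iff₀ (by positivity)] at hn
    have hstart : (2 : ℝ) ^ ℓ * (2⁻¹ ^ ℓ * mean d) ≤ 2 * H := by
      rw [← mul_assoc, ← mul_pow, mul_inv_cancel₀ two_ne_zero, one_pow, one_mul]
      linarith
    have hloop := pr_decLoop_lt (δ := δ / (2 * (2 + Real.logb 2 (H / L)))) (m := 0) hS hL hLH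
      (by positivity) hf (hfμ hμ) hLμ hμH ℓ n le_rfl hstart hn
    refine (Run.prob_law_bind_le _ _ (Prod.fst ⁻¹' {x | x < 2⁻¹ ^ ℓ * mean d}) _ ?_).trans
      (hloop.trans ?_)
    · intro s hs hsA u hu
      obtain ⟨h1, h2⟩ := exists_threshold_of_mem_support hL hLH hε hε2 hδ hδ2 hf hs
      have hsA' : 2⁻¹ ^ ℓ * mean d ≤ s.1 := not_lt.1 hsA
      have h4 : 0 < L / 4 := by linarith
      refine not_lt.2 ((h2 u hu).trans ?_)
      exact sampleBound_antitone hf hε hδ (by linarith) (lt_max_of_lt_left h4) (h4.trans_le h1)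
        (max_le h1 hsA')
    · have hδ' : δ / (2 * (2 + Real.logb 2 (H / L))) ≤ δ := div_le_self hδ.le (by linarith)
      calc ((δ / (2 * (2 + Real.logb 2 (H / L)))) ^ 3) ^ ℓ ≤ (δ ^ 3) ^ ℓ := by gcongr
        _ = δ ^ (3 * ℓ) := (pow_mul _ _ _).symm
        _ ≤ δ ^ (ℓ + 1) := pow_le_pow_of_le_one hδ.le (by linarith) (by omega)

end Total

/-- A random variable `N` whose tails beyond the thresholds `b 1, b 2, …` decay like `δ ^ (ℓ + 1)`
is bounded by `b T` for a random index `T` with `Pr(T = ℓ) ≤ δ ^ ℓ` for `ℓ > 1`. -/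
theorem exists_index {α : Type*} (p : PMF α) (N : α → ℝ) (b : ℕ → ℝ) {δ : ℝ} (hδ : 0 < δ)
    (hδ1 : δ ≤ 1) (hN : ∀ a ∈ p.support, ∃ ℓ, 1 ≤ ℓ ∧ N a ≤ b ℓ)
    (htail : ∀ ℓ, 1 ≤ ℓ → prob p {a | b ℓ < N a} ≤ δ ^ (ℓ + 1)) :
    ∃ T : α → ℕ, (∀ a, 1 ≤ T a) ∧
      ENNReal.ofReal (1 - δ) ≤ p.toOuterMeasure {a | T a = 1} ∧
      (∀ ℓ : ℕ, 1 < ℓ → p.toOuterMeasure {a | T a = ℓ} ≤ ENNReal.ofReal (δ ^ ℓ)) ∧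
      ∀ a ∈ p.support, N a ≤ b (T a) := by
  classical
  -- The least index whose bound holds; the default 1 occurs only off the support. T = ℓ > 1 means
  -- that bound ℓ - 1 is violated, which explains the shifted exponent in `htail`.
  let T : α → ℕ := fun a => if h : ∃ ℓ, 1 ≤ ℓ ∧ N a ≤ b ℓ then Nat.find h else 1
  have hlt : ∀ a ℓ, 1 ≤ ℓ → ℓ < T a → b ℓ < N a := fun a ℓ hℓ hT => by
    by_cases h : ∃ ℓ, 1 ≤ ℓ ∧ N a ≤ b ℓ
    · simp only [T, dif_pos h] at hT
      exact not_le.1 fun hle => Nat.find_min h hT ⟨hℓ, hle⟩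
    · simp only [T, dif_neg h] at hT
      omega
  have hT1 : ∀ a, 1 ≤ T a := fun a => by
    by_cases h : ∃ ℓ, 1 ≤ ℓ ∧ N a ≤ b ℓ
    · simp only [T, dif_pos h]
      exact (Nat.find_spec h).1
    · simp only [T, dif_neg h, le_refl]
  refine ⟨T, hT1, ?_, fun ℓ hℓ => ?_, fun a ha => ?_⟩
  · refine ofReal_le_toOuterMeasure p ((prob_mono p fun a ha => ?_).trans
      ((htail 1 le_rfl).trans (pow_le_of_le_one hδ.le hδ1 two_ne_zero)))
    have ha' : T a ≠ 1 := ha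
    exact hlt a 1 le_rfl (lt_of_le_of_ne (hT1 a) ha'.symm)
  · rw [← ofReal_prob]
    refine ENNReal.ofReal_le_ofReal ((prob_mono p fun a ha => ?_).trans
      ((htail (ℓ - 1) (by omega)).trans (le_of_eq (by rw [Nat.sub_add_cancel hℓ.le]))))
    have ha' : T a = ℓ := ha
    exact hlt a (ℓ - 1) (by omega) (by omega)
  · simp only [T, dif_pos (hN a ha)]
    exact (Nat.find_spec (hN a ha)).2

end QuantumMean

end

/-! ### Assembly of accuracy, upper bound and cost -/

theorem mainTheorem5 : ∃ (C : ℝ) (k : ℕ), 0 < C ∧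
    ∀ (G : Type*) [NormedAddCommGroup G] [InnerProductSpace ℂ G] [CompleteSpace G]
      (Ω : Finset ℝ≥0) (B : QuantumMean.Blank G Ω)
      (S : QuantumMean.Reg G Ω ≃ₗᵢ[ℂ] QuantumMean.Reg G Ω) (d : PMF Ω)
      (f : ℝ → ℝ) (L H ε δ : ℝ) (hL : 0 < L),
      QuantumMean.IsSampler B S d →
      AntitoneOn f (Set.Ioi 0) →
      (0 < QuantumMean.mean d → QuantumMean.phi d / QuantumMean.mean d ≤ f (QuantumMean.mean d)) →
      L < H → 0 < ε → ε < 1 / 2 → 0 < δ → δ < 1 / 2 →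
      let μ : ℝ := QuantumMean.mean d
      let law : PMF (ℝ × ℕ) := (QuantumMean.epsApproxDec B S f L H hL ε δ).law
      (L ≤ μ → μ < H →
        ENNReal.ofReal (1 - δ) ≤ law.toOuterMeasure {r | |r.1 - μ| ≤ ε * μ}) ∧
      ENNReal.ofReal (1 - δ) ≤ law.toOuterMeasure {r | r.1 ≤ (1 + 2 * Real.pi) ^ 2 * μ} ∧
      (μ < H → ∃ T : ℝ × ℕ → ℕ, (∀ r, 1 ≤ T r) ∧
        ENNReal.ofReal (1 - δ) ≤ law.toOuterMeasure {r | T r = 1} ∧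
        (∀ ℓ : ℕ, 1 < ℓ → law.toOuterMeasure {r | T r = ℓ} ≤ ENNReal.ofReal (δ ^ ℓ)) ∧
        ∀ r ∈ law.support,
          let h : ℝ := max 1 (Real.logb 2 (H / L))
          let F : ℝ := max 1
            (f (max (L / 4) ((2 : ℝ)⁻¹ ^ T r * μ) / (6 * (1 + 2 * Real.pi) ^ 2)))
          let X : ℝ := F * ε⁻¹ * h * Real.logb 2 (1 / δ)
          (r.2 : ℝ) ≤ C * (X * h) * Real.logb 2 (2 + X) ^ k) := by
  refine ⟨5 * 10 ^ 12, 3, by norm_num, ?_⟩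
  intro G _ _ _ Ω B S d f L H ε δ hL hS hf hfμ hLH hε hε2 hδ hδ2 μ law
  have hδ3 : δ ^ 3 ≤ δ := pow_le_of_le_one hδ.le (by linarith) three_ne_zero
  refine ⟨fun hLμ hμH => ?_, ?_, fun hμH => ?_⟩
  · have hfar := QuantumMean.pr_epsApproxDec_far hS hL hLH hδ hε (by linarith) hf
      (hfμ (hL.trans_le hLμ)) hLμ hμH
    refine QuantumMean.ofReal_le_toOuterMeasure law ((QuantumMean.prob_mono law ?_).trans
      (hfar.trans hδ3))
    intro r (hr : ¬|r.1 - μ| ≤ ε * μ)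
    exact not_le.1 hr
  · have hup := QuantumMean.pr_epsApproxDec_upper (H := H) (ε := ε) (f := f) hS hL hδ
    refine QuantumMean.ofReal_le_toOuterMeasure law ((QuantumMean.prob_mono law ?_).trans
      (hup.trans hδ3))
    intro r (hr : ¬r.1 ≤ (1 + 2 * Real.pi) ^ 2 * μ)
    exact not_le.1 hr
  · refine QuantumMean.exists_index law (fun r => (r.2 : ℝ))
      (fun ℓ => QuantumMean.sampleBound f L H ε δ (max (L / 4) ((2 : ℝ)⁻¹ ^ ℓ * μ)))
      hδ (by linarith) (fun r hr => ?_)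
      fun ℓ hℓ => QuantumMean.prob_sampleBound_lt_le hS hL hLH hε hε2 hδ hδ2 hf hfμ hμH hℓ
    have hμ : 0 ≤ μ := QuantumMean.mean_nonneg d
    -- Every run satisfies some bound: for large ℓ the level 2^(-ℓ)μ is below L/4. Dividing by μ + 1
    -- covers μ = 0.
    obtain ⟨n, hn⟩ := exists_pow_lt_of_lt_one (show 0 < L / 4 / (μ + 1) by positivity)
      (show (2 : ℝ)⁻¹ < 1 by norm_num)
    rw [lt_div_iff₀ (by positivity)] at hn
    have hn1 : (2 : ℝ)⁻¹ ^ (n + 1) * μ ≤ L / 4 := by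
      refine le_trans ?_ hn.le
      exact mul_le_mul (pow_le_pow_of_le_one (by norm_num) (by norm_num) (Nat.le_succ n))
        (by linarith) hμ (by positivity)
    exact ⟨n + 1, by omega,
      QuantumMean.le_sampleBound_of_le hL hLH hε hε2 hδ hδ2 hf hn1 r hr⟩
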